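/- There are an integer $c\ge 1$, a constant $C\ge 1$, a randomized word-RAM program $\mathsf{Pre}$ and a deterministic word-RAM program $\mathsf{Query}$ such that, writing $L(n) = C\,(\lfloor\log_2 n\rfloor+1)^{C}$, the following holds for all integers $1\le \ell\le k\le n$ and every finite alphabet $\Sigma$. The machine has words of $c\cdot(|n|_2+|\Sigma|_2)$ bits, where $|m|_2$ is the number of binary digits of $m$; arithmetic, comparisons, reading and writing an array entry, and drawing a uniformly random word take unit time; the numbers $n,k,\ell,|\Sigma|$ are given to both programs. $\operatorname{ED}$ is the edit distance (the least number of insertions, deletions and substitutions of single characters). 1. (Preprocessing.) For every $A\in\Sigma^n$, the expected running time of $\mathsf{Pre}$ on $A$ is at most $L(n)\cdot nk/\ell$, i.e. $\tilde O(nk/\ell)$. 2. (Query.) Let $A,B\in\Sigma^n$, and let $\mathsf{Pre}$ be run separately on $A$ and on $B$, the two runs using the same random tape. $\mathsf{Query}$ has access to $A$, $B$ and the two outputs of $\mathsf{Pre}$. Whenever both runs of $\mathsf{Pre}$ halt, $\mathsf{Query}$ halts after at most $L(n)\cdot k^2/\ell$ steps, i.e. in $\tilde O(k^2/\ell)$ time.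 3. (Correctness.) Over the random bits of the preprocessing: if $\operatorname{ED}(A,B)\le k/L(n)$, then with probability at least $1-\frac1n$ all runs halt and $\mathsf{Query}$ answers SMALL; if $\operatorname{ED}(A,B)\ge C k\ell$, then with probability at least $1-\frac1n$ all runs halt and $\mathsf{Query}$ answers LARGE. -/

import Mathlib

open MeasureTheory
open scoped ENNReal

/-! ### Edit distance -/

/-- `EditScript x y d`: reading from left to right, `x` can be turned into `y` with `d` insertions,
deletions and substitutions of single characters (keeping a character is free). -/
inductive EditScript {α : Type*} : List α → List α → ℕ → Prop
  | nil : EditScript [] [] 0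
  | keep {x y : List α} {d : ℕ} (a : α) : EditScript x y d → EditScript (a :: x) (a :: y) d
  | subst {x y : List α} {d : ℕ} (a b : α) :
      EditScript x y d → EditScript (a :: x) (b :: y) (d + 1)
  | delete {x y : List α} {d : ℕ} (a : α) : EditScript x y d → EditScript (a :: x) y (d + 1)
  | insert {x y : List α} {d : ℕ} (b : α) : EditScript x y d → EditScript x (b :: y) (d + 1)

/-- Some edit script always exists, so the infimum in `editDist` is a minimum. -/
theorem EditScript.exists_script {α : Type*} (x y : List α) : ∃ d, EditScript x y d := by
  induction x with
  | nil =>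
    induction y with
    | nil => exact ⟨0, .nil⟩
    | cons b y ih => obtain ⟨d, h⟩ := ih; exact ⟨d + 1, h.insert b⟩
  | cons a x ih => obtain ⟨d, h⟩ := ih; exact ⟨d + 1, h.delete a⟩

/-- The edit distance of two strings: the least number of single-character insertions, deletions
and substitutions that turn one into the other. -/
noncomputable def editDist {α : Type*} {n m : ℕ} (A : Fin n → α) (B : Fin m → α) : ℕ :=
  sInf {d | EditScript (List.ofFn A) (List.ofFn B) d}

/-! ### A randomized word RAM

All values are words of `w` bits (numbers below `2 ^ w`).  A program uses finitely many registers
and finitely many arrays, each array being indexed by words.  Random words are read one after the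
other from a tape of independent uniform words. -/

/-- The unit-cost operations on words.  Comparisons return `1` (true) or `0` (false). -/
inductive WordOp
  | add | sub | mul | div | mod | lt | eq

/-- Arithmetic is modulo `2 ^ w`; division by `0` returns `0`, and `a mod 0 = a`. -/
def WordOp.eval (w : ℕ) : WordOp → ℕ → ℕ → ℕ
  | .add, a, b => (a + b) % 2 ^ w
  | .sub, a, b => (a + (2 ^ w - b % 2 ^ w)) % 2 ^ w
  | .mul, a, b => (a * b) % 2 ^ w
  | .div, a, b => (a / b) % 2 ^ w
  | .mod, a, b => (a % b) % 2 ^ w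
  | .lt, a, b => (if a < b then 1 else 0) % 2 ^ w
  | .eq, a, b => (if a = b then 1 else 0) % 2 ^ w

/-- Programs.  Registers and arrays are named by numerals that occur in the program text. -/
inductive Prog
  | skip
  /-- `x := v`, for a numeral `v` of the program text -/
  | const (x v : ℕ)
  /-- `x := y op z`, for registers `x`, `y`, `z` -/
  | op (o : WordOp) (x y z : ℕ)
  /-- `x := b[y]`, for registers `x`, `y` and the array `b` -/
  | load (x b y : ℕ)
  /-- `b[y] := x`, for registers `x`, `y` and the array `b` -/
  | store (b y x : ℕ)
  /-- `x :=` the next random word -/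
  | rand (x : ℕ)
  | seq (p q : Prog)
  /-- run `p` if register `x` is nonzero, else `q` -/
  | ite (x : ℕ) (p q : Prog)
  /-- repeat `p` as long as register `x` is nonzero -/
  | while (x : ℕ) (p : Prog)

/-- The program uses no randomness. -/
def Prog.Deterministic : Prog → Prop
  | .rand _ => False
  | .seq p q => p.Deterministic ∧ q.Deterministic
  | .ite _ p q => p.Deterministic ∧ q.Deterministic
  | .while _ p => p.Deterministic
  | _ => True

/-- A configuration of the machine: the registers, the arrays (`mem b i` is entry `i` of array `b`)
and the number of random words read so far. -/
structure Config where
  reg : ℕ → ℕ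
  mem : ℕ → ℕ → ℕ
  pos : ℕ

/-- The configuration after `x := v`. -/
def Config.setReg (s : Config) (x v : ℕ) : Config :=
  { s with reg := Function.update s.reg x v }

/-- The configuration after `b[i] := v`. -/
def Config.setMem (s : Config) (b i v : ℕ) : Config :=
  { s with mem := Function.update s.mem b (Function.update (s.mem b) i v) }

/-- A tape of random `w`-bit words. -/
abbrev Tape (w : ℕ) : Type := ℕ → Fin (2 ^ w)

/-- `Exec w ω p s t s'`: with word length `w` and random tape `ω`, the program `p` started in `s`
halts in `s'` after exactly `t` steps.  Each instruction and each test costs one step. -/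
inductive Exec (w : ℕ) (ω : Tape w) : Prog → Config → ℕ → Config → Prop
  | skip (s : Config) : Exec w ω .skip s 1 s
  | const (s : Config) (x v : ℕ) : Exec w ω (.const x v) s 1 (s.setReg x (v % 2 ^ w))
  | op (s : Config) (o : WordOp) (x y z : ℕ) :
      Exec w ω (.op o x y z) s 1 (s.setReg x (o.eval w (s.reg y) (s.reg z)))
  | load (s : Config) (x b y : ℕ) : Exec w ω (.load x b y) s 1 (s.setReg x (s.mem b (s.reg y)))
  | store (s : Config) (b y x : ℕ) :
      Exec w ω (.store b y x) s 1 (s.setMem b (s.reg y) (s.reg x))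
  | rand (s : Config) (x : ℕ) :
      Exec w ω (.rand x) s 1 { s.setReg x (ω s.pos) with pos := s.pos + 1 }
  | seq {p q : Prog} {s s' s'' : Config} {t t' : ℕ} :
      Exec w ω p s t s' → Exec w ω q s' t' s'' → Exec w ω (.seq p q) s (t + t') s''
  | iteTrue {x : ℕ} {p q : Prog} {s s' : Config} {t : ℕ} :
      s.reg x ≠ 0 → Exec w ω p s t s' → Exec w ω (.ite x p q) s (t + 1) s'
  | iteFalse {x : ℕ} {p q : Prog} {s s' : Config} {t : ℕ} :
      s.reg x = 0 → Exec w ω q s t s' → Exec w ω (.ite x p q) s (t + 1) s'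
  | whileTrue {x : ℕ} {p : Prog} {s s' s'' : Config} {t t' : ℕ} :
      s.reg x ≠ 0 → Exec w ω p s t s' → Exec w ω (.while x p) s' t' s'' →
      Exec w ω (.while x p) s (t + t' + 1) s''
  | whileFalse {x : ℕ} {p : Prog} {s : Config} :
      s.reg x = 0 → Exec w ω (.while x p) s 1 s

/-- Once the tape is fixed, the running time and the final configuration are determined. -/
theorem Exec.unique {w : ℕ} {ω : Tape w} {p : Prog} {s s₁ s₂ : Config} {t₁ t₂ : ℕ}
    (h₁ : Exec w ω p s t₁ s₁) (h₂ : Exec w ω p s t₂ s₂) : t₁ = t₂ ∧ s₁ = s₂ := by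
  induction h₁ generalizing t₂ s₂ with
  | seq _ _ ih ih' =>
    cases h₂ with
    | seq a b => obtain ⟨rfl, rfl⟩ := ih a; obtain ⟨rfl, rfl⟩ := ih' b; exact ⟨rfl, rfl⟩
  | iteTrue hx _ ih =>
    cases h₂ with
    | iteTrue _ a => obtain ⟨rfl, rfl⟩ := ih a; exact ⟨rfl, rfl⟩
    | iteFalse hx' _ => exact absurd hx' hx
  | iteFalse hx _ ih =>
    cases h₂ with
    | iteTrue hx' _ => exact absurd hx hx'
    | iteFalse _ a => obtain ⟨rfl, rfl⟩ := ih a; exact ⟨rfl, rfl⟩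
  | whileTrue hx _ _ ih ih' =>
    cases h₂ with
    | whileTrue _ a b => obtain ⟨rfl, rfl⟩ := ih a; obtain ⟨rfl, rfl⟩ := ih' b; exact ⟨rfl, rfl⟩
    | whileFalse hx' => exact absurd hx' hx
  | whileFalse hx =>
    cases h₂ with
    | whileTrue hx' _ _ => exact absurd hx hx'
    | whileFalse _ => exact ⟨rfl, rfl⟩
  | _ => cases h₂; exact ⟨rfl, rfl⟩

/-- The running time of `p` started in `s`; it is `∞` if `p` does not halt. -/
noncomputable def runTime (w : ℕ) (ω : Tape w) (p : Prog) (s : Config) : ℝ≥0∞ :=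
  ⨅ (t : ℕ) (s' : Config) (_ : Exec w ω p s t s'), (t : ℝ≥0∞)

/-- The law of the random tape: independent uniformly distributed `w`-bit words. -/
noncomputable def tapeLaw (w : ℕ) : Measure (Tape w) :=
  Measure.infinitePi fun _ => (PMF.uniformOfFintype (Fin (2 ^ w))).toMeasure

/-- The word length for strings of length `n` over an alphabet of `σ` characters, a multiple of
(the number of binary digits of `n`) + (the number of binary digits of `σ`). -/
def wordLength (c n σ : ℕ) : ℕ := c * (Nat.size n + Nat.size σ)

/-! ### Two-sided preprocessing -/

/-- A string as the contents of an array. -/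
def stringArray {n σ : ℕ} (A : Fin n → Fin σ) : ℕ → ℕ :=
  fun i => if h : i < n then (A ⟨i, h⟩ : ℕ) else 0

/-- The parameters are handed over in the first four registers; all others are `0`. -/
def paramRegs (n k l σ : ℕ) : ℕ → ℕ
  | 0 => n
  | 1 => k
  | 2 => l
  | 3 => σ
  | _ => 0

/-- Start of the preprocessing of one string: array `0` holds the string, all others are `0`. -/
def preInit {n σ : ℕ} (k l : ℕ) (A : Fin n → Fin σ) : Config where
  reg := paramRegs n k l σ
  mem
    | 0 => stringArray A
    | _ => fun _ => 0
  pos := 0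

/-- `PreOut w ω pre k l A D`: run on the string `A` with the random tape `ω`, the preprocessing
halts with output `D`, the final contents of array `1`. -/
def PreOut (w : ℕ) (ω : Tape w) (pre : Prog) {n σ : ℕ} (k l : ℕ) (A : Fin n → Fin σ)
    (D : ℕ → ℕ) : Prop :=
  ∃ t s, Exec w ω pre (preInit k l A) t s ∧ s.mem 1 = D

/-- Start of a query: arrays `0` and `1` hold the two strings, arrays `2` and `3` hold the outputs
of their preprocessing, all others are `0`. -/
def queryInit {n σ : ℕ} (k l : ℕ) (A B : Fin n → Fin σ) (DA DB : ℕ → ℕ) : Config where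
  reg := paramRegs n k l σ
  mem
    | 0 => stringArray A
    | 1 => stringArray B
    | 2 => DA
    | 3 => DB
    | _ => fun _ => 0
  pos := 0

/-- With the random tape `ω`, both runs of the preprocessing (one on `A`, one on `B`, both reading
the tape from its beginning) and the query halt, and the query leaves the answer `ans` in
register `0`. -/
def Answers (w : ℕ) (ω : Tape w) (pre query : Prog) {n σ : ℕ} (k l : ℕ) (A B : Fin n → Fin σ)
    (ans : ℕ) : Prop :=
  ∃ DA DB t s, PreOut w ω pre k l A DA ∧ PreOut w ω pre k l B DB ∧
    Exec w ω query (queryInit k l A B DA DB) t s ∧ s.reg 0 = ans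

/-- A polylogarithmic factor `C * (⌊log₂ n⌋ + 1) ^ C`. -/
def polylog (C n : ℕ) : ℕ := C * (Nat.log 2 n + 1) ^ C

/-! The algorithm is a diagonal-by-diagonal search for furthest reaching positions, made coarser in
two ways. Diagonals are grouped into about `2 * k / l` blocks of width `l`, and common windows are
recognised only at lengths that are powers of two, by fingerprints.

Preprocessing fingerprints every window of length `2 ^ j` by hashing the pair of fingerprints of its
two halves with a random multiplier, one multiplier per level. Besides the fingerprints it stores,
for each level, each block of `l` positions and each fingerprint, a mark telling whether some window
there has that fingerprint. This takes about `n * log n` steps, within the allowance because `l ≤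
k`. Both runs read the same multipliers, so their fingerprints are comparable.

A query makes `k` rounds. In each round every block starts from the best front on itself and its two
neighbours, jumps over the longest window of the first string that matches somewhere on the block,
and advances by one more letter. Two mark lookups per level replace a search through the diagonals
of the block, so the time is about `k * (k / l) * log n`.

Close strings: a run of kept letters is passed in `L` rounds, about `log n`, since each jump at
least halves the rest, and each edit takes one more round (`le_front_add_div`, `exists_le_front`).
Hence `k` rounds suffice for `d` edits once `3 * d * L ≤ k`. Equal windows always have equal
fingerprints, so this direction never errs; equal strings are recognised by comparing fingerprints
of the whole.

Far strings: in the absence of collisions, each round is realised by an alignment of cost at most `8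
* l`, because only the diagonal inside a block is uncertain (`prefixED_front`). A front at the end
of the string therefore forces edit distance at most `12 * k * l` (`editDist_le_of_front`).
Collisions are rare by `card_mulHash_collision_le` and a union bound over levels and pairs of
positions (`tapeLaw_exists_collide_le`, `hash_failure_le`).

The programs are verified with timed Hoare triples `Tri`, the numerical side conditions being
collected in `Sizes`. -/

/-! ### Compiling arithmetic expressions, and timed Hoare triples -/

/-- The operation on natural numbers that a word operation computes when nothing overflows. -/
def WordOp.nat : WordOp → ℕ → ℕ → ℕ
  | .add, a, b => a + b
  | .sub, a, b => a - b
  | .mul, a, b => a * b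
  | .div, a, b => a / b
  | .mod, a, b => a % b
  | .lt, a, b => if a < b then 1 else 0
  | .eq, a, b => if a = b then 1 else 0

/-- The operation does not overflow on these operands. -/
def WordOp.Fits (w : ℕ) : WordOp → ℕ → ℕ → Prop
  | .add, a, b => a + b < 2 ^ w
  | .sub, a, b => b ≤ a ∧ a < 2 ^ w
  | .mul, a, b => a * b < 2 ^ w
  | .div, a, _ => a < 2 ^ w
  | .mod, a, _ => a < 2 ^ w
  | .lt, _, _ => 1 < 2 ^ w
  | .eq, _, _ => 1 < 2 ^ w

theorem WordOp.Fits.eval_eq {w : ℕ} {o : WordOp} {a b : ℕ} (h : o.Fits w a b) :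
    o.eval w a b = o.nat a b := by
  cases o <;> simp only [WordOp.Fits, WordOp.eval, WordOp.nat] at *
  · exact Nat.mod_eq_of_lt h
  · rw [Nat.mod_eq_of_lt (lt_of_le_of_lt h.1 h.2),
      show a + (2 ^ w - b) = (a - b) + 2 ^ w by omega, Nat.add_mod_right]
    exact Nat.mod_eq_of_lt (by omega)
  · exact Nat.mod_eq_of_lt h
  · exact Nat.mod_eq_of_lt (lt_of_le_of_lt (Nat.div_le_self _ _) h)
  · exact Nat.mod_eq_of_lt (lt_of_le_of_lt (Nat.mod_le _ _) h)
  · split_ifs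
    · exact Nat.mod_eq_of_lt h
    · simp
  · split_ifs
    · exact Nat.mod_eq_of_lt h
    · simp

/-- Arithmetic expressions.  `bin` is meant for operations that do not overflow, `wrap` for
operations modulo the word size. -/
inductive Exp
  | var (x : ℕ)
  | num (v : ℕ)
  | bin (o : WordOp) (a b : Exp)
  | wrap (o : WordOp) (a b : Exp)
  | max (a b : Exp)
  | get (arr : ℕ) (i : Exp)

namespace Exp

/-- The value of an expression. -/
def val (w : ℕ) (s : Config) : Exp → ℕ
  | var x => s.reg x
  | num v => v
  | bin o a b => o.nat (a.val w s) (b.val w s)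
  | wrap o a b => o.eval w (a.val w s) (b.val w s)
  | max a b => Max.max (a.val w s) (b.val w s)
  | get arr i => s.mem arr (i.val w s)

/-- No operation of the expression overflows. -/
def Fits (w : ℕ) (s : Config) : Exp → Prop
  | var x => s.reg x < 2 ^ w
  | num v => v < 2 ^ w
  | bin o a b => a.Fits w s ∧ b.Fits w s ∧ o.Fits w (a.val w s) (b.val w s)
  | wrap _ a b => a.Fits w s ∧ b.Fits w s
  | max a b => a.Fits w s ∧ b.Fits w s ∧ 1 < 2 ^ w ∧ b.val w s < 2 ^ w
  | get _ i => i.Fits w s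

/-- Only registers below `32` occur; the others hold intermediate results. -/
def Low : Exp → Prop
  | var x => x < 32
  | num _ => True
  | bin _ a b => a.Low ∧ b.Low
  | wrap _ a b => a.Low ∧ b.Low
  | max a b => a.Low ∧ b.Low
  | get _ i => i.Low

/-- Code that computes the expression into register `d`, using only registers from `d` on. -/
def comp : Exp → ℕ → Prog
  | var x, d => .seq (.const d 0) (.op .add d x d)
  | num v, d => .const d v
  | bin o a b, d => .seq (a.comp d) (.seq (b.comp (d + 1)) (.op o d d (d + 1)))
  | wrap o a b, d => .seq (a.comp d) (.seq (b.comp (d + 1)) (.op o d d (d + 1)))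
  | max a b, d => .seq (a.comp d) (.seq (b.comp (d + 1)) (.seq (.op .lt (d + 2) d (d + 1))
      (.ite (d + 2) (.seq (.const (d + 2) 0) (.op .add d (d + 1) (d + 2))) .skip)))
  | get arr i, d => .seq (i.comp d) (.load d arr d)

/-- A bound on the time of the compiled code. -/
def cost : Exp → ℕ
  | var _ => 2
  | num _ => 1
  | bin _ a b => a.cost + (b.cost + 1)
  | wrap _ a b => a.cost + (b.cost + 1)
  | max a b => a.cost + (b.cost + 4)
  | get _ i => i.cost + 1

theorem comp_deterministic (e : Exp) (d : ℕ) : (e.comp d).Deterministic := by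
  induction e generalizing d <;> simp_all [comp, Prog.Deterministic]

variable {w : ℕ} {s s' : Config}

theorem val_congr {e : Exp} (he : e.Low) (hr : ∀ r < 32, s'.reg r = s.reg r)
    (hm : s'.mem = s.mem) : e.val w s' = e.val w s := by
  induction e with
  | var x => exact hr x he
  | num v => rfl
  | bin o a b iha ihb => simp only [val, iha he.1, ihb he.2]
  | wrap o a b iha ihb => simp only [val, iha he.1, ihb he.2]
  | max a b iha ihb => simp only [val, iha he.1, ihb he.2]
  | get arr i ih => simp only [val, ih he, hm]

theorem fits_congr {e : Exp} (he : e.Low) (hr : ∀ r < 32, s'.reg r = s.reg r)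
    (hm : s'.mem = s.mem) (hf : e.Fits w s) : e.Fits w s' := by
  induction e with
  | var x => simpa only [Fits, hr x he] using hf
  | num v => exact hf
  | bin o a b iha ihb =>
    exact ⟨iha he.1 hf.1, ihb he.2 hf.2.1, by
      rw [val_congr he.1 hr hm, val_congr he.2 hr hm]; exact hf.2.2⟩
  | wrap o a b iha ihb => exact ⟨iha he.1 hf.1, ihb he.2 hf.2⟩
  | max a b iha ihb =>
    exact ⟨iha he.1 hf.1, ihb he.2 hf.2.1, hf.2.2.1, by
      rw [val_congr he.2 hr hm]; exact hf.2.2.2⟩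
  | get arr i ih => exact ih he hf

/-- Evaluation works like a stack: code with target `d` leaves all registers below `d` alone, so a
left operand in `d` survives the evaluation of the right operand in `d + 1`, and the registers below
`32` read by the expression never change. -/
theorem exec_comp (ω : Tape w) {e : Exp} (he : e.Low) {s : Config} (hf : e.Fits w s) {d : ℕ}
    (hd : 32 ≤ d) :
    ∃ t s', Exec w ω (e.comp d) s t s' ∧ t ≤ e.cost ∧ s'.reg d = e.val w s ∧
      (∀ r < d, s'.reg r = s.reg r) ∧ s'.mem = s.mem ∧ s'.pos = s.pos := by
  induction e generalizing s d with
  | var x =>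
    have hx : x ≠ d := by have : x < 32 := he; omega
    refine ⟨_, _, .seq (.const ..) (.op ..), le_rfl, ?_, ?_, rfl, rfl⟩
    · simpa [Config.setReg, WordOp.eval, hx, val] using Nat.mod_eq_of_lt hf
    · intro r hr; simp [Config.setReg, hr.ne]
  | num v =>
    refine ⟨_, _, .const .., le_rfl, ?_, ?_, rfl, rfl⟩
    · simpa [Config.setReg, val] using Nat.mod_eq_of_lt hf
    · intro r hr; simp [Config.setReg, hr.ne]
  | bin o a b iha ihb =>
    obtain ⟨t₁, s₁, e₁, c₁, v₁, r₁, m₁, p₁⟩ := iha he.1 hf.1 hd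
    have hr : ∀ r < 32, s₁.reg r = s.reg r := fun r hr => r₁ r (by omega)
    obtain ⟨t₂, s₂, e₂, c₂, v₂, r₂, m₂, p₂⟩ :=
      ihb he.2 (fits_congr he.2 hr m₁ hf.2.1) (d := d + 1) (by omega)
    refine ⟨_, _, .seq e₁ (.seq e₂ (.op ..)), ?_, ?_, ?_, ?_, ?_⟩
    · simp only [cost]; omega
    · simp only [Config.setReg, Function.update_self, val]
      rw [r₂ d (by omega), v₁, v₂, val_congr he.2 hr m₁, hf.2.2.eval_eq]
    · intro r hr; simp only [Config.setReg, ne_eq, hr.ne, not_false_eq_true,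
        Function.update_of_ne]; rw [r₂ r (by omega), r₁ r hr]
    · exact m₂.trans m₁
    · exact p₂.trans p₁
  | wrap o a b iha ihb =>
    obtain ⟨t₁, s₁, e₁, c₁, v₁, r₁, m₁, p₁⟩ := iha he.1 hf.1 hd
    have hr : ∀ r < 32, s₁.reg r = s.reg r := fun r hr => r₁ r (by omega)
    obtain ⟨t₂, s₂, e₂, c₂, v₂, r₂, m₂, p₂⟩ :=
      ihb he.2 (fits_congr he.2 hr m₁ hf.2) (d := d + 1) (by omega)
    refine ⟨_, _, .seq e₁ (.seq e₂ (.op ..)), ?_, ?_, ?_, ?_, ?_⟩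
    · simp only [cost]; omega
    · simp only [Config.setReg, Function.update_self, val]
      rw [r₂ d (by omega), v₁, v₂, val_congr he.2 hr m₁]
    · intro r hr; simp only [Config.setReg, ne_eq, hr.ne, not_false_eq_true,
        Function.update_of_ne]; rw [r₂ r (by omega), r₁ r hr]
    · exact m₂.trans m₁
    · exact p₂.trans p₁
  | max a b iha ihb =>
    obtain ⟨t₁, s₁, e₁, c₁, v₁, r₁, m₁, p₁⟩ := iha he.1 hf.1 hd
    have hr : ∀ r < 32, s₁.reg r = s.reg r := fun r hr => r₁ r (by omega)
    obtain ⟨t₂, s₂, e₂, c₂, v₂, r₂, m₂, p₂⟩ :=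
      ihb he.2 (fits_congr he.2 hr m₁ hf.2.1) (d := d + 1) (by omega)
    have va : s₂.reg d = a.val w s := by rw [r₂ d (by omega), v₁]
    have vb : s₂.reg (d + 1) = b.val w s := by rw [v₂, val_congr he.2 hr m₁]
    have hev : WordOp.lt.eval w (a.val w s) (b.val w s) =
        if a.val w s < b.val w s then 1 else 0 :=
      WordOp.Fits.eval_eq (o := .lt) hf.2.2.1
    by_cases hlt : a.val w s < b.val w s
    · refine ⟨_, _, .seq e₁ (.seq e₂ (.seq (.op ..)
        (.iteTrue ?_ (.seq (.const ..) (.op ..))))), ?_, ?_, ?_, ?_, ?_⟩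
      · simp only [Config.setReg, Function.update_self, va, vb, hev, if_pos hlt]; omega
      · simp only [cost]; omega
      · simpa [Config.setReg, WordOp.eval, val, vb, max_eq_right hlt.le] using
          Nat.mod_eq_of_lt hf.2.2.2
      · intro r hr
        simp [Config.setReg, hr.ne, show r ≠ d + 2 by omega, r₂ r (by omega), r₁ r hr]
      · exact m₂.trans m₁
      · exact p₂.trans p₁
    · refine ⟨_, _, .seq e₁ (.seq e₂ (.seq (.op ..) (.iteFalse ?_ (.skip _)))), ?_, ?_, ?_, ?_, ?_⟩
      · simp only [Config.setReg, Function.update_self, va, vb, hev, if_neg hlt]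
      · simp only [cost]; omega
      · simpa [Config.setReg, val, va] using hlt
      · intro r hr
        simp [Config.setReg, show r ≠ d + 2 by omega, r₂ r (by omega), r₁ r hr]
      · exact m₂.trans m₁
      · exact p₂.trans p₁
  | get arr i ih =>
    obtain ⟨t₁, s₁, e₁, c₁, v₁, r₁, m₁, p₁⟩ := ih he hf hd
    refine ⟨_, _, .seq e₁ (.load ..), ?_, ?_, ?_, m₁, p₁⟩
    · simp only [cost]; omega
    · simp [Config.setReg, val, v₁, m₁]
    · intro r hr; simp [Config.setReg, hr.ne, r₁ r hr]

end Exp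

/-- `x := e` -/
def assign (x : ℕ) (e : Exp) : Prog :=
  -- There is no instruction that copies a register; adding a zero takes its place.
  .seq (e.comp 32) (.seq (.const 33 0) (.op .add x 32 33))

/-- `arr[i] := e` -/
def put (arr : ℕ) (i e : Exp) : Prog :=
  .seq (i.comp 32) (.seq (e.comp 33) (.store arr 32 33))

theorem assign_deterministic (x : ℕ) (e : Exp) : (assign x e).Deterministic :=
  ⟨e.comp_deterministic _, trivial, trivial⟩

theorem put_deterministic (arr : ℕ) (i e : Exp) : (put arr i e).Deterministic :=
  ⟨i.comp_deterministic _, e.comp_deterministic _, trivial⟩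

/-! ### Timed Hoare triples. -/

/-- The two configurations agree except for intermediate results. -/
def Config.Sim (s h : Config) : Prop :=
  (∀ r < 32, s.reg r = h.reg r) ∧ s.mem = h.mem ∧ s.pos = h.pos

/-- Started in `h`, the program halts after at most `T` steps, and then `Q` holds. -/
def Tri (w : ℕ) (ω : Tape w) (p : Prog) (h : Config) (T : ℕ) (Q : Config → Prop) : Prop :=
  -- Ranging over all `s` similar to `h` makes the contents of the scratch registers irrelevant;
  -- `h'` is a representative of the final configuration that is free of scratch work.
  ∀ s : Config, s.Sim h → ∃ t s' h', Exec w ω p s t s' ∧ t ≤ T ∧ s'.Sim h' ∧ Q h'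

namespace Tri

variable {w : ℕ} {ω : Tape w} {p q : Prog} {h : Config} {T T' : ℕ} {Q R : Config → Prop}

theorem mono (H : Tri w ω p h T Q) (hT : T ≤ T') (hQ : ∀ h', Q h' → R h') :
    Tri w ω p h T' R := fun s hs => by
  obtain ⟨t, s', h', e, ht, hs', hq⟩ := H s hs
  exact ⟨t, s', h', e, ht.trans hT, hs', hQ _ hq⟩

theorem seq (H : Tri w ω p h T R) (H' : ∀ h', R h' → Tri w ω q h' T' Q) :
    Tri w ω (.seq p q) h (T + T') Q := fun s hs => by
  obtain ⟨t, s', h', e, ht, hs', hq⟩ := H s hs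
  obtain ⟨t₂, s₂, h₂, e₂, ht₂, hs₂, hq₂⟩ := H' h' hq s' hs'
  exact ⟨_, s₂, h₂, .seq e e₂, by omega, hs₂, hq₂⟩

theorem assign {x : ℕ} {e : Exp} (hx : x < 32) (he : e.Low) (hf : e.Fits w h)
    (hv : e.val w h < 2 ^ w) (hQ : Q (h.setReg x (e.val w h))) :
    Tri w ω (assign x e) h (e.cost + 2) Q := fun s hs => by
  obtain ⟨t, s', ex, ht, v, r, m, p⟩ :=
    Exp.exec_comp ω he (Exp.fits_congr he hs.1 hs.2.1 hf) le_rfl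
  rw [Exp.val_congr he hs.1 hs.2.1] at v
  refine ⟨_, _, _, .seq ex (.seq (.const ..) (.op ..)), by omega, ⟨?_, ?_, ?_⟩, hQ⟩
  · intro y hy
    by_cases hxy : y = x
    · subst hxy
      simpa [Config.setReg, WordOp.eval, v] using Nat.mod_eq_of_lt hv
    · simp [Config.setReg, hxy, show y ≠ 33 by omega, r y hy, hs.1 y hy]
  · exact m.trans hs.2.1
  · exact p.trans hs.2.2

theorem put {arr : ℕ} {i e : Exp} (hi : i.Low) (he : e.Low) (hfi : i.Fits w h) (hf : e.Fits w h)
    (hQ : Q (h.setMem arr (i.val w h) (e.val w h))) :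
    Tri w ω (put arr i e) h (i.cost + e.cost + 1) Q := fun s hs => by
  obtain ⟨t, s₁, ex, ht, v, r, m, p⟩ :=
    Exp.exec_comp ω hi (Exp.fits_congr hi hs.1 hs.2.1 hfi) le_rfl
  have hr₁ : ∀ r < 32, s₁.reg r = h.reg r := fun y hy => (r y hy).trans (hs.1 y hy)
  have hm₁ : s₁.mem = h.mem := m.trans hs.2.1
  obtain ⟨t₂, s₂, ex₂, ht₂, v₂, r₂, m₂, p₂⟩ :=
    Exp.exec_comp ω he (Exp.fits_congr he hr₁ hm₁ hf) (d := 33) (by omega)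
  rw [Exp.val_congr hi hs.1 hs.2.1] at v
  rw [Exp.val_congr he hr₁ hm₁] at v₂
  refine ⟨_, _, _, .seq ex (.seq ex₂ (.store ..)), by omega, ⟨?_, ?_, ?_⟩, hQ⟩
  · intro y hy
    simp [Config.setMem, r₂ y (by omega), hr₁ y hy]
  · simp [Config.setMem, r₂ 32 (by omega), v, v₂, m₂, hm₁]
  · exact p₂.trans (p.trans hs.2.2)

theorem rand {x : ℕ} (hQ : Q { h.setReg x (ω h.pos) with pos := h.pos + 1 }) :
    Tri w ω (.rand x) h 1 Q := fun s hs => by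
  refine ⟨_, _, _, .rand .., le_rfl, ⟨?_, ?_, ?_⟩, hQ⟩
  · intro y hy
    simp [Config.setReg, Function.update_apply, hs.1 y hy, hs.2.2]
  · exact hs.2.1
  · simp [hs.2.2]

theorem assign_seq {x : ℕ} {e : Exp} (hx : x < 32) (he : e.Low) (hf : e.Fits w h)
    (hv : e.val w h < 2 ^ w) (H : Tri w ω q (h.setReg x (e.val w h)) T Q) :
    Tri w ω (.seq (_root_.assign x e) q) h (e.cost + 2 + T) Q :=
  seq (R := fun h' => h' = h.setReg x (e.val w h)) (assign hx he hf hv rfl)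
    (fun _ h' => h' ▸ H)

theorem put_seq {arr : ℕ} {i e : Exp} (hi : i.Low) (he : e.Low) (hfi : i.Fits w h)
    (hf : e.Fits w h) (H : Tri w ω q (h.setMem arr (i.val w h) (e.val w h)) T Q) :
    Tri w ω (.seq (_root_.put arr i e) q) h (i.cost + e.cost + 1 + T) Q :=
  seq (R := fun h' => h' = h.setMem arr (i.val w h) (e.val w h)) (put hi he hfi hf rfl)
    (fun _ h' => h' ▸ H)

/-- The rule for loops: `Inv m` holds when `m` more rounds are to be made. -/
theorem loop {x : ℕ} (hx : x < 32) (Inv : ℕ → Config → Prop)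
    (h0 : ∀ h, Inv 0 h → h.reg x = 0) (h1 : ∀ m h, Inv (m + 1) h → h.reg x ≠ 0)
    (H : ∀ m h, Inv (m + 1) h → Tri w ω p h T (Inv m)) (m : ℕ) (hm : Inv m h) :
    Tri w ω (.while x p) h (m * (T + 1) + 1) (Inv 0) := by
  induction m generalizing h with
  | zero =>
    intro s hs
    exact ⟨_, s, h, .whileFalse (by rw [hs.1 x hx, h0 h hm]), by omega, hs, hm⟩
  | succ m ih =>
    intro s hs
    obtain ⟨t, s', h', e, ht, hs', hq⟩ := H m h hm s hs
    obtain ⟨t₂, s₂, h₂, e₂, ht₂, hs₂, hq₂⟩ := ih hq s' hs'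
    refine ⟨_, s₂, h₂, .whileTrue (by rw [hs.1 x hx]; exact h1 m h hm) e e₂, ?_, hs₂, hq₂⟩
    rw [Nat.succ_mul]; omega

end Tri

/-! ### Fingerprints -/

/-- Few multipliers make two given numbers collide under `z ↦ (r * z mod W) / D`. -/
theorem card_mulHash_collision_le {W D Z z z' : ℕ} (hD : 0 < D) (hz : z < Z) (hz' : z' < Z)
    (hne : z ≠ z') :
    (Finset.univ.filter fun r : Fin W => (r * z) % W / D = (r * z') % W / D).card ≤
      4 * D + 2 * Z := by
  wlog hlt : z' < z generalizing z z'
  · simpa only [eq_comm] using this hz' hz hne.symm (by omega)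
  obtain ⟨δ, hδ, rfl⟩ : ∃ δ, 0 < δ ∧ z = z' + δ := ⟨z - z', by omega, by omega⟩
  -- With `z = z' + δ`, equal quotients put the two residues less than `D` apart, so `r * δ` is
  -- within `D` of a multiple `q * W`. Since `r < W`, only `q ≤ δ` can occur.
  let S : ℕ → Finset (Fin W) := fun q => Finset.univ.filter fun r =>
    (q : ℤ) * W - D < (r : ℕ) * (δ : ℤ) ∧ ((r : ℕ) * (δ : ℤ)) < q * W + D
  have hsub : (Finset.univ.filter fun r : Fin W =>
      (r * (z' + δ)) % W / D = (r * z') % W / D) ⊆ (Finset.range (δ + 1)).biUnion S := by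
    intro r hr
    simp only [Finset.mem_filter, Finset.mem_univ, true_and] at hr
    have hW : 0 < W := r.pos
    set a := (r * (z' + δ)) % W with ha
    set b := (r * z') % W with hb
    have h1 := Nat.div_add_mod (r * (z' + δ)) W
    have h2 := Nat.div_add_mod (r * z') W
    have h3 := Nat.div_add_mod a D
    have h4 := Nat.div_add_mod b D
    have h5 := Nat.mod_lt a hD
    have h6 := Nat.mod_lt b hD
    rw [hr] at h3
    rw [← ha] at h1
    rw [← hb] at h2
    set u := (r * (z' + δ)) / W
    set v := (r * z') / W
    have hvu : v ≤ u := Nat.div_le_div_right (Nat.mul_le_mul_left _ (by omega))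
    obtain ⟨q, hq⟩ := Nat.exists_eq_add_of_le hvu
    rw [hq] at h1
    have e1 : (W : ℤ) * (v + q) + a = r * (z' + δ) := by exact_mod_cast h1
    have e2 : (W : ℤ) * v + b = r * z' := by exact_mod_cast h2
    have e3 : ((r : ℕ) : ℤ) * δ = q * W + (a - b) := by linarith
    have hab : (a : ℤ) - b < D ∧ -(D : ℤ) < a - b := by omega
    have haW : a < W := Nat.mod_lt _ hW
    have hbW : b < W := Nat.mod_lt _ hW
    have hrW : r * δ < W * δ := Nat.mul_lt_mul_of_pos_right r.2 hδ
    have hqδ : q < δ + 1 := by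
      by_contra hcon
      have : (δ + 1) * W ≤ q * W := Nat.mul_le_mul_right _ (by omega)
      have : ((δ : ℤ) + 1) * W ≤ q * W := by exact_mod_cast this
      have : ((r : ℕ) : ℤ) * δ < W * δ := by exact_mod_cast hrW
      nlinarith
    simp only [Finset.mem_biUnion, Finset.mem_range, S, Finset.mem_filter, Finset.mem_univ,
      true_and]
    exact ⟨q, hqδ, by omega, by omega⟩
  -- Consecutive multipliers change `r * δ` by `δ`, and all products in `S q` lie within `2 * D` of
  -- each other.
  have hcard : ∀ q ∈ Finset.range (δ + 1), (S q).card ≤ 2 * D / δ + 1 := by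
    intro q _
    rcases (S q).eq_empty_or_nonempty with he | hne
    · simp [he]
    · set a := (S q).min' hne with ha
      have hamem : a ∈ S q := Finset.min'_mem _ _
      have : (S q).map Fin.valEmbedding ⊆ Finset.Icc (a : ℕ) (a + 2 * D / δ) := by
        intro r hr
        obtain ⟨r', hr', rfl⟩ := Finset.mem_map.1 hr
        have hle : a ≤ r' := Finset.min'_le _ _ hr'
        simp only [S, Finset.mem_filter, Finset.mem_univ, true_and] at hr' hamem
        have hle' : (a : ℕ) ≤ r' := hle
        obtain ⟨m, hm⟩ := Nat.exists_eq_add_of_le hle'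
        have : m * δ ≤ 2 * D := by
          have h1 := hr'.2
          have h2 := hamem.1
          rw [hm] at h1
          push_cast at h1
          have : (m : ℤ) * δ ≤ 2 * D := by nlinarith
          exact_mod_cast this
        have := (Nat.le_div_iff_mul_le hδ).2 this
        simp only [Fin.valEmbedding_apply, Finset.mem_Icc]
        omega
      calc (S q).card = ((S q).map Fin.valEmbedding).card := (Finset.card_map _).symm
        _ ≤ _ := Finset.card_le_card this
        _ = _ := by rw [Nat.card_Icc, add_assoc, Nat.add_sub_cancel_left]
  calc _ ≤ _ := Finset.card_le_card hsub
    _ ≤ (Finset.range (δ + 1)).card * (2 * D / δ + 1) := Finset.card_biUnion_le_card_mul _ _ _ hcard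
    _ = 2 * D / δ * δ + 2 * D / δ + δ + 1 := by rw [Finset.card_range]; ring
    _ ≤ _ := by
        have := Nat.div_mul_le_self (2 * D) δ
        have := Nat.div_le_self (2 * D) δ
        omega

/-! ### Probabilities on the random tape. -/

/-- If a set of at most `K` words is determined by the first `j` random words, then the next random
word lies in it with probability at most `K / 2 ^ w`. -/
theorem tapeLaw_mem_le {w j K : ℕ} (g : Tape w → Finset (Fin (2 ^ w)))
    (hg : ∀ ω ω', (∀ i < j, ω i = ω' i) → g ω = g ω') (hK : ∀ ω, (g ω).card ≤ K) :
    tapeLaw w {ω | ω j ∈ g ω} ≤ (K : ℝ≥0∞) / (2 ^ w : ℕ) := by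
  let ext : (Fin j → Fin (2 ^ w)) → Tape w := fun x i => if h : i < j then x ⟨i, h⟩ else 0
  let cyl : (Fin j → Fin (2 ^ w)) → Fin (2 ^ w) → Set (Tape w) := fun x v =>
    Set.pi (Finset.range (j + 1)) fun i => {if i < j then ext x i else v}
  have hcyl : ∀ x v, tapeLaw w (cyl x v) = (((2 ^ w : ℕ) : ℝ≥0∞)⁻¹) ^ (j + 1) := by
    intro x v
    rw [tapeLaw, Measure.infinitePi_pi _ (fun i _ => MeasurableSet.of_discrete)]
    rw [Finset.prod_congr rfl (g := fun _ => ((2 ^ w : ℕ) : ℝ≥0∞)⁻¹), Finset.prod_const,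
      Finset.card_range]
    intro i _
    rw [PMF.toMeasure_apply_singleton _ _ (MeasurableSet.of_discrete)]
    simp
  -- One cylinder for each prefix of length `j` and each of at most `K` next words covers the event.
  -- Subadditivity over this finite cover needs no measurability of `g`.
  have hsub : {ω | ω j ∈ g ω} ⊆ ⋃ x ∈ (Finset.univ : Finset (Fin j → Fin (2 ^ w))),
      ⋃ v ∈ g (ext x), cyl x v := by
    intro ω hω
    have he : ∀ i < j, ω i = ext (fun i => ω i) i := fun i hi => by simp [ext, hi]
    simp only [Set.mem_iUnion]
    refine ⟨fun i => ω i, Finset.mem_univ _, ω j, ?_, ?_⟩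
    · rw [← hg _ _ he]; exact hω
    · intro i hi
      have hi' : i < j + 1 := by simpa using hi
      by_cases h : i < j
      · simpa [h] using he i h
      · obtain rfl : i = j := by omega
        simp
  have hpos : ((2 ^ w : ℕ) : ℝ≥0∞) ≠ 0 := by positivity
  have htop : ((2 ^ w : ℕ) : ℝ≥0∞) ≠ ∞ := ENNReal.natCast_ne_top _
  calc tapeLaw w {ω | ω j ∈ g ω} ≤ _ := measure_mono hsub
    _ ≤ ∑ x : Fin j → Fin (2 ^ w), tapeLaw w (⋃ v ∈ g (ext x), cyl x v) :=
        measure_biUnion_finset_le _ _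
    _ ≤ ∑ _x : Fin j → Fin (2 ^ w), (K : ℝ≥0∞) * (((2 ^ w : ℕ) : ℝ≥0∞)⁻¹) ^ (j + 1) := by
        refine Finset.sum_le_sum fun x _ => (measure_biUnion_finset_le _ _).trans ?_
        simp only [hcyl, Finset.sum_const, nsmul_eq_mul]
        gcongr
        exact hK _
    _ = (K : ℝ≥0∞) / (2 ^ w : ℕ) := by
        rw [Finset.sum_const, Finset.card_univ, Fintype.card_fun, Fintype.card_fin,
          Fintype.card_fin, nsmul_eq_mul, Nat.cast_pow, pow_succ, div_eq_mul_inv, ← ENNReal.inv_pow]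
        rw [mul_left_comm, ← mul_assoc (((2 ^ w : ℕ) : ℝ≥0∞) ^ j),
          ENNReal.mul_inv_cancel (by positivity) (by finiteness), one_mul]

/-- The fingerprints of the windows of length `2 ^ j` of the sequence `f`. -/
def fingerprint (W U D : ℕ) (r : ℕ → ℕ) (f : ℕ → ℕ) : ℕ → ℕ → ℕ
  -- Both cases add `1`, so that the value `0` remains free to signal an absent window.
  | 0, x => f x + 1
  | j + 1, x => 1 + (r j * (fingerprint W U D r f j x * U +
      fingerprint W U D r f j (x + 2 ^ j))) % W / D

section fingerprint

variable {W U D : ℕ} {r r' f g : ℕ → ℕ}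

theorem fingerprint_congr {j x y : ℕ} (h : ∀ t < 2 ^ j, f (x + t) = g (y + t)) :
    fingerprint W U D r f j x = fingerprint W U D r g j y := by
  induction j generalizing x y with
  | zero => simpa [fingerprint] using h 0
  | succ j ih =>
    rw [pow_succ] at h
    simp only [fingerprint]
    rw [ih fun t ht => h t (by omega), ih (x := x + 2 ^ j) (y := y + 2 ^ j) fun t ht => by
      rw [add_assoc, add_assoc]; exact h _ (by omega)]

/-- Level `j` uses only the multipliers before `r j`. The next multiplier is therefore independent
of the numbers it hashes, which is what `tapeLaw_mem_le` asks for. -/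
theorem fingerprint_congr_tape {j x : ℕ} (h : ∀ i < j, r i = r' i) :
    fingerprint W U D r f j x = fingerprint W U D r' f j x := by
  induction j generalizing x with
  | zero => rfl
  | succ j ih => simp only [fingerprint, ih fun i hi => h i (by omega), h j (by omega)]

theorem fingerprint_pos (j x : ℕ) : 1 ≤ fingerprint W U D r f j x := by
  cases j <;> simp [fingerprint]

/-- The margin of `2` keeps fingerprints below `U - 1`, a digit that the table reserves. -/
theorem fingerprint_le (hW : 0 < W) (hD : (W - 1) / D + 3 ≤ U) (hf : ∀ x, f x + 3 ≤ U)
    (j x : ℕ) : fingerprint W U D r f j x + 2 ≤ U := by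
  cases j with
  | zero => have := hf x; simp only [fingerprint]; omega
  | succ j =>
    simp only [fingerprint]
    have := Nat.mod_lt (r j * (fingerprint W U D r f j x * U +
      fingerprint W U D r f j (x + 2 ^ j))) hW
    have := Nat.div_le_div_right (c := D) (Nat.le_sub_one_of_lt this)
    omega

theorem mul_add_inj_of_lt {U a b a' b' : ℕ} (hb : b < U) (hb' : b' < U)
    (h : a * U + b = a' * U + b') : a = a' ∧ b = b' := by
  have hU : 0 < U := by omega
  have h1 := congrArg (· / U) h
  have h2 := congrArg (· % U) h
  simp only [Nat.mul_add_mod_self_right, Nat.mod_eq_of_lt hb, Nat.mod_eq_of_lt hb'] at h2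
  simp only [mul_comm _ U, Nat.mul_add_div hU, Nat.div_eq_of_lt hb, Nat.div_eq_of_lt hb',
    add_zero] at h1
  exact ⟨h1, h2⟩

/-- At level `j + 1`, the windows at `x` and `y` differ in a half but agree in the fingerprint. -/
def Collide (W U D : ℕ) (r f g : ℕ → ℕ) (j x y : ℕ) : Prop :=
  fingerprint W U D r f j x * U + fingerprint W U D r f j (x + 2 ^ j) ≠
    fingerprint W U D r g j y * U + fingerprint W U D r g j (y + 2 ^ j) ∧
  fingerprint W U D r f (j + 1) x = fingerprint W U D r g (j + 1) y

/-- Without a collision, equal fingerprints come from equal codes of pairs, and the code in base `U`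
is injective, so both halves have equal fingerprints. This descends to single letters, where the
fingerprint is injective by definition. -/
theorem eq_of_fingerprint_eq {n j x y : ℕ} (hU : ∀ i z, fingerprint W U D r f i z < U)
    (hU' : ∀ i z, fingerprint W U D r g i z < U) {J : ℕ}
    (hc : ∀ i < J, ∀ x < n, ∀ y < n, ¬ Collide W U D r f g i x y) (hj : j ≤ J)
    (hx : x + 2 ^ j ≤ n) (hy : y + 2 ^ j ≤ n)
    (h : fingerprint W U D r f j x = fingerprint W U D r g j y) :
    ∀ t < 2 ^ j, f (x + t) = g (y + t) := by
  induction j generalizing x y with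
  | zero => simpa [fingerprint] using h
  | succ j ih =>
    have h2 : 0 < 2 ^ j := by positivity
    rw [pow_succ] at hx hy ⊢
    have := hc j (by omega) x (by omega) y (by omega)
    simp only [Collide, h, and_true, not_not, ne_eq] at this
    obtain ⟨e1, e2⟩ := mul_add_inj_of_lt (hU _ _) (hU' _ _) this
    intro t ht
    by_cases htj : t < 2 ^ j
    · exact ih (by omega) (by omega) (by omega) e1 t htj
    · have := ih (x := x + 2 ^ j) (y := y + 2 ^ j) (by omega) (by omega) (by omega) e2
        (t - 2 ^ j) (by omega)
      rwa [show x + 2 ^ j + (t - 2 ^ j) = x + t by omega,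
        show y + 2 ^ j + (t - 2 ^ j) = y + t by omega] at this

end fingerprint

/-- The multipliers on a tape. -/
def tapeWords {w : ℕ} (ω : Tape w) : ℕ → ℕ := fun i => ω i

/-- The first `j` words of the tape fix both pair codes, which are below `U * U`. If they differ,
the multiplicative hash bounds the number of bad values of the next word; if they agree, there is no
collision at all. -/
theorem tapeLaw_collide_le {w U D : ℕ} (hD : 0 < D) {f g : ℕ → ℕ}
    (hU : ∀ (ω : Tape w) i z, fingerprint (2 ^ w) U D (tapeWords ω) f i z < U)
    (hU' : ∀ (ω : Tape w) i z, fingerprint (2 ^ w) U D (tapeWords ω) g i z < U) (j x y : ℕ) :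
    tapeLaw w {ω | Collide (2 ^ w) U D (tapeWords ω) f g j x y} ≤
      ((4 * D + 2 * (U * U) : ℕ) : ℝ≥0∞) / (2 ^ w : ℕ) := by
  classical
  let z : (ℕ → ℕ) → Tape w → ℕ → ℕ := fun f ω x =>
    fingerprint (2 ^ w) U D (tapeWords ω) f j x * U +
      fingerprint (2 ^ w) U D (tapeWords ω) f j (x + 2 ^ j)
  let G : Tape w → Finset (Fin (2 ^ w)) := fun ω =>
    if z f ω x = z g ω y then ∅ else
      Finset.univ.filter fun r : Fin (2 ^ w) =>
        (r * z f ω x) % 2 ^ w / D = (r * z g ω y) % 2 ^ w / D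
  have hzU : ∀ a b, a < U → b < U → a * U + b < U * U := fun a b ha hb => by
    have : (a + 1) * U ≤ U * U := Nat.mul_le_mul_right _ ha
    nlinarith
  have hz : ∀ ω ω' : Tape w, (∀ i < j, ω i = ω' i) → ∀ f x, z f ω x = z f ω' x := by
    intro ω ω' h f x
    have h' : ∀ i < j, tapeWords ω i = tapeWords ω' i := fun i hi => by
      simp only [tapeWords, h i hi]
    simp only [z, fingerprint_congr_tape h']
  refine le_trans (measure_mono ?_) (tapeLaw_mem_le (j := j) G ?_ ?_)
  · rintro ω ⟨h1, h2⟩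
    have h3 : ¬ z f ω x = z g ω y := h1
    simp only [fingerprint, add_right_inj] at h2
    simp only [G, Set.mem_ofPred_eq, if_neg h3, Finset.mem_filter, Finset.mem_univ, true_and]
    exact h2
  · intro ω ω' h
    simp only [G, hz ω ω' h]
  · intro ω
    simp only [G]
    split_ifs with h
    · simp
    · exact card_mulHash_collision_le hD (hzU _ _ (hU _ _ _) (hU _ _ _))
        (hzU _ _ (hU' _ _ _) (hU' _ _ _)) h

/-- With high probability no two windows of the two sequences collide. -/
theorem tapeLaw_exists_collide_le {w U D : ℕ} (hD : 0 < D) {f g : ℕ → ℕ}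
    (hU : ∀ (ω : Tape w) i z, fingerprint (2 ^ w) U D (tapeWords ω) f i z < U)
    (hU' : ∀ (ω : Tape w) i z, fingerprint (2 ^ w) U D (tapeWords ω) g i z < U) (J n : ℕ) :
    tapeLaw w {ω | ¬ ∀ i < J, ∀ x < n, ∀ y < n,
        ¬ Collide (2 ^ w) U D (tapeWords ω) f g i x y} ≤
      ((J * n * n * (4 * D + 2 * (U * U)) : ℕ) : ℝ≥0∞) / (2 ^ w : ℕ) := by
  have hsub : {ω : Tape w | ¬ ∀ i < J, ∀ x < n, ∀ y < n,
      ¬ Collide (2 ^ w) U D (tapeWords ω) f g i x y} ⊆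
      ⋃ p ∈ Finset.range J ×ˢ Finset.range n ×ˢ Finset.range n,
        {ω | Collide (2 ^ w) U D (tapeWords ω) f g p.1 p.2.1 p.2.2} := by
    intro ω hω
    simp only [Set.mem_ofPred_eq, not_forall, not_not] at hω
    obtain ⟨i, hi, x, hx, y, hy, h⟩ := hω
    simp only [Set.mem_iUnion]
    exact ⟨(i, x, y), by simp [hi, hx, hy], h⟩
  refine (measure_mono hsub).trans ((measure_biUnion_finset_le _ _).trans
    ((Finset.sum_le_sum fun p _ => tapeLaw_collide_le hD hU hU' _ _ _).trans (le_of_eq ?_)))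
  rw [Finset.sum_const, Finset.card_product, Finset.card_product, Finset.card_range,
    Finset.card_range, nsmul_eq_mul, ← mul_div_assoc]
  rw [← Nat.cast_mul, ← mul_assoc J]

/-! ### Edit scripts -/

namespace EditScript

variable {α : Type*}

theorem refl (x : List α) : EditScript x x 0 := by
  induction x with
  | nil => exact .nil
  | cons a x ih => exact ih.keep a

theorem append {x y x' y' : List α} {d d' : ℕ} (h : EditScript x y d)
    (h' : EditScript x' y' d') : EditScript (x ++ x') (y ++ y') (d + d') := by
  induction h with
  | nil => simpa using h'
  | keep a _ ih => exact ih.keep a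
  | subst a b _ ih => rw [add_right_comm]; exact ih.subst a b
  | delete a _ ih => rw [add_right_comm]; exact ih.delete a
  | insert b _ ih => rw [add_right_comm]; exact ih.insert b

theorem delete_all (x : List α) : EditScript x [] x.length := by
  induction x with
  | nil => exact .nil
  | cons a x ih => exact ih.delete a

theorem insert_all (y : List α) : EditScript [] y y.length := by
  induction y with
  | nil => exact .nil
  | cons a x ih => exact ih.insert a

theorem length_le {x y : List α} {d : ℕ} (h : EditScript x y d) : x.length ≤ y.length + d := by
  induction h <;> simp_all <;> omega

/-- Cutting off the end of the target costs at most its length. -/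
theorem of_append_right {x y z : List α} {d : ℕ} (h : EditScript x (y ++ z) d) :
    ∃ d' ≤ d + z.length, EditScript x y d' := by
  generalize hv : y ++ z = v at h
  induction h generalizing y with
  | nil =>
    obtain ⟨rfl, rfl⟩ := List.append_eq_nil_iff.1 hv
    exact ⟨0, by simp, .nil⟩
  | @keep x v d a h ih =>
    cases y with
    | nil =>
      -- Nothing of the target is left: the whole remaining source is deleted, and the script bounds
      -- its length.
      have := (h.keep a).length_le
      have hz : z = a :: v := hv
      exact ⟨_, by rw [hz]; omega, delete_all _⟩
    | cons c y =>
      obtain ⟨rfl, hv'⟩ := List.cons_eq_cons.1 hv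
      obtain ⟨d', hd', h'⟩ := ih hv'
      exact ⟨d', hd', h'.keep _⟩
  | @subst x v d a b h ih =>
    cases y with
    | nil =>
      have := (h.subst a b).length_le
      have hz : z = b :: v := hv
      exact ⟨_, by rw [hz]; omega, delete_all _⟩
    | cons c y =>
      obtain ⟨rfl, hv'⟩ := List.cons_eq_cons.1 hv
      obtain ⟨d', hd', h'⟩ := ih hv'
      exact ⟨d' + 1, by omega, h'.subst _ _⟩
  | delete a h ih =>
    obtain ⟨d', hd', h'⟩ := ih hv
    exact ⟨d' + 1, by omega, h'.delete _⟩
  | @insert x v d b h ih =>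
    cases y with
    | nil =>
      have := (h.insert b).length_le
      have hz : z = b :: v := hv
      exact ⟨_, by rw [hz]; omega, delete_all _⟩
    | cons c y =>
      obtain ⟨rfl, hv'⟩ := List.cons_eq_cons.1 hv
      obtain ⟨d', hd', h'⟩ := ih hv'
      exact ⟨d' + 1, by omega, h'.insert _⟩

/-- A script keeps a common prefix, and then it edits, unless the strings are equal. -/
theorem eq_or_exists_edit {x y : List α} {d : ℕ} (h : EditScript x y d) :
    x = y ∨ ∃ u x' y' e, d = e + 1 ∧ EditScript x' y' e ∧
      ((∃ a b, x = u ++ a :: x' ∧ y = u ++ b :: y') ∨ (∃ a, x = u ++ a :: x' ∧ y = u ++ y') ∨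
        (∃ b, x = u ++ x' ∧ y = u ++ b :: y')) := by
  induction h with
  | nil => exact .inl rfl
  | keep a h ih =>
    obtain rfl | ⟨u, x', y', e, hd, hs, hc⟩ := ih
    · exact .inl rfl
    · refine .inr ⟨a :: u, x', y', e, hd, hs, ?_⟩
      rcases hc with ⟨c, b, rfl, rfl⟩ | ⟨c, rfl, rfl⟩ | ⟨b, rfl, rfl⟩
      · exact .inl ⟨c, b, rfl, rfl⟩
      · exact .inr (.inl ⟨c, rfl, rfl⟩)
      · exact .inr (.inr ⟨b, rfl, rfl⟩)
  | subst a b h _ => exact .inr ⟨[], _, _, _, rfl, h, .inl ⟨a, b, rfl, rfl⟩⟩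
  | delete a h _ => exact .inr ⟨[], _, _, _, rfl, h, .inr (.inl ⟨a, rfl, rfl⟩)⟩
  | insert b h _ => exact .inr ⟨[], _, _, _, rfl, h, .inr (.inr ⟨b, rfl, rfl⟩)⟩

end EditScript

section editDist

variable {α : Type*} {n m : ℕ} (A : Fin n → α) (B : Fin m → α)

theorem editScript_editDist : EditScript (List.ofFn A) (List.ofFn B) (editDist A B) :=
  Nat.sInf_mem (EditScript.exists_script _ _)

variable {A B}

theorem editDist_le {d : ℕ} (h : EditScript (List.ofFn A) (List.ofFn B) d) : editDist A B ≤ d :=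
  Nat.sInf_le h

theorem editDist_self : editDist A A = 0 := Nat.le_zero.1 (editDist_le (.refl _))

end editDist

/-! ### Alignments of prefixes. -/

/-- The prefixes of lengths `x` and `y` of `a` and `b` have edit distance at most `c`. -/
def PrefixED {α : Type*} (a b : List α) (x y c : ℕ) : Prop :=
  ∃ d ≤ c, EditScript (a.take x) (b.take y) d

namespace PrefixED

variable {α : Type*} {a b : List α} {x y c : ℕ}

theorem mono {c' : ℕ} (h : PrefixED a b x y c) (hc : c ≤ c') : PrefixED a b x y c' :=
  h.imp fun _ h => ⟨h.1.trans hc, h.2⟩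

theorem of_le_right {y' : ℕ} (h : PrefixED a b x y c) (hy : y ≤ y') :
    PrefixED a b x y' (c + (y' - y)) := by
  obtain ⟨d, hd, h⟩ := h
  have h2 := h.append (EditScript.insert_all ((b.drop y).take (y' - y)))
  rw [List.append_nil, ← List.take_add, Nat.add_sub_cancel' hy] at h2
  refine ⟨_, ?_, h2⟩
  have := List.length_take_le (y' - y) (b.drop y)
  omega

theorem of_ge_right {y' : ℕ} (h : PrefixED a b x y c) (hy : y' ≤ y) :
    PrefixED a b x y' (c + (y - y')) := by
  obtain ⟨d, hd, h⟩ := h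
  rw [show y = y' + (y - y') by omega, List.take_add] at h
  obtain ⟨d', hd', h'⟩ := h.of_append_right
  refine ⟨_, ?_, h'⟩
  have := List.length_take_le (y - y') (b.drop y')
  omega

/-- A change of diagonal is paid for by inserting or cutting off letters of `b`. This is the price
of treating a whole block of diagonals as one. -/
theorem move_right {y' c' : ℕ} (h : PrefixED a b x y c) (hy : c + (y' - y) + (y - y') ≤ c') :
    PrefixED a b x y' c' := by
  rcases le_total y y' with hle | hle
  · exact (h.of_le_right hle).mono (by omega)
  · exact (h.of_ge_right hle).mono (by omega)

theorem succ_left (h : PrefixED a b x y c) : PrefixED a b (x + 1) y (c + 1) := by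
  obtain ⟨d, hd, h⟩ := h
  have h2 := h.append (EditScript.delete_all ((a.drop x).take 1))
  rw [List.append_nil, ← List.take_add] at h2
  refine ⟨_, ?_, h2⟩
  have := List.length_take_le 1 (a.drop x)
  omega

theorem match_window {L : ℕ} (h : PrefixED a b x y c) (hw : ∀ t < L, a[x + t]? = b[y + t]?) :
    PrefixED a b (x + L) (y + L) c := by
  obtain ⟨d, hd, h⟩ := h
  refine ⟨d, hd, ?_⟩
  have heq : (a.drop x).take L = (b.drop y).take L := by
    apply List.ext_getElem?
    intro t
    simp only [List.getElem?_take, List.getElem?_drop]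
    split_ifs with ht
    · exact hw t ht
    · rfl
  have h2 := h.append (EditScript.refl ((a.drop x).take L))
  rw [← List.take_add, heq, ← List.take_add] at h2
  exact h2

end PrefixED

/-! ### Furthest reaching positions on blocks of diagonals -/

section Front

open Classical in
/-- The largest power `2 ^ j` with `j < L` and `hit j`, or `0`. -/
noncomputable def jump (hit : ℕ → Prop) : ℕ → ℕ
  | 0 => 0
  | L + 1 => max (jump hit L) (if hit L then 2 ^ L else 0)

variable {hit : ℕ → Prop}

theorem le_jump {L j : ℕ} (hj : j < L) (h : hit j) : 2 ^ j ≤ jump hit L := by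
  induction L with
  | zero => omega
  | succ L ih =>
    simp only [jump]
    rcases Nat.lt_succ_iff_lt_or_eq.1 hj with hj | rfl
    · exact (ih hj).trans (le_max_left _ _)
    · simp [h]

theorem jump_eq (L : ℕ) : jump hit L = 0 ∨ ∃ j < L, hit j ∧ jump hit L = 2 ^ j := by
  induction L with
  | zero => exact .inl rfl
  | succ L ih =>
    by_cases h : hit L
    · rcases le_total (jump hit L) (2 ^ L) with hle | hle
      · exact .inr ⟨L, by omega, h, by simp [jump, h, hle]⟩
      · rcases ih with h0 | ⟨j, hj, hh, he⟩
        · rw [h0] at hle; have : 0 < 2 ^ L := by positivity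
          omega
        · exact .inr ⟨j, by omega, hh, by simp only [jump, h, if_true, max_eq_left hle]; exact he⟩
    · rcases ih with h0 | ⟨j, hj, hh, he⟩
      · exact .inl (by simp [jump, h, h0])
      · exact .inr ⟨j, by omega, hh, by simp [jump, h, he]⟩

/-- The position from which round `i` starts on block `b`, given the positions `F` after the
previous round. -/
def bestNeighbor (F : ℕ → ℕ) (b : ℕ) : ℕ := max (max (F (b - 1)) (F b)) (F (b + 1))

/-- `front hit nb L i b` is the position in the first string that is reached after `i` rounds on
block `b` of diagonals. -/
noncomputable def front (hit : ℕ → ℕ → ℕ → Prop) (nb L : ℕ) : ℕ → ℕ → ℕ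
  | 0, _ => 0
  | i + 1, b =>
    -- Blocks outside the range stay at `0`, so `bestNeighbor` needs no boundary case. The final `+
    -- 1` below makes room for one edit.
    if 1 ≤ b ∧ b ≤ nb then
      bestNeighbor (front hit nb L i) b +
        jump (fun j => hit j (bestNeighbor (front hit nb L i) b) b) L + 1
    else 0

variable {hit : ℕ → ℕ → ℕ → Prop} {nb L : ℕ}

theorem bestNeighbor_mem (F : ℕ → ℕ) (b : ℕ) :
    ∃ b', bestNeighbor F b = F b' ∧ b' ≤ b + 1 ∧ b ≤ b' + 1 := by
  unfold bestNeighbor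
  rcases max_choice (max (F (b - 1)) (F b)) (F (b + 1)) with h | h
  · rcases max_choice (F (b - 1)) (F b) with h' | h'
    · exact ⟨b - 1, by rw [h, h'], by omega, by omega⟩
    · exact ⟨b, by rw [h, h'], by omega, by omega⟩
  · exact ⟨b + 1, h, by omega, by omega⟩

theorem le_bestNeighbor (F : ℕ → ℕ) {b b' : ℕ} (h : b' ≤ b + 1) (h' : b ≤ b' + 1) :
    F b' ≤ bestNeighbor F b := by
  unfold bestNeighbor
  obtain rfl | rfl | rfl : b' = b - 1 ∨ b' = b ∨ b' = b + 1 := by omega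
  · simp
  · simp
  · simp

theorem front_succ {i b : ℕ} (hb : 1 ≤ b) (hb' : b ≤ nb) : front hit nb L (i + 1) b =
    bestNeighbor (front hit nb L i) b +
      jump (fun j => hit j (bestNeighbor (front hit nb L i) b) b) L + 1 := by
  simp [front, hb, hb']

theorem front_of_not {i b : ℕ} (h : ¬ (1 ≤ b ∧ b ≤ nb)) : front hit nb L i b = 0 := by
  cases i
  · rfl
  · simp [front, h]

/-- Hits end inside the string, so only the extra letter of each round can lead past `n`. This keeps
all later addresses in range. -/
theorem front_le {n : ℕ} (hh : ∀ j m b, hit j m b → m + 2 ^ j ≤ n) (i b : ℕ) :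
    front hit nb L i b ≤ n + i := by
  induction i generalizing b with
  | zero => simp [front]
  | succ i ih =>
    by_cases hb : 1 ≤ b ∧ b ≤ nb
    · rw [front_succ hb.1 hb.2]
      obtain ⟨b', hm, -⟩ := bestNeighbor_mem (front hit nb L i) b
      rcases jump_eq (hit := fun j => hit j (bestNeighbor (front hit nb L i) b) b) L with
        h | ⟨j, -, hj, h⟩
      · rw [h, hm]; have := ih b'; omega
      · rw [h]; have := hh _ _ _ hj; omega
    · rw [front_of_not hb]; omega

/-- Every front position is reached by an alignment that is cheap. -/
theorem prefixED_front {α : Type*} {a b : List α} {k l : ℕ} (hl : 1 ≤ l) (hnb : nb * l ≤ 2 * k + l)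
    (hh : ∀ j m β, hit j m β → ∃ y, ((y + (k + l)) / l = m / l + β ∨
      (y + (k + l)) / l = m / l + β + 1) ∧ ∀ t < 2 ^ j, a[m + t]? = b[y + t]?)
    (i β : ℕ) (hβ : β * l ≤ 2 * k + 2 * l) :
    PrefixED a b (front hit nb L i β) (front hit nb L i β + β * l - (k + l))
      (k + l + 8 * l * i) := by
  induction i generalizing β with
  | zero =>
    -- Before the first round only the offset of the diagonal has to be inserted, and it is at most
    -- `k + l`.
    refine ⟨_, ?_, EditScript.insert_all _⟩
    have := List.length_take_le (0 + β * l - (k + l)) b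
    simp only [front]
    omega
  | succ i ih =>
    by_cases hb : 1 ≤ β ∧ β ≤ nb
    swap
    · rw [front_of_not hb]
      refine ⟨_, ?_, EditScript.insert_all _⟩
      have := List.length_take_le (0 + β * l - (k + l)) b
      have := Nat.zero_le (8 * l * (i + 1))
      omega
    -- Reference diagonals of adjacent blocks are `l` apart, so adopting the front of a neighbour
    -- costs at most `l`.
    have hstart : PrefixED a b (bestNeighbor (front hit nb L i) β)
        (bestNeighbor (front hit nb L i) β + β * l - (k + l)) (k + l + 8 * l * i + l) := by
      obtain ⟨β', hm, h1, h2⟩ := bestNeighbor_mem (front hit nb L i) β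
      have h3 := Nat.mul_le_mul_right l hb.2
      have h1 := Nat.mul_le_mul_right l h1
      have h2 := Nat.mul_le_mul_right l h2
      rw [Nat.succ_mul] at h1 h2
      rw [hm]
      exact (ih β' (by omega)).move_right (by omega)
    rw [front_succ hb.1 hb.2]
    generalize bestNeighbor (front hit nb L i) β = m at *
    rcases jump_eq (hit := fun j => hit j m β) L with h | ⟨j, -, hj, h⟩
    · rw [h]
      refine hstart.succ_left.move_right ?_
      rw [mul_add]; omega
    · obtain ⟨y, hy, hw⟩ := hh _ _ _ hj
      rw [h]
      have hdm := Nat.div_add_mod (y + (k + l)) l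
      have hdm' := Nat.div_add_mod m l
      have hlt := Nat.mod_lt (y + (k + l)) hl
      have hlt' := Nat.mod_lt m hl
      -- Rounding to multiples of `l` leaves `y` within `2 * l` of the reference diagonal. Moving
      -- there and back, the change of block and the extra letter cost at most `5 * l + 2` together,
      -- within the `8 * l` allotted to a round.
      have hrange : m + β * l ≤ y + (k + l) + l ∧ y + (k + l) ≤ m + β * l + 2 * l := by
        rcases hy with hy | hy <;> rw [hy] at hdm <;>
          simp only [mul_add, mul_one, mul_comm l β] at hdm <;> omega
      have h3 := (hstart.move_right (y' := y) (c' := k + l + 8 * l * i + l + 2 * l)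
        (by omega)).match_window hw
      refine h3.succ_left.move_right ?_
      rw [mul_add]; omega

/-- Every round gains a letter, even across a change to an adjacent block; this is how an edit is
absorbed. -/
theorem lt_front_succ {i β β' : ℕ} (h : β ≤ β' + 1) (h' : β' ≤ β + 1) (hb : 1 ≤ β')
    (hb' : β' ≤ nb) : front hit nb L i β + 1 ≤ front hit nb L (i + 1) β' := by
  rw [front_succ hb hb']
  have := le_bestNeighbor (front hit nb L i) h h'
  omega

/-! ### The fronts keep up with every cheap script. -/

section complete

variable {α : Type*} {a b : List α} {n k l : ℕ}

/-- A common window is passed in few rounds on its block of diagonals. -/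
theorem le_front_add_div (hl : 1 ≤ l) (hL : n < 2 ^ L)
    (hC : ∀ j m y β, j < L → m + 2 ^ j ≤ n → y + 2 ^ j ≤ n →
      (∀ t < 2 ^ j, a[m + t]? = b[y + t]?) →
      ((y + (k + l)) / l = m / l + β ∨ (y + (k + l)) / l = m / l + β + 1) → hit j m β)
    {p q r i β : ℕ} (hβ1 : 1 ≤ β) (hβ2 : β ≤ nb) (hp : p + r ≤ n) (hq : q + r ≤ n)
    (hw : ∀ t < r, a[p + t]? = b[q + t]?) (h1 : p + β * l ≤ q + (k + l))
    (h2 : q + (k + l) < p + β * l + l) (hf : p ≤ front hit nb L i β) (t : ℕ) :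
    p + r ≤ front hit nb L (i + t) β + r / 2 ^ t := by
  induction t with
  | zero => simp only [add_zero, pow_zero, Nat.div_one]; omega
  | succ t ih =>
    have hm := le_bestNeighbor (front hit nb L (i + t)) (b := β) (b' := β) (by omega) (by omega)
    have hpm : p ≤ front hit nb L (i + t) β := by
      clear ih hm
      induction t with
      | zero => exact hf
      | succ t iht =>
        exact iht.trans ((Nat.le_succ _).trans
          (lt_front_succ (i := i + t) (β := β) (by omega) (by omega) hβ1 hβ2))
    rw [← add_assoc, front_succ hβ1 hβ2, pow_succ, ← Nat.div_div_eq_div_mul]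
    generalize bestNeighbor (front hit nb L (i + t)) β = m at *
    generalize r / 2 ^ t = R at *
    by_cases hlt : m < p + r
    -- The largest power of two up to the remaining length `ρ` exceeds half of it, so the jump
    -- leaves at most half of the rest.
    · set ρ := p + r - m with hρ
      have hρ0 : ρ ≠ 0 := by omega
      have e1 := Nat.pow_log_le_self 2 hρ0
      have e2 := Nat.lt_pow_succ_log_self (b := 2) (by omega) ρ
      rw [pow_succ] at e2
      have hjL : Nat.log 2 ρ < L := Nat.log_lt_of_lt_pow hρ0 (by omega)
      have hdm := Nat.div_add_mod m l
      have hlt' := Nat.mod_lt m hl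
      -- The block of positions containing the partner of `m` is known up to one from `m / l` and
      -- `β`; hence the two alternatives in the notion of a hit.
      have hblk : (q + (m - p) + (k + l)) / l = m / l + β ∨
          (q + (m - p) + (k + l)) / l = m / l + β + 1 := by
        have g1 : m / l + β ≤ (q + (m - p) + (k + l)) / l := by
          rw [Nat.le_div_iff_mul_le hl, add_mul, mul_comm (m / l)]; omega
        have g2 : (q + (m - p) + (k + l)) / l < m / l + β + 2 := by
          rw [Nat.div_lt_iff_lt_mul hl, add_mul, add_mul, mul_comm (m / l)]; omega
        omega
      have := le_jump (hit := fun j => hit j m β) hjL (hC _ m (q + (m - p)) β hjL (by omega)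
        (by omega) (fun t ht => by
          have := hw (m - p + t) (by omega)
          rwa [show p + (m - p + t) = m + t by omega, ← add_assoc] at this) hblk)
      omega
    · omega

/-- A script with `d` edits is followed in about `d * log n` rounds. -/
theorem exists_le_front (hl : 1 ≤ l) (hnb : 2 * k + l < (nb + 1) * l) (hL : n < 2 ^ L)
    (ha : a.length = n) (hb : b.length = n)
    (hC : ∀ j m y β, j < L → m + 2 ^ j ≤ n → y + 2 ^ j ≤ n →
      (∀ t < 2 ^ j, a[m + t]? = b[y + t]?) →
      ((y + (k + l)) / l = m / l + β ∨ (y + (k + l)) / l = m / l + β + 1) → hit j m β)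
    (d : ℕ) {x y : List α} (hs : EditScript x y d) {p q i β : ℕ} (hx : a.drop p = x)
    (hy : b.drop q = y) (hp : p ≤ n) (hq : q ≤ n) (hpq : p + d ≤ q + k) (hqp : q + d ≤ p + k)
    (h1 : p + β * l ≤ q + (k + l)) (h2 : q + (k + l) < p + β * l + l)
    (hf : p ≤ front hit nb L i β) :
    ∃ β', 1 ≤ β' ∧ β' ≤ nb ∧ n ≤ front hit nb L (i + d * (L + 1) + L) β' := by
  -- The offset `k + l` places the diagonals from `-k` to `k` in the blocks from `1` to `nb`.
  have hblock : ∀ p q β, p ≤ q + k → q ≤ p + k → p + β * l ≤ q + (k + l) →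
      q + (k + l) < p + β * l + l → 1 ≤ β ∧ β ≤ nb := by
    intro p q β g1 g2 g3 g4
    constructor
    · by_contra h
      obtain rfl : β = 0 := by omega
      omega
    · by_contra h
      have := Nat.mul_le_mul_right l (show nb + 1 ≤ β by omega)
      omega
  induction d using Nat.strong_induction_on generalizing x y p q i β with
  | _ d ih =>
  obtain ⟨hβ1, hβ2⟩ := hblock p q β (by omega) (by omega) h1 h2
  have hrun : ∀ u v z : List α, x = u ++ v → y = u ++ z →
      (∀ t < u.length, a[p + t]? = b[q + t]?) ∧ p + u.length + v.length = n ∧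
      q + u.length + z.length = n ∧ a.drop (p + u.length) = v ∧ b.drop (q + u.length) = z ∧
      p + u.length ≤ front hit nb L (i + L) β := by
    intro u v z hxu hyu
    have hlx := congrArg List.length hx
    have hly := congrArg List.length hy
    rw [List.length_drop, hxu, List.length_append] at hlx
    rw [List.length_drop, hyu, List.length_append] at hly
    have hw : ∀ t < u.length, a[p + t]? = b[q + t]? := by
      intro t ht
      rw [← List.getElem?_drop, ← List.getElem?_drop, hx, hy, hxu, hyu,
        List.getElem?_append_left ht, List.getElem?_append_left ht]
    have := le_front_add_div hl hL hC hβ1 hβ2 (r := u.length) (by omega) (by omega) hw h1 h2 hf L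
    rw [Nat.div_eq_of_lt (by omega)] at this
    refine ⟨hw, by omega, by omega, ?_, ?_, this⟩
    · rw [← List.drop_drop, hx, hxu, List.drop_left]
    · rw [← List.drop_drop, hy, hyu, List.drop_left]
  rcases hs.eq_or_exists_edit with rfl | ⟨u, x', y', e, rfl, hs', hc⟩
  · obtain ⟨-, g1, -, -, -, g2⟩ := hrun x [] [] (by simp) (by simp)
    refine ⟨β, hβ1, hβ2, ?_⟩
    -- The remaining strings may agree before the budget of rounds is used up; the front then has to
    -- persist until the prescribed round.
    have hmono : ∀ t, front hit nb L (i + L) β ≤ front hit nb L (i + L + t) β := by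
      intro t
      induction t with
      | zero => exact le_rfl
      | succ t iht =>
        exact iht.trans ((Nat.le_succ _).trans
          (lt_front_succ (i := i + L + t) (by omega) (by omega) hβ1 hβ2))
    have := hmono (d * (L + 1))
    rw [add_right_comm i L] at this
    simp only [List.length_nil] at g1
    omega
  -- An edit changes the diagonal by at most one, hence the block by at most one, and the extra
  -- letter of the next round covers it. The hypotheses `hpq` and `hqp` reserve enough of the band
  -- for the edits that remain.
  · have hnext : ∀ p' q', p' ≤ n → q' ≤ n → a.drop p' = x' → b.drop q' = y' →
        p' ≤ p + u.length + 1 → q' ≤ q + u.length + 1 → p + u.length ≤ p' →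
        q + u.length ≤ q' → p + u.length ≤ front hit nb L (i + L) β →
        ∃ β', 1 ≤ β' ∧ β' ≤ nb ∧ n ≤ front hit nb L (i + (e + 1) * (L + 1) + L) β' := by
      intro p' q' hp' hq' hx' hy' c1 c2 c3 c4 hfr
      obtain ⟨v, hv⟩ := Nat.exists_eq_add_of_le (show p' ≤ q' + (k + l) by omega)
      have d1 := Nat.div_mul_le_self v l
      have d2 := Nat.lt_div_mul_add (a := v) hl
      obtain ⟨b1, b2⟩ := hblock p' q' (v / l) (by omega) (by omega) (by omega) (by omega)
      have n1 : β ≤ v / l + 1 := by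
        by_contra h
        have := Nat.mul_le_mul_right l (show v / l + 2 ≤ β by omega)
        rw [add_mul] at this
        omega
      have n2 : v / l ≤ β + 1 := by
        by_contra h
        have := Nat.mul_le_mul_right l (show β + 2 ≤ v / l by omega)
        rw [add_mul] at this
        omega
      have hfr' := lt_front_succ (hit := hit) (L := L) (i := i + L) n1 n2 b1 b2
      obtain ⟨β', g1, g2, g3⟩ := ih e (by omega) hs' (i := i + L + 1) (β := v / l) hx' hy' hp' hq'
        (by omega) (by omega) (by omega) (by omega) (by omega)
      exact ⟨β', g1, g2, by rwa [show i + (e + 1) * (L + 1) + L =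
        i + L + 1 + e * (L + 1) + L by ring]⟩
    rcases hc with ⟨c, c', hxu, hyu⟩ | ⟨c, hxu, hyu⟩ | ⟨c, hxu, hyu⟩
    · obtain ⟨-, g1, g2, g3, g4, g5⟩ := hrun _ _ _ hxu hyu
      simp only [List.length_cons] at g1 g2
      refine hnext (p + u.length + 1) (q + u.length + 1) (by omega) (by omega) ?_ ?_ le_rfl le_rfl
        (by omega) (by omega) g5
      · rw [← List.drop_drop, g3, List.drop_one, List.tail_cons]
      · rw [← List.drop_drop, g4, List.drop_one, List.tail_cons]
    · obtain ⟨-, g1, g2, g3, g4, g5⟩ := hrun _ _ _ hxu hyu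
      simp only [List.length_cons] at g1 g2
      refine hnext (p + u.length + 1) (q + u.length) (by omega) (by omega) ?_ g4 le_rfl (by omega)
        (by omega) (by omega) g5
      rw [← List.drop_drop, g3, List.drop_one, List.tail_cons]
    · obtain ⟨-, g1, g2, g3, g4, g5⟩ := hrun _ _ _ hxu hyu
      simp only [List.length_cons] at g1 g2
      refine hnext (p + u.length) (q + u.length + 1) (by omega) (by omega) g3 ?_ (by omega) le_rfl
        (by omega) (by omega) g5
      rw [← List.drop_drop, g4, List.drop_one, List.tail_cons]

end complete

end Front

/-! ### The preprocessing program -/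

/-! ### Layout of the table of fingerprints and marks. -/

/-- The address of an entry of the table; `j`, `x`, `h` are its digits in base `U`. -/
def cell (U j x h : ℕ) : ℕ := (j * U + x) * U + h

theorem cell_inj {U j x h j' x' h' : ℕ} (hx : x < U) (hh : h < U) (hx' : x' < U) (hh' : h' < U)
    (e : cell U j x h = cell U j' x' h') : j = j' ∧ x = x' ∧ h = h' := by
  obtain ⟨e1, e2⟩ := mul_add_inj_of_lt hh hh' e
  obtain ⟨e3, e4⟩ := mul_add_inj_of_lt hx hx' e1
  exact ⟨e3, e4, e2⟩

open Classical in
/-- The array `D` holds the fingerprints `H j x` of the windows in `S`, and for each of them a mark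
that can be looked up from the level, the block of positions and the fingerprint. -/
structure IsTable (U K l : ℕ) (H : ℕ → ℕ → ℕ) (S : ℕ → ℕ → Prop) (D : ℕ → ℕ) : Prop where
  -- The last digit `U - 1` belongs to fingerprints stored by position; smaller last digits belong
  -- to marks. Absence is coded by `0`, so memory needs no initialisation.
  name : ∀ j x, x < U → D (cell U j x (U - 1)) = if S j x then H j x else 0
  mark : ∀ j β h, 1 ≤ β → β < U → h < U - 1 →
    D (cell U j β h) = if ∃ y, S j y ∧ (y + K) / l = β ∧ H j y = h then 1 else 0

namespace IsTable

variable {U K l : ℕ} {H : ℕ → ℕ → ℕ} {S S' : ℕ → ℕ → Prop} {D : ℕ → ℕ}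

theorem congr (h : IsTable U K l H S D) (hS : ∀ j x, S' j x ↔ S j x) : IsTable U K l H S' D := by
  obtain rfl : S' = S := funext fun j => funext fun x => propext (hS j x)
  exact h

theorem empty (hS : ∀ j x, ¬ S j x) : IsTable U K l H S fun _ => 0 :=
  ⟨fun j x _ => by simp [hS], fun j β h _ _ _ => by simp [hS]⟩

/-- Names have addresses from `U - 1` on, and marks with `1 ≤ β` have addresses from `U` on. The
smaller addresses are free for the header of the output. -/
theorem update_small (h : IsTable U K l H S D) {a v : ℕ} (ha : a < U - 1) :
    IsTable U K l H S (Function.update D a v) := by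
  constructor
  · intro j x hx
    rw [Function.update_of_ne, h.name j x hx]
    rw [cell]; omega
  · intro j β g h1 h2 h3
    rw [Function.update_of_ne, h.mark j β g h1 h2 h3]
    have : 1 * U ≤ (j * U + β) * U := Nat.mul_le_mul_right _ (by omega)
    rw [cell]; omega

theorem insert (h : IsTable U K l H S D) {j x : ℕ} (hx : x < U)
    (hβ : (x + K) / l < U) (h2 : H j x < U - 1)
    (hS : ∀ j' x', S' j' x' ↔ S j' x' ∨ (j' = j ∧ x' = x)) :
    IsTable U K l H S' (Function.update (Function.update D (cell U j x (U - 1)) (H j x))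
      (cell U j ((x + K) / l) (H j x)) 1) := by
  constructor
  · intro j' x' hx'
    rw [Function.update_of_ne, Function.update_apply]
    · split_ifs with h1 h3 h3
      · obtain ⟨rfl, rfl, -⟩ := cell_inj hx' (by omega) hx (by omega) h1
        rfl
      · obtain ⟨rfl, rfl, -⟩ := cell_inj hx' (by omega) hx (by omega) h1
        exact absurd ((hS _ _).2 (.inr ⟨rfl, rfl⟩)) h3
      · rw [h.name _ _ hx', if_pos]
        rcases (hS _ _).1 h3 with h3 | ⟨rfl, rfl⟩
        · exact h3
        · exact absurd rfl h1
      · rw [h.name _ _ hx', if_neg fun h4 => h3 ((hS _ _).2 (.inl h4))]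
    · intro e
      have := (cell_inj hx' (by omega) hβ (by omega) e).2.2
      omega
  · intro j' β g g1 g2 g3
    rw [Function.update_apply, Function.update_of_ne]
    · split_ifs with e1 e2 e2
      · rfl
      · obtain ⟨rfl, rfl, rfl⟩ := cell_inj g2 (by omega) hβ (by omega) e1
        exact absurd ⟨x, (hS _ _).2 (.inr ⟨rfl, rfl⟩), rfl, rfl⟩ e2
      · rw [h.mark _ _ _ g1 g2 g3, if_pos]
        obtain ⟨y, hy, rfl, rfl⟩ := e2
        rcases (hS _ _).1 hy with h3 | ⟨rfl, rfl⟩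
        · exact ⟨y, h3, rfl, rfl⟩
        · exact absurd rfl e1
      · rw [h.mark _ _ _ g1 g2 g3, if_neg]
        rintro ⟨y, hy, h5⟩
        exact e2 ⟨y, (hS _ _).2 (.inl hy), h5⟩
    · intro e
      have := (cell_inj g2 (by omega) hx (by omega) e).2.2
      omega

end IsTable

namespace Exp

/-- Sums of expressions. -/
abbrev add (a b : Exp) : Exp := bin .add a b
/-- Differences of expressions. -/
abbrev sub (a b : Exp) : Exp := bin .sub a b
/-- Products of expressions. -/
abbrev mul (a b : Exp) : Exp := bin .mul a b
/-- Quotients of expressions. -/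
abbrev div (a b : Exp) : Exp := bin .div a b
/-- Comparisons of expressions. -/
abbrev lt (a b : Exp) : Exp := bin .lt a b

theorem val_get (w : ℕ) (s : Config) (arr : ℕ) (i : Exp) :
    (get arr i).val w s = s.mem arr (i.val w s) := rfl

/-- The address of a table entry; register `5` holds the base. -/
def cell (j x h : Exp) : Exp := add (mul (add (mul j (var 5)) x) (var 5)) h

theorem cell_spec {w U : ℕ} {s : Config} {j x h : Exp} (hU : s.reg 5 = U) (hW : U ^ 3 < 2 ^ w)
    (hj : j.Fits w s) (hx : x.Fits w s) (hh : h.Fits w s) (vj : j.val w s < U)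
    (vx : x.val w s < U) (vh : h.val w s < U) :
    (cell j x h).Fits w s ∧
      (cell j x h).val w s = _root_.cell U (j.val w s) (x.val w s) (h.val w s) := by
  simp only [cell, Fits, val, WordOp.nat, WordOp.Fits, hU, _root_.cell, hj, hx, hh, true_and,
    and_true]
  generalize j.val w s = a at *
  generalize x.val w s = b at *
  generalize h.val w s = c at *
  have h1 : (a + 1) * U ≤ U * U := Nat.mul_le_mul_right _ vj
  have h2 : (a * U + b + 1) * U ≤ U * U * U := Nat.mul_le_mul_right _ (by nlinarith)
  have h3 : U ^ 3 = U * U * U := by ring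
  have h4 : U * 1 ≤ U * U := Nat.mul_le_mul_left _ (by omega)
  have h5 : U * U * 1 ≤ U * U * U := Nat.mul_le_mul_left _ (by omega)
  simp only [add_mul, one_mul, mul_one] at *
  omega

end Exp

/-- The numerical assumptions under which the programs do not overflow. -/
structure Sizes (w n k l σ U D : ℕ) : Prop where
  one_le : 1 ≤ l
  le : l ≤ k
  le' : k ≤ n
  base : 16 * n + 16 ≤ U
  alphabet : σ + 3 ≤ U
  word : U ^ 3 < 2 ^ w
  pos : 0 < D
  div_lt : D < 2 ^ w
  range : (2 ^ w - 1) / D + 3 ≤ U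

namespace Sizes

variable {w n k l σ U D : ℕ}

theorem sq_lt (S : Sizes w n k l σ U D) : U * U < 2 ^ w := by
  have := S.word
  have := S.base
  have h5 : U * U * 1 ≤ U * U * U := Nat.mul_le_mul_left _ (by omega)
  have h3 : U ^ 3 = U * U * U := by ring
  omega

theorem base_lt (S : Sizes w n k l σ U D) : U * 16 < 2 ^ w := by
  have := S.sq_lt
  have := S.base
  have : U * 16 ≤ U * U := Nat.mul_le_mul_left _ (by omega)
  omega

theorem fingerprint_le (S : Sizes w n k l σ U D) {f : ℕ → ℕ} (hf : ∀ x, f x ≤ σ) (r : ℕ → ℕ) (j x : ℕ) :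
    fingerprint (2 ^ w) U D r f j x + 2 ≤ U := by
  refine _root_.fingerprint_le (by positivity) S.range (fun x => ?_) j x
  have := hf x
  have := S.alphabet
  omega

theorem word_pos (S : Sizes w n k l σ U D) : 0 < w := by
  have := S.base_lt
  have := S.base
  rcases Nat.eq_zero_or_pos w with rfl | h
  · simp only [pow_zero] at *; omega
  · exact h

end Sizes

/-! ### The code of the preprocessing and its innermost loops. -/

/-- Enter the window at position `r10` on level `r15`, with fingerprint `r11`, into the table. -/
def emit : Prog :=
  .seq (put 1 (.cell (.var 15) (.var 10) (.sub (.var 5) (.num 1))) (.var 11))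
    (put 1 (.cell (.var 15) (.div (.add (.var 10) (.var 7)) (.var 2)) (.var 11)) (.num 1))

/-- The registers that stay fixed during the preprocessing. -/
structure PreBase (n l U D K : ℕ) (f : ℕ → ℕ) (h : Config) : Prop where
  reg_n : h.reg 0 = n
  reg_l : h.reg 2 = l
  reg_U : h.reg 5 = U
  reg_D : h.reg 6 = D
  reg_K : h.reg 7 = K
  mem_f : h.mem 0 = f

theorem tri_emit {w n k l σ U D : ℕ} (S : Sizes w n k l σ U D) {ω : Tape w} {f : ℕ → ℕ}
    {h : Config} (hb : PreBase n l U D (k + l) f h) {j x v : ℕ} (hj : h.reg 15 = j)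
    (hx : h.reg 10 = x) (hv : h.reg 11 = v) (hjn : j ≤ n) (hxn : x ≤ n) (hvU : v + 2 ≤ U) :
    Tri w ω emit h 50 fun h' => h'.reg = h.reg ∧ h'.pos = h.pos ∧
      h'.mem = Function.update h.mem 1 (Function.update (Function.update (h.mem 1)
        (cell U j x (U - 1)) v) (cell U j ((x + (k + l)) / l) v) 1) := by
  have := S.base_lt
  have := S.base
  have := S.one_le
  have := S.le
  have := S.le'
  have hdiv := Nat.div_le_self (x + (k + l)) l
  obtain ⟨f1, v1⟩ := Exp.cell_spec (s := h) (j := .var 15) (x := .var 10)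
    (h := .sub (.var 5) (.num 1)) hb.reg_U S.word (by simp only [Exp.Fits]; omega)
    (by simp only [Exp.Fits]; omega)
    (by simp only [Exp.Fits, WordOp.Fits, Exp.val, hb.reg_U]; omega)
    (by simp only [Exp.val]; omega) (by simp only [Exp.val]; omega)
    (by simp only [Exp.val, WordOp.nat, hb.reg_U]; omega)
  set h₂ := h.setMem 1 (cell U j x (U - 1)) v with hh₂
  obtain ⟨f2, v2⟩ := Exp.cell_spec (s := h₂) (j := .var 15)
    (x := .div (.add (.var 10) (.var 7)) (.var 2))
    (h := .var 11) hb.reg_U S.word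
    (by simp only [Exp.Fits, hh₂, Config.setMem]; omega)
    (by simp only [Exp.Fits, hh₂, Config.setMem, WordOp.Fits, Exp.val, hb.reg_K, hb.reg_l, WordOp.nat, hx]
        omega)
    (by simp only [Exp.Fits, hh₂, Config.setMem]; omega)
    (by simp only [Exp.val, hh₂, Config.setMem]; omega)
    (by simp only [hh₂, Config.setMem, Exp.val, hb.reg_K, hb.reg_l, WordOp.nat, hx]
        omega)
    (by simp only [Exp.val, hh₂, Config.setMem]; omega)
  simp only [Exp.val, WordOp.nat, hj, hx, hb.reg_U] at v1
  simp only [Exp.val, WordOp.nat, hh₂, Config.setMem, hj, hx, hv, hb.reg_K, hb.reg_l] at v2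
  refine Tri.mono (Tri.put_seq ?_ ?_ f1 ?_ (Tri.put (Q := fun h' => h'.reg = h.reg ∧
    h'.pos = h.pos ∧
      h'.mem = Function.update h.mem 1 (Function.update (Function.update (h.mem 1)
        (cell U j x (U - 1)) v) (cell U j ((x + (k + l)) / l) v) 1))
    ?_ ?_ ?_ ?_ ?_)) ?_ fun _ => id
  · simp [Exp.cell, Exp.Low]
  · simp [Exp.Low]
  · simp only [Exp.Fits]; omega
  · simp [Exp.cell, Exp.Low]
  · simp [Exp.Low]
  · rw [v1]; simpa only [Exp.val, hv] using f2
  · simp only [Exp.Fits]; omega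
  · rw [v1]
    simp only [Exp.val, hv]
    rw [← hh₂, hh₂]
    simp only [Config.setMem]
    refine ⟨trivial, trivial, ?_⟩
    rw [v2]
    simp
  · simp [Exp.cost, Exp.cell]


/-- Subtract one from the counter `r10`. -/
def countDown : Prog := assign 10 (.sub (.var 10) (.num 1))

/-- Enter the letter before position `r10`. -/
def letterBody : Prog :=
  .seq countDown (.seq (assign 11 (.add (.get 0 (.var 10)) (.num 1))) emit)

/-- Enter the combination of two adjacent windows of level `r8`. -/
def windowBody : Prog :=
  .seq countDown
    (.seq (assign 13 (.get 1 (.cell (.var 8) (.var 10) (.sub (.var 5) (.num 1)))))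
    (.seq (assign 14 (.get 1 (.cell (.var 8) (.add (.var 10) (.var 9)) (.sub (.var 5) (.num 1)))))
    (.seq (assign 11 (.add (.num 1)
      (.div (.wrap .mul (.var 12) (.add (.mul (.var 13) (.var 5)) (.var 14))) (.var 6))))
    emit)))

/-- The windows that have been entered while level `j` is under way, from position `m` on. -/
def Entered (n j m j' x : ℕ) : Prop := x + 2 ^ j' ≤ n ∧ (j' < j ∨ j' = j ∧ m ≤ x)

theorem tri_countDown {w : ℕ} {ω : Tape w} {h : Config} {m T : ℕ} {p : Prog}
    {Q : Config → Prop} (hm : h.reg 10 = m + 1) (hw : m + 1 < 2 ^ w)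
    (H : Tri w ω p (h.setReg 10 m) T Q) : Tri w ω (.seq countDown p) h (6 + T) Q := by
  refine (Tri.assign_seq (T := T) (Q := Q) ?_ ?_ ?_ ?_ ?_).mono ?_ fun _ => id
  · norm_num
  · simp [Exp.Low]
  · simp only [Exp.Fits, Exp.val, WordOp.Fits, hm]; omega
  · simp only [Exp.val, WordOp.nat, hm]; omega
  · simpa only [Exp.val, WordOp.nat, hm, Nat.add_sub_cancel] using H
  · simp [Exp.cost]

theorem tri_letterBody {w n k l σ U D : ℕ} (S : Sizes w n k l σ U D) {ω : Tape w} {f : ℕ → ℕ}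
    (hf : ∀ x, f x ≤ σ) {H : ℕ → ℕ → ℕ} (hH : ∀ x, H 0 x = f x + 1) {m : ℕ} {h : Config}
    (hb : PreBase n l U D (k + l) f h) (h15 : h.reg 15 = 0) (h10 : h.reg 10 = m + 1)
    (hm : m + 1 ≤ n) (hp : h.pos = 0)
    (ht : IsTable U (k + l) l H (Entered n 0 (m + 1)) (h.mem 1)) :
    Tri w ω letterBody h 70 fun h' => PreBase n l U D (k + l) f h' ∧ h'.reg 15 = 0 ∧
      h'.reg 10 = m ∧ h'.pos = 0 ∧ IsTable U (k + l) l H (Entered n 0 m) (h'.mem 1) := by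
  have := S.word_pos
  have := S.base_lt
  have := S.base
  have := S.one_le
  have := S.le
  have := S.le'
  have := S.alphabet
  have := hf m
  have hdiv := Nat.div_le_self (m + (k + l)) l
  refine (tri_countDown h10 (by omega) (Tri.assign_seq ?_ ?_ ?_ ?_
    ((tri_emit S (f := f) (j := 0) (x := m) (v := f m + 1) ?_ ?_ ?_ ?_ ?_ ?_ ?_).mono le_rfl
      (R := fun h' => PreBase n l U D (k + l) f h' ∧ h'.reg 15 = 0 ∧
        h'.reg 10 = m ∧ h'.pos = 0 ∧ IsTable U (k + l) l H (Entered n 0 m) (h'.mem 1)) ?_))).mono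
    ?_ fun _ => id
  · norm_num
  · simp [Exp.Low]
  · simp [Exp.Fits, Exp.val, WordOp.Fits, Config.setReg, hb.mem_f]; omega
  · simp [Exp.val, WordOp.nat, Config.setReg, hb.mem_f]; omega
  · constructor <;> simp [Config.setReg, hb.reg_n, hb.reg_l, hb.reg_U, hb.reg_D, hb.reg_K, hb.mem_f]
  · simp [Config.setReg, h15]
  · simp [Config.setReg]
  · simp [Config.setReg, Exp.val, WordOp.nat, hb.mem_f]
  · omega
  · omega
  · omega
  · rintro h' ⟨hr, hp', hm'⟩
    refine ⟨?_, ?_, ?_, ?_, ?_⟩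
    · constructor <;> simp [hr, hm', Config.setReg, hb.reg_n, hb.reg_l, hb.reg_U, hb.reg_D, hb.reg_K, hb.mem_f]
    · simp [hr, Config.setReg, h15]
    · simp [hr, Config.setReg]
    · simp [hp', Config.setReg, hp]
    · rw [hm']
      simp only [Config.setReg, Function.update_self]
      rw [← hH m]
      refine ht.insert (by omega) (by omega) (by rw [hH]; omega) fun j' x' => ?_
      simp only [Entered, Nat.not_lt_zero, false_or]
      constructor
      · rintro ⟨h1, rfl, h2⟩
        simp only [pow_zero, true_and] at *; omega
      · rintro (⟨h1, rfl, h2⟩ | ⟨rfl, rfl⟩) <;> simp only [pow_zero, true_and] at * <;> omega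
  · simp [Exp.cost]

theorem tri_windowBody {w n k l σ U D : ℕ} (S : Sizes w n k l σ U D) {ω : Tape w} {f : ℕ → ℕ}
    (hf : ∀ x, f x ≤ σ) {H : ℕ → ℕ → ℕ} (hH : H = fingerprint (2 ^ w) U D (tapeWords ω) f)
    {j m : ℕ} {h : Config} (hb : PreBase n l U D (k + l) f h) (h8 : h.reg 8 = j)
    (h9 : h.reg 9 = 2 ^ j) (h12 : h.reg 12 = ω j) (h15 : h.reg 15 = j + 1)
    (h10 : h.reg 10 = m + 1) (hm : m + 2 ^ (j + 1) ≤ n) (hp : h.pos = j + 1)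
    (ht : IsTable U (k + l) l H (Entered n (j + 1) (m + 1)) (h.mem 1)) :
    Tri w ω windowBody h 150 fun h' => PreBase n l U D (k + l) f h' ∧ h'.reg 8 = j ∧
      h'.reg 9 = 2 ^ j ∧ h'.reg 12 = ω j ∧ h'.reg 15 = j + 1 ∧
      h'.reg 10 = m ∧ h'.pos = j + 1 ∧
      IsTable U (k + l) l H (Entered n (j + 1) m) (h'.mem 1) := by
  have := S.base_lt
  have hsq := S.sq_lt
  have := S.word_pos
  have := S.base
  have := S.one_le
  have := S.le
  have := S.le'
  have hle : ∀ j x, H j x + 2 ≤ U := fun j x => by rw [hH]; exact S.fingerprint_le hf _ _ _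
  have hj2 : j < 2 ^ j := Nat.lt_two_pow_self
  rw [pow_succ] at hm
  have hdiv := Nat.div_le_self (m + (k + l)) l
  -- Both halves belong to the finished level `j`, so their fingerprints are already in the table.
  have e1 : h.mem 1 (cell U j m (U - 1)) = H j m := by
    rw [ht.name _ _ (by omega), if_pos]; exact ⟨by omega, by omega⟩
  have e2 : h.mem 1 (cell U j (m + 2 ^ j) (U - 1)) = H j (m + 2 ^ j) := by
    rw [ht.name _ _ (by omega), if_pos]; exact ⟨by omega, by omega⟩
  have hb1 := hle j m
  have hb2 := hle j (m + 2 ^ j)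
  have hb3 := hle (j + 1) m
  have hUU : (H j m + 1) * U ≤ U * U := Nat.mul_le_mul_right _ (by omega)
  rw [add_mul] at hUU
  obtain ⟨f1, v1⟩ := Exp.cell_spec (s := h.setReg 10 m) (j := .var 8) (x := .var 10)
    (h := .sub (.var 5) (.num 1)) (w := w) (U := U) (by simpa [Config.setReg] using hb.reg_U) S.word
    (by simp [Exp.Fits, Config.setReg, h8]; omega)
    (by simp [Exp.Fits, Config.setReg]; omega)
    (by simp [Exp.Fits, WordOp.Fits, Exp.val, Config.setReg, hb.reg_U]; omega)
    (by simp [Exp.val, Config.setReg, h8]; omega) (by simp [Exp.val, Config.setReg]; omega)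
    (by simp [Exp.val, WordOp.nat, Config.setReg, hb.reg_U]; omega)
  have v1' : (Exp.cell (.var 8) (.var 10) (.sub (.var 5) (.num 1))).val w (h.setReg 10 m) =
      cell U j m (U - 1) := by
    rw [v1]; simp [Exp.val, WordOp.nat, Config.setReg, h8, hb.reg_U]
  obtain ⟨f2, v2⟩ := Exp.cell_spec (s := (h.setReg 10 m).setReg 13 (H j m)) (j := .var 8)
    (x := .add (.var 10) (.var 9))
    (h := .sub (.var 5) (.num 1)) (w := w) (U := U) (by simpa [Config.setReg] using hb.reg_U) S.word
    (by simp [Exp.Fits, Config.setReg, h8]; omega)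
    (by simp [Exp.Fits, WordOp.Fits, Exp.val, Config.setReg, h9]; omega)
    (by simp [Exp.Fits, WordOp.Fits, Exp.val, Config.setReg, hb.reg_U]; omega)
    (by simp [Exp.val, Config.setReg, h8]; omega)
    (by simp [Exp.val, WordOp.nat, Config.setReg, h9]; omega)
    (by simp [Exp.val, WordOp.nat, Config.setReg, hb.reg_U]; omega)
  have v2' : (Exp.cell (.var 8) (.add (.var 10) (.var 9)) (.sub (.var 5) (.num 1))).val w
      ((h.setReg 10 m).setReg 13 (H j m)) = cell U j (m + 2 ^ j) (U - 1) := by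
    rw [v2]; simp [Exp.val, WordOp.nat, Config.setReg, h8, h9, hb.reg_U]
  have hstep : H (j + 1) m = 1 + ω j * (H j m * U + H j (m + 2 ^ j)) % 2 ^ w / D := by
    rw [hH]; rfl
  refine (tri_countDown h10 (by omega) (Tri.assign_seq ?_ ?_ ?_ ?_ (Tri.assign_seq ?_ ?_ ?_ ?_
    (Tri.assign_seq ?_ ?_ ?_ ?_
    ((tri_emit S (f := f) (j := j + 1) (x := m) (v := H (j + 1) m) ?_ ?_ ?_ ?_ ?_ ?_ ?_).mono
      le_rfl (R := fun h' => PreBase n l U D (k + l) f h' ∧ h'.reg 8 = j ∧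
      h'.reg 9 = 2 ^ j ∧ h'.reg 12 = ω j ∧ h'.reg 15 = j + 1 ∧
      h'.reg 10 = m ∧ h'.pos = j + 1 ∧
      IsTable U (k + l) l H (Entered n (j + 1) m) (h'.mem 1)) ?_))))).mono
    ?_ fun _ => id
  all_goals try simp only [Exp.val_get, v1', show ∀ x v, (h.setReg x v).mem = h.mem from
    fun _ _ => rfl, e1]
  · norm_num
  · simp [Exp.Low, Exp.cell]
  · exact f1
  · omega
  · norm_num
  · simp [Exp.Low, Exp.cell]
  · exact f2
  all_goals try simp only [v2', show ∀ (h : Config) x v, (h.setReg x v).mem = h.mem from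
    fun _ _ _ => rfl, e2]
  · omega
  · norm_num
  · simp [Exp.Low]
  · simp [Exp.Fits, Exp.val, WordOp.Fits, WordOp.eval, WordOp.nat, Config.setReg, hb.reg_U, hb.reg_D, h12]
    have := (ω j).2
    have : 0 < 2 ^ w := by positivity
    have := Nat.mod_lt (ω j * (H j m * U + H j (m + 2 ^ j))) this
    rw [← hstep]
    and_intros
    all_goals first | omega | exact S.div_lt
  · simp [Exp.val, WordOp.nat, WordOp.eval, Config.setReg, hb.reg_U, hb.reg_D, h12, ← hstep]; omega
  · constructor <;> simp [Config.setReg, hb.reg_n, hb.reg_l, hb.reg_U, hb.reg_D, hb.reg_K, hb.mem_f]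
  · simp [Config.setReg, h15]
  · simp [Config.setReg]
  · simp [Config.setReg, Exp.val, WordOp.nat, WordOp.eval, hb.reg_U, hb.reg_D, h12, ← hstep]
  · omega
  · omega
  · omega
  · rintro h' ⟨hr, hp', hm'⟩
    refine ⟨?_, ?_, ?_, ?_, ?_, ?_, ?_, ?_⟩
    · constructor <;> simp [hr, hm', Config.setReg, hb.reg_n, hb.reg_l, hb.reg_U, hb.reg_D, hb.reg_K, hb.mem_f]
    · simp [hr, Config.setReg, h8]
    · simp [hr, Config.setReg, h9]
    · simp [hr, Config.setReg, h12]
    · simp [hr, Config.setReg, h15]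
    · simp [hr, Config.setReg]
    · simp [hp', Config.setReg, hp]
    · rw [hm']
      refine ht.insert (by omega) (by omega) (by omega) fun j' x' => ?_
      simp only [Entered]
      constructor
      · rintro ⟨h1, h2⟩; omega
      · rintro (⟨h1, h2⟩ | ⟨rfl, rfl⟩)
        · omega
        · rw [pow_succ]; omega
  · simp [Exp.cost, Exp.cell]

/-- Enter all letters. -/
def firstLevel : Prog :=
  .seq (assign 15 (.num 0)) (.seq (assign 10 (.var 0)) (.while 10 letterBody))

/-- `2 * r9 ≤ n`, which tells whether there is a further level. -/
def moreLevels : Prog := assign 16 (.lt (.mul (.num 2) (.var 9)) (.add (.var 0) (.num 1)))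

/-- Enter all windows of the level after `r8`. -/
def nextLevel : Prog :=
  .seq (.rand 12)
    (.seq (assign 15 (.add (.var 8) (.num 1)))
    (.seq (assign 10 (.sub (.add (.var 0) (.num 1)) (.mul (.num 2) (.var 9))))
    (.seq (.while 10 windowBody)
    (.seq (assign 8 (.var 15))
    (.seq (assign 9 (.mul (.num 2) (.var 9))) moreLevels)))))

/-- Store the fingerprint of the whole string, the number of levels and the base. -/
def finish : Prog :=
  .seq (put 1 (.num 0) (.add (.mul (.get 1 (.cell (.var 8) (.num 0) (.sub (.var 5) (.num 1))))
      (.var 5)) (.get 1 (.cell (.var 8) (.sub (.var 0) (.var 9)) (.sub (.var 5) (.num 1))))))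
    (.seq (put 1 (.num 1) (.add (.var 8) (.num 1))) (put 1 (.num 2) (.var 5)))

/-- Compute the base of the table and the divisor of the hash function. -/
def setup (p : Prog) : Prog :=
  .seq (assign 4 (.mul (.num 4) (.mul (.var 0) (.var 3))))
    (.seq (assign 4 (.mul (.var 4) (.var 4)))
    (.seq (assign 4 (.mul (.var 4) (.var 4)))
    (.seq (assign 5 (.add (.var 4) (.num 4)))
    (.seq (assign 6 (.div (.wrap .sub (.num 0) (.num 1)) (.var 4)))
    (.seq (assign 7 (.add (.var 1) (.var 2))) p)))))

/-- The preprocessing. -/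
def preprocess : Prog :=
  setup (.seq firstLevel (.seq (assign 8 (.num 0)) (.seq (assign 9 (.num 1)) (.seq moreLevels
    (.seq (.while 16 nextLevel) finish)))))

/-- The state between two levels of the preprocessing. -/
structure LevelState (n l U D K : ℕ) (f : ℕ → ℕ) (H : ℕ → ℕ → ℕ) (j : ℕ) (h : Config) : Prop
    extends PreBase n l U D K f h where
  level : h.reg 8 = j
  width : h.reg 9 = 2 ^ j
  more : h.reg 16 = if 2 * 2 ^ j < n + 1 then 1 else 0
  pos : h.pos = j
  table : IsTable U K l H (Entered n j 0) (h.mem 1)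

/-! ### Correctness and running time of the preprocessing. -/

section levels

variable {w n k l σ U D : ℕ} {ω : Tape w} {f : ℕ → ℕ} {H : ℕ → ℕ → ℕ}

theorem tri_firstLevel (S : Sizes w n k l σ U D) (hf : ∀ x, f x ≤ σ)
    (hH : ∀ x, H 0 x = f x + 1) {h : Config} (hb : PreBase n l U D (k + l) f h) (hp : h.pos = 0)
    (h1 : h.mem 1 = fun _ => 0) :
    Tri w ω firstLevel h (n * 71 + 10) fun h' => PreBase n l U D (k + l) f h' ∧ h'.pos = 0 ∧
      IsTable U (k + l) l H (Entered n 0 0) (h'.mem 1) := by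
  have := S.word_pos
  have := S.base_lt
  have := S.base
  let Inv : ℕ → Config → Prop := fun m h' => m ≤ n ∧ PreBase n l U D (k + l) f h' ∧
    h'.reg 15 = 0 ∧ h'.reg 10 = m ∧ h'.pos = 0 ∧ IsTable U (k + l) l H (Entered n 0 m) (h'.mem 1)
  refine (Tri.assign_seq ?_ ?_ ?_ ?_ (Tri.assign_seq ?_ ?_ ?_ ?_ ((Tri.loop (T := 70) ?_
    Inv ?_ ?_ ?_ n ?_).mono le_rfl fun h' hi => ⟨hi.2.1, hi.2.2.2.2.1, hi.2.2.2.2.2⟩))).mono ?_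
    fun _ => id
  · norm_num
  · simp [Exp.Low]
  · simp [Exp.Fits]
  · simp [Exp.val]
  · norm_num
  · simp [Exp.Low]
  · simp [Exp.Fits, Config.setReg, hb.reg_n]; omega
  · simp [Exp.val, Config.setReg, hb.reg_n]; omega
  · norm_num
  · exact fun h hi => hi.2.2.2.1
  · exact fun m h hi => by rw [hi.2.2.2.1]; omega
  · rintro m h ⟨g1, g2, g3, g4, g5, g6⟩
    exact (tri_letterBody S hf hH g2 g3 g4 g1 g5 g6).mono le_rfl
      fun h' hh => ⟨by omega, hh⟩
  · refine ⟨le_rfl, ?_, ?_, ?_, ?_, ?_⟩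
    · constructor <;> simp [Config.setReg, hb.reg_n, hb.reg_l, hb.reg_U, hb.reg_D, hb.reg_K, hb.mem_f]
    · simp [Config.setReg, Exp.val]
    · simp [Config.setReg, Exp.val, hb.reg_n]
    · simp [Config.setReg, hp]
    · simp only [Config.setReg, h1]
      refine IsTable.empty fun j x hx => ?_
      have : 0 < 2 ^ j := by positivity
      have := hx.1
      have := hx.2
      omega
  · simp only [Exp.cost]; omega

theorem tri_moreLevels (S : Sizes w n k l σ U D) {h : Config} {j : ℕ} (hn : h.reg 0 = n)
    (h9 : h.reg 9 = 2 ^ j) (hj : 2 ^ j ≤ n) {Q : Config → Prop}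
    (hQ : Q (h.setReg 16 (if 2 * 2 ^ j < n + 1 then 1 else 0))) : Tri w ω moreLevels h 12 Q := by
  have := S.word_pos
  have := S.base_lt
  have := S.base
  refine (Tri.assign (Q := Q) ?_ ?_ ?_ ?_ ?_).mono ?_ fun _ => id
  · norm_num
  · simp [Exp.Low]
  · simp [Exp.Fits, Exp.val, WordOp.Fits, hn, h9]
    and_intros <;> omega
  · simp only [Exp.val, WordOp.nat, hn, h9]
    split_ifs <;> omega
  · simpa only [Exp.val, WordOp.nat, hn, h9] using hQ
  · simp [Exp.cost]

theorem tri_nextLevel (S : Sizes w n k l σ U D) (hf : ∀ x, f x ≤ σ)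
    (hH : H = fingerprint (2 ^ w) U D (tapeWords ω) f) {j : ℕ} (hj : 2 ^ (j + 1) ≤ n) {h : Config}
    (hb : LevelState n l U D (k + l) f H j h) :
    Tri w ω nextLevel h (n * 151 + 50) (LevelState n l U D (k + l) f H (j + 1)) := by
  have := S.word_pos
  have := S.base_lt
  have := S.base
  have hj2 : j + 1 < 2 ^ (j + 1) := Nat.lt_two_pow_self
  have h2 : 2 ^ (j + 1) = 2 * 2 ^ j := by ring
  let Inv : ℕ → Config → Prop := fun m h' => m + 2 ^ (j + 1) ≤ n + 1 ∧
    PreBase n l U D (k + l) f h' ∧ h'.reg 8 = j ∧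
      h'.reg 9 = 2 ^ j ∧ h'.reg 12 = ω j ∧ h'.reg 15 = j + 1 ∧
      h'.reg 10 = m ∧ h'.pos = j + 1 ∧
      IsTable U (k + l) l H (Entered n (j + 1) m) (h'.mem 1)
  -- Since `h.pos = j`, the word drawn is `ω j`, independently of the string: this is what makes the
  -- two runs use the same hash function.
  refine (Tri.seq (R := fun h' => h' = { h.setReg 12 (ω h.pos) with pos := h.pos + 1 })
    (Tri.rand rfl) ?_ (T' := n * 151 + 49)).mono (by omega) fun _ => id
  rintro h' rfl
  refine (Tri.assign_seq ?_ ?_ ?_ ?_ (Tri.assign_seq ?_ ?_ ?_ ?_ (Tri.seq (Tri.loop (T := 150) ?_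
    Inv ?_ ?_ ?_ (n + 1 - 2 * 2 ^ j) ?_) ?_ (T' := 25)))).mono ?_ fun _ => id
  · norm_num
  · simp [Exp.Low]
  · simp [Exp.Fits, Exp.val, WordOp.Fits, Config.setReg, hb.level]; omega
  · simp [Exp.val, WordOp.nat, Config.setReg, hb.level]; omega
  · norm_num
  · simp [Exp.Low]
  · simp [Exp.Fits, Exp.val, WordOp.Fits, WordOp.nat, Config.setReg, hb.reg_n, hb.width]
    and_intros <;> omega
  · simp [Exp.val, WordOp.nat, Config.setReg, hb.reg_n, hb.width]; omega
  · norm_num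
  · exact fun h hi => hi.2.2.2.2.2.2.1
  · exact fun m h hi => by rw [hi.2.2.2.2.2.2.1]; omega
  · rintro m h ⟨g1, g2, g3, g4, g5, g6, g7, g8, g9⟩
    exact (tri_windowBody S hf hH g2 g3 g4 g5 g6 g7 (by omega) g8 g9).mono le_rfl
      fun h' hh => ⟨by omega, hh⟩
  · refine ⟨by omega, ?_, ?_, ?_, ?_, ?_, ?_, ?_, ?_⟩
    · constructor <;> simp [Config.setReg, hb.reg_n, hb.reg_l, hb.reg_U, hb.reg_D, hb.reg_K, hb.mem_f]
    · simp [Config.setReg, hb.level]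
    · simp [Config.setReg, hb.width]
    · simp [Config.setReg, hb.pos]
    · simp [Config.setReg, Exp.val, WordOp.nat, hb.level]
    · simp [Config.setReg, Exp.val, WordOp.nat, hb.reg_n, hb.width]
    · simp [Config.setReg, hb.pos]
    · refine hb.table.congr fun j' x' => ?_
      simp only [Entered]
      constructor
      · rintro ⟨g1, g2 | ⟨rfl, g2⟩⟩ <;> omega
      · rintro ⟨g1, g2 | ⟨rfl, g2⟩⟩ <;> omega
  · rintro h' ⟨g1, g2, g3, g4, g5, g6, g7, g8, g9⟩
    refine (Tri.assign_seq ?_ ?_ ?_ ?_ (Tri.assign_seq ?_ ?_ ?_ ?_ (tri_moreLevels (j := j + 1)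
      (Q := LevelState n l U D (k + l) f H (j + 1)) S ?_ ?_ hj ?_))).mono ?_ fun _ => id
    · norm_num
    · simp [Exp.Low]
    · simp [Exp.Fits, g6]; omega
    · simp [Exp.val, g6]; omega
    · norm_num
    · simp [Exp.Low]
    · simp [Exp.Fits, Exp.val, WordOp.Fits, Config.setReg, g4]
      and_intros <;> omega
    · simp [Exp.val, WordOp.nat, Config.setReg, g4]; omega
    · simp [Config.setReg, g2.reg_n]
    · simp [Config.setReg, Exp.val, WordOp.nat, g4, h2]
    · constructor
      · constructor <;> simp [Config.setReg, g2.reg_n, g2.reg_l, g2.reg_U, g2.reg_D, g2.reg_K, g2.mem_f]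
      · simp [Config.setReg, Exp.val, g6]
      · simp [Config.setReg, Exp.val, WordOp.nat, g4, h2]
      · simp [Config.setReg]
      · simp [Config.setReg, g8]
      · exact g9
    · simp [Exp.cost]
  · simp only [Exp.cost]
    have : (n + 1 - 2 * 2 ^ j) * 151 ≤ n * 151 := Nat.mul_le_mul_right _ (by
      have : 0 < 2 ^ j := by positivity
      omega)
    omega

/-- What the preprocessing leaves in array `1`. -/
structure IsOutput (U K l n : ℕ) (H : ℕ → ℕ → ℕ) (E : ℕ → ℕ) : Prop where
  table : IsTable U K l H (fun j x => j ≤ Nat.log 2 n ∧ x + 2 ^ j ≤ n) E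
  -- Two overlapping windows of maximal level, one at each end, cover the string, so this one number
  -- serves to test equality.
  whole : E 0 = H (Nat.log 2 n) 0 * U + H (Nat.log 2 n) (n - 2 ^ Nat.log 2 n)
  levels : E 1 = Nat.log 2 n + 1
  base : E 2 = U

theorem tri_finish (S : Sizes w n k l σ U D) (hf : ∀ x, f x ≤ σ)
    (hH : H = fingerprint (2 ^ w) U D (tapeWords ω) f) {h : Config}
    (hb : LevelState n l U D (k + l) f H (Nat.log 2 n) h) :
    Tri w ω finish h 70 fun h' => IsOutput U (k + l) l n H (h'.mem 1) := by
  have := S.word_pos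
  have := S.base_lt
  have hsq := S.sq_lt
  have := S.base
  have := S.one_le
  have := S.le
  have := S.le'
  have hle : ∀ j x, H j x + 2 ≤ U := fun j x => by rw [hH]; exact S.fingerprint_le hf _ _ _
  have hJ : 2 ^ Nat.log 2 n ≤ n := Nat.pow_log_le_self 2 (by omega)
  have hJ2 : Nat.log 2 n < 2 ^ Nat.log 2 n := Nat.lt_two_pow_self
  have hb1 := hle (Nat.log 2 n) 0
  have hb2 := hle (Nat.log 2 n) (n - 2 ^ Nat.log 2 n)
  have hpos : 0 < 2 ^ Nat.log 2 n := by positivity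
  have e1 : h.mem 1 (cell U (Nat.log 2 n) 0 (U - 1)) = H (Nat.log 2 n) 0 := by
    rw [hb.table.name _ _ (by omega), if_pos]; exact ⟨by omega, by omega⟩
  have e2 : h.mem 1 (cell U (Nat.log 2 n) (n - 2 ^ Nat.log 2 n) (U - 1)) =
      H (Nat.log 2 n) (n - 2 ^ Nat.log 2 n) := by
    rw [hb.table.name _ _ (by omega), if_pos]; exact ⟨by omega, by omega⟩
  have hUU : (H (Nat.log 2 n) 0 + 1) * U ≤ U * U := Nat.mul_le_mul_right _ (by omega)
  rw [add_mul] at hUU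
  obtain ⟨f1, v1⟩ := Exp.cell_spec (s := h) (j := .var 8) (x := .num 0)
    (h := .sub (.var 5) (.num 1)) (w := w) (U := U) hb.reg_U S.word
    (by simp only [Exp.Fits, hb.level]; omega)
    (by simp only [Exp.Fits]; omega)
    (by simp only [Exp.Fits, WordOp.Fits, Exp.val, hb.reg_U]; omega)
    (by simp only [Exp.val, hb.level]; omega) (by simp only [Exp.val]; omega)
    (by simp only [Exp.val, WordOp.nat, hb.reg_U]; omega)
  obtain ⟨f2, v2⟩ := Exp.cell_spec (s := h) (j := .var 8) (x := .sub (.var 0) (.var 9))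
    (h := .sub (.var 5) (.num 1)) (w := w) (U := U) hb.reg_U S.word
    (by simp only [Exp.Fits, hb.level]; omega)
    (by simp only [Exp.Fits, WordOp.Fits, Exp.val, hb.reg_n, hb.width]; omega)
    (by simp only [Exp.Fits, WordOp.Fits, Exp.val, hb.reg_U]; omega)
    (by simp only [Exp.val, hb.level]; omega)
    (by simp only [Exp.val, WordOp.nat, hb.reg_n, hb.width]; omega)
    (by simp only [Exp.val, WordOp.nat, hb.reg_U]; omega)
  simp only [Exp.val, WordOp.nat, hb.level, hb.reg_U] at v1
  simp only [Exp.val, WordOp.nat, hb.level, hb.reg_U, hb.reg_n, hb.width] at v2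
  refine (Tri.put_seq ?_ ?_ ?_ ?_ (Tri.put_seq ?_ ?_ ?_ ?_ (Tri.put
    (Q := fun h' => IsOutput U (k + l) l n H (h'.mem 1)) ?_ ?_ ?_ ?_ ?_))).mono ?_ fun _ => id
  · simp [Exp.Low]
  · simp [Exp.Low, Exp.cell]
  · simp [Exp.Fits]
  · refine ⟨⟨f1, ?_, ?_⟩, f2, ?_⟩
    · simp only [Exp.Fits, hb.reg_U]; omega
    · simp only [WordOp.Fits, Exp.val, v1, e1, hb.reg_U]; omega
    · simp only [WordOp.Fits, WordOp.nat, Exp.val, v1, e1, v2, e2, hb.reg_U]; omega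
  · simp [Exp.Low]
  · simp [Exp.Low]
  · simp [Exp.Fits]; omega
  · simp [Exp.Fits, Exp.val, WordOp.Fits, Config.setMem, hb.level]
    and_intros <;> omega
  · simp [Exp.Low]
  · simp [Exp.Low]
  · simp [Exp.Fits]; omega
  · simp [Exp.Fits, Config.setMem, hb.reg_U]; omega
  · constructor
    · simp only [Config.setMem, Function.update_self, Exp.val]
      refine (((hb.table.update_small (by omega)).update_small (by omega)).update_small
        (by omega)).congr fun j x => ?_
      simp only [Entered]
      omega
    · simp [Config.setMem, Exp.val, WordOp.nat, v1, v2, e1, e2, hb.reg_U]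
    · simp [Config.setMem, Exp.val, WordOp.nat, hb.level]
    · simp [Config.setMem, Exp.val, hb.reg_U]
  · simp [Exp.cost, Exp.cell]

end levels

/-- The base of the table. -/
def tableBase (n σ : ℕ) : ℕ :=
  -- A fourth power in `n` pays for the levels, the pairs of positions and the error `1 / n` in the
  -- union bound. The summand `4` makes room for the shift of the fingerprints and the reserved
  -- digit.
  4 * (n * σ) * (4 * (n * σ)) * (4 * (n * σ) * (4 * (n * σ))) + 4

/-- The divisor of the hash function. -/
def hashDiv (w n σ : ℕ) : ℕ :=
  (2 ^ w - 1) / (4 * (n * σ) * (4 * (n * σ)) * (4 * (n * σ) * (4 * (n * σ))))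

theorem tri_setup {w n k l σ : ℕ} (S : Sizes w n k l σ (tableBase n σ) (hashDiv w n σ))
    {ω : Tape w} {f : ℕ → ℕ} {h : Config} (h0 : h.reg 0 = n) (h1 : h.reg 1 = k) (h2 : h.reg 2 = l)
    (h3 : h.reg 3 = σ) (hm : h.mem 0 = f) {p : Prog} {T : ℕ} {Q : Config → Prop}
    (H : ∀ h', PreBase n l (tableBase n σ) (hashDiv w n σ) (k + l) f h' → h'.mem = h.mem →
      h'.pos = h.pos → Tri w ω p h' T Q) : Tri w ω (setup p) h (60 + T) Q := by
  have := S.word_pos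
  have := S.base_lt
  have := S.base
  have := S.one_le
  have := S.le
  have := S.le'
  have hm1 : 1 < 2 ^ w := by omega
  set t := 4 * (n * σ) with ht
  have hU : tableBase n σ = t * t * (t * t) + 4 := rfl
  have ht1 : t ≤ t * t := Nat.le_mul_self _
  have ht2 : t * t ≤ t * t * (t * t) := Nat.le_mul_self _
  have hD : hashDiv w n σ = (2 ^ w - 1) / (t * t * (t * t)) := rfl
  have hDlt := S.div_lt
  -- The program is not told `w`; wrapping `0 - 1` around yields `2 ^ w - 1`.
  have hev : WordOp.eval w .sub 0 1 = 2 ^ w - 1 := by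
    simp only [WordOp.eval, Nat.mod_eq_of_lt hm1, zero_add]
    exact Nat.mod_eq_of_lt (by omega)
  have hσ : n * σ ≤ t := by omega
  have hσ' : σ < 2 ^ w := by have := S.alphabet; omega
  refine (Tri.assign_seq ?_ ?_ ?_ ?_ (Tri.assign_seq ?_ ?_ ?_ ?_ (Tri.assign_seq ?_ ?_ ?_ ?_
    (Tri.assign_seq ?_ ?_ ?_ ?_ (Tri.assign_seq ?_ ?_ ?_ ?_ (Tri.assign_seq ?_ ?_ ?_ ?_
    (H _ ?_ ?_ ?_))))))).mono ?_ fun _ => id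
  all_goals try simp only [Exp.val, WordOp.nat, Config.setReg, h0, h3, ← ht,
    Function.update_self, Exp.Fits, WordOp.Fits]
  · norm_num
  · simp [Exp.Low]
  · and_intros <;> omega
  · omega
  · norm_num
  · simp [Exp.Low]
  · and_intros <;> omega
  · omega
  · norm_num
  · simp [Exp.Low]
  · and_intros <;> omega
  · omega
  · norm_num
  · simp [Exp.Low]
  · and_intros <;> omega
  · omega
  · norm_num
  · simp [Exp.Low]
  · simp [hev]; omega
  · simp [hev, ← hD, hDlt]
  · norm_num
  · simp [Exp.Low]
  · simp [h1, h2]; omega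
  · simp [h1, h2]; omega
  · constructor <;> simp [h0, h1, h2, hev, hU, hD, hm]
  · simp only [Exp.cost]; omega

/-- There are `Nat.log 2 n + 1` levels with at most `n` windows each, at constant cost per window.
The bound holds for every tape, so the expectation is immediate. -/
theorem exec_preprocess {w n k l σ : ℕ} (S : Sizes w n k l σ (tableBase n σ) (hashDiv w n σ))
    (ω : Tape w) (A : Fin n → Fin σ) :
    ∃ t s, Exec w ω preprocess (preInit k l A) t s ∧ t ≤ 1000 * n * (Nat.log 2 n + 1) ∧
      IsOutput (tableBase n σ) (k + l) l n (fingerprint (2 ^ w) (tableBase n σ) (hashDiv w n σ)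
        (tapeWords ω) (stringArray A)) (s.mem 1) := by
  have := S.word_pos
  have := S.base_lt
  have := S.base
  have := S.one_le
  have := S.le
  have := S.le'
  have hf : ∀ x, stringArray A x ≤ σ := by
    intro x
    unfold stringArray
    split_ifs with hx
    · exact (A ⟨x, hx⟩).2.le
    · omega
  set U := tableBase n σ with hU
  set D := hashDiv w n σ with hD
  set f := stringArray A with hfA
  set H := fingerprint (2 ^ w) U D (tapeWords ω) f with hH
  set J := Nat.log 2 n with hJ
  have hJn : 2 ^ J ≤ n := Nat.pow_log_le_self 2 (by omega)
  have hJn' : n < 2 ^ (J + 1) := Nat.lt_pow_succ_log_self (by omega) n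
  let Inv : ℕ → Config → Prop := fun m h => ∃ j, j + m = J ∧ LevelState n l U D (k + l) f H j h
  have hmore : ∀ j, j < J → 2 ^ (j + 1) ≤ n := fun j hj =>
    (Nat.pow_le_pow_right (by omega) (by omega : j + 1 ≤ J)).trans hJn
  have key : Tri w ω preprocess (preInit k l A)
      (60 + (n * 71 + 10 + (3 + (3 + (12 + ((J * (n * 151 + 50 + 1) + 1) + 70))))))
      fun h' => IsOutput U (k + l) l n H (h'.mem 1) := by
    refine tri_setup S (f := f) rfl rfl rfl rfl rfl fun h hb hm hp => Tri.seq
      (tri_firstLevel (H := H) S hf (fun _ => rfl) hb hp (by rw [hm]; rfl)) ?_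
    rintro h ⟨hb, hp, ht⟩
    refine (Tri.assign_seq ?_ ?_ ?_ ?_ (Tri.assign_seq ?_ ?_ ?_ ?_ (Tri.seq
      (R := LevelState n l U D (k + l) f H 0)
      (tri_moreLevels (j := 0) S ?_ ?_ ?_ ?_) fun h hh => Tri.seq (T' := 70)
      (Tri.loop (T := n * 151 + 50) ?_ Inv ?_ ?_ ?_ J ⟨0, by omega, hh⟩) ?_))).mono ?_ fun _ => id
    · norm_num
    · simp [Exp.Low]
    · simp [Exp.Fits]
    · simp [Exp.val]
    · norm_num
    · simp [Exp.Low]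
    · simp [Exp.Fits]; omega
    · simp [Exp.val]; omega
    · simp [Config.setReg, hb.reg_n]
    · simp [Config.setReg, Exp.val]
    · simp; omega
    · constructor
      · constructor <;> simp [Config.setReg, hb.reg_n, hb.reg_l, hb.reg_U, hb.reg_D, hb.reg_K,
          hb.mem_f]
      · simp [Config.setReg, Exp.val]
      · simp [Config.setReg, Exp.val]
      · simp [Config.setReg]
      · simp [Config.setReg, hp]
      · exact ht
    · norm_num
    · rintro h ⟨j, hj, hh⟩
      obtain rfl : j = J := hj
      rw [hh.more, if_neg]
      rw [pow_succ] at hJn'; omega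
    · rintro m h ⟨j, hj, hh⟩
      have := hmore j (by omega)
      rw [pow_succ] at this
      rw [hh.more, if_pos (by omega)]
      omega
    · rintro m h ⟨j, hj, hh⟩
      exact (tri_nextLevel S hf hH (hmore j (by omega)) hh).mono le_rfl
        fun h' hh' => ⟨j + 1, by omega, hh'⟩
    · rintro h ⟨j, hj, hh⟩
      obtain rfl : j = J := hj
      exact tri_finish S hf hH hh
    · simp [Exp.cost]
  obtain ⟨t, s, h', he, ht, hs, hq⟩ := key (preInit k l A) ⟨fun _ _ => rfl, rfl, rfl⟩
  refine ⟨t, s, he, ht.trans ?_, by rwa [hs.2.1]⟩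
  have h1 : J * n ≥ J := Nat.le_mul_of_pos_right _ (by omega)
  have h2 : 1000 * n * (J + 1) = 1000 * (J * n) + 1000 * n := by ring
  have h3 : J * (n * 151 + 50 + 1) = 151 * (J * n) + 51 * J := by ring
  omega

/-! ### The query program -/

/-- The windows of length `2 ^ j` at `m` and at some position on the block `b` of diagonals have
the same fingerprint. -/
def Hit (n k l : ℕ) (H H' : ℕ → ℕ → ℕ) (j m b : ℕ) : Prop :=
  m + 2 ^ j ≤ n ∧ ∃ y, y + 2 ^ j ≤ n ∧
    ((y + (k + l)) / l = m / l + b ∨ (y + (k + l)) / l = m / l + b + 1) ∧ H' j y = H j m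

/-- Look for windows of level `r16` at position `r12` on block `r11`. -/
def scanBody : Prog :=
  .seq (assign 18 (.get 2 (.cell (.var 16) (.var 12) (.sub (.var 5) (.num 1)))))
    (.seq (assign 19 (.add
      (.get 3 (.cell (.var 16) (.add (.div (.var 12) (.var 2)) (.var 11)) (.var 18)))
      (.get 3 (.cell (.var 16) (.add (.div (.var 12) (.var 2)) (.add (.var 11) (.num 1)))
        (.var 18)))))
    (.seq (assign 14 (.max (.var 14) (.mul (.lt (.num 0) (.var 19)) (.var 17))))
    (.seq (assign 16 (.add (.var 16) (.num 1)))
    (.seq (assign 17 (.mul (.num 2) (.var 17)))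
      (assign 15 (.sub (.var 15) (.num 1)))))))

/-- Compute the jump from position `r12` on block `r11`. -/
def scan (p : Prog) : Prog :=
  .seq (assign 14 (.num 0)) (.seq (assign 15 (.var 8)) (.seq (assign 16 (.num 0))
    (.seq (assign 17 (.num 1)) (.seq (.while 15 scanBody) p))))

/-- The address of an entry of the array of front positions. -/
def frontCell (i b : Exp) : Exp := .add (.mul i (.var 5)) b

/-- Compute the front of round `r10 + 1` on block `r11`. -/
def blockBody : Prog :=
  .seq (assign 12 (.max (.max (.get 4 (frontCell (.var 10) (.sub (.var 11) (.num 1))))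
      (.get 4 (frontCell (.var 10) (.var 11))))
      (.get 4 (frontCell (.var 10) (.add (.var 11) (.num 1))))))
    (scan
      (.seq (assign 12 (.add (.add (.var 12) (.var 14)) (.num 1)))
      (.seq (put 4 (frontCell (.add (.var 10) (.num 1)) (.var 11)) (.var 12))
      (.seq (assign 20 (.max (.var 20) (.var 12)))
        (assign 11 (.sub (.var 11) (.num 1)))))))

/-- One round. -/
def roundBody : Prog :=
  .seq (assign 11 (.var 7)) (.seq (.while 11 blockBody)
    (.seq (assign 10 (.add (.var 10) (.num 1))) (assign 9 (.sub (.var 9) (.num 1)))))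

/-- The query. -/
def query : Prog :=
  .seq (assign 5 (.get 2 (.num 2)))
    (.seq (assign 8 (.get 2 (.num 1)))
    (.seq (assign 7 (.add (.div (.mul (.num 2) (.var 1)) (.var 2)) (.num 1)))
    (.seq (assign 9 (.var 1))
    (.seq (.while 9 roundBody)
      (assign 0 (.max (.bin .eq (.get 2 (.num 0)) (.get 3 (.num 0)))
        (.lt (.var 0) (.add (.var 20) (.num 1)))))))))

theorem query_deterministic : query.Deterministic := by
  simp [query, roundBody, blockBody, scan, scanBody, Prog.Deterministic, assign_deterministic,
    put_deterministic]

/-- What stays fixed during the rounds of the query. -/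
structure QueryBase (n l U nb L : ℕ) (E E' : ℕ → ℕ) (h : Config) : Prop where
  reg_n : h.reg 0 = n
  reg_l : h.reg 2 = l
  reg_U : h.reg 5 = U
  reg_nb : h.reg 7 = nb
  reg_L : h.reg 8 = L
  mem_E : h.mem 2 = E
  mem_E' : h.mem 3 = E'

theorem QueryBase.congr {n l U nb L : ℕ} {E E' : ℕ → ℕ} {h h' : Config}
    (hb : QueryBase n l U nb L E E' h) (hr : ∀ r < 9, h'.reg r = h.reg r)
    (h2 : h'.mem 2 = h.mem 2) (h3 : h'.mem 3 = h.mem 3) : QueryBase n l U nb L E E' h' := by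
  constructor
  · rw [hr _ (by omega), hb.reg_n]
  · rw [hr _ (by omega), hb.reg_l]
  · rw [hr _ (by omega), hb.reg_U]
  · rw [hr _ (by omega), hb.reg_nb]
  · rw [hr _ (by omega), hb.reg_L]
  · rw [h2, hb.mem_E]
  · rw [h3, hb.mem_E']

/-! ### Correctness and running time of the query. -/

section query

variable {w n k l σ U D nb : ℕ} {ω : Tape w} {H H' : ℕ → ℕ → ℕ} {E E' : ℕ → ℕ}

/-- Here the factor `l` is saved: two lookups, one for each block of positions that can contain a
partner of `m`, decide in constant time whether any of them matches. -/
theorem tri_scanBody (S : Sizes w n k l σ U D)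
    (hE : IsOutput U (k + l) l n H E) (hE' : IsOutput U (k + l) l n H' E')
    (hH : ∀ j x, 1 ≤ H j x ∧ H j x + 2 ≤ U) (hH' : ∀ j x, 1 ≤ H' j x ∧ H' j x + 2 ≤ U)
    {h : Config} (hb : QueryBase n l U nb (Nat.log 2 n + 1) E E' h) {j m b c : ℕ}
    (hj : j ≤ Nat.log 2 n) (hm : m ≤ 2 * n) (hb1 : 1 ≤ b) (hb2 : b ≤ 2 * n + 1)
    (h11 : h.reg 11 = b) (h12 : h.reg 12 = m)
    (h14 : h.reg 14 = jump (fun j => Hit n k l H H' j m b) j) (h15 : h.reg 15 = c + 1)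
    (hc : c ≤ n) (h16 : h.reg 16 = j) (h17 : h.reg 17 = 2 ^ j) :
    Tri w ω scanBody h 150 fun h' => h'.reg 14 = jump (fun j => Hit n k l H H' j m b) (j + 1) ∧
      h'.reg 15 = c ∧ h'.reg 16 = j + 1 ∧ h'.reg 17 = 2 ^ (j + 1) ∧ h'.mem = h.mem ∧
      ∀ r, r < 14 ∨ 19 < r → h'.reg r = h.reg r := by
  classical
  have := S.word_pos
  have := S.base_lt
  have := S.base
  have := S.one_le
  have := S.le
  have := S.le'
  have hJ2 : Nat.log 2 n < 2 ^ Nat.log 2 n := Nat.lt_two_pow_self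
  have hJn : 2 ^ Nat.log 2 n ≤ n := Nat.pow_log_le_self 2 (by omega)
  have hjn : 2 ^ j ≤ n := (Nat.pow_le_pow_right (by omega) hj).trans hJn
  have hml := Nat.div_le_self m l
  have hml0 := Nat.zero_le (m / l)
  -- For a window that sticks out of the string the table gives `0`. No fingerprint is `0`, so the
  -- marks looked up under it are absent and no hit is reported.
  set v := if j ≤ Nat.log 2 n ∧ m + 2 ^ j ≤ n then H j m else 0 with hv
  have hvU : v + 2 ≤ U := by
    rw [hv]; split_ifs
    · exact (hH j m).2
    · omega
  have e1 : E (cell U j m (U - 1)) = v := by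
    rw [hE.table.name j m (by omega), hv]; congr
  set d1 := E' (cell U j (m / l + b) v) with hd1
  set d2 := E' (cell U j (m / l + (b + 1)) v) with hd2
  have hd1' := hE'.table.mark j (m / l + b) v (by omega) (by omega) (by omega)
  have hd2' := hE'.table.mark j (m / l + (b + 1)) v (by omega) (by omega) (by omega)
  rw [← hd1] at hd1'
  rw [← hd2] at hd2'
  have hd1le : d1 ≤ 1 := by rw [hd1']; split_ifs <;> omega
  have hd2le : d2 ≤ 1 := by rw [hd2']; split_ifs <;> omega
  have hhit : 0 < d1 + d2 ↔ Hit n k l H H' j m b := by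
    by_cases hmj : m + 2 ^ j ≤ n
    · have hvH : v = H j m := by rw [hv, if_pos ⟨hj, hmj⟩]
      rw [hvH] at hd1' hd2'
      constructor
      · intro hpos
        by_cases hc1 : ∃ y, (j ≤ Nat.log 2 n ∧ y + 2 ^ j ≤ n) ∧ (y + (k + l)) / l = m / l + b ∧
            H' j y = H j m
        · obtain ⟨y, ⟨-, hy⟩, h1, h2⟩ := hc1
          exact ⟨hmj, y, hy, .inl h1, h2⟩
        · rw [if_neg hc1] at hd1'
          by_cases hc2 : ∃ y, (j ≤ Nat.log 2 n ∧ y + 2 ^ j ≤ n) ∧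
              (y + (k + l)) / l = m / l + (b + 1) ∧ H' j y = H j m
          · obtain ⟨y, ⟨-, hy⟩, h1, h2⟩ := hc2
            exact ⟨hmj, y, hy, .inr h1, h2⟩
          · rw [if_neg hc2] at hd2'; omega
      · rintro ⟨-, y, hy, h1 | h1, h2⟩
        · rw [if_pos ⟨y, ⟨hj, hy⟩, h1, h2⟩] at hd1'; omega
        · rw [if_pos ⟨y, ⟨hj, hy⟩, h1, h2⟩] at hd2'; omega
    · have hv0 : v = 0 := by rw [hv, if_neg fun h => hmj h.2]
      rw [hv0] at hd1' hd2'
      rw [if_neg (by rintro ⟨y, -, -, h⟩; have := (hH' j y).1; omega)] at hd1' hd2'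
      refine iff_of_false (by omega) fun hh => hmj hh.1
  have hjump : jump (fun j => Hit n k l H H' j m b) (j + 1) =
      max (h.reg 14) ((if 0 < d1 + d2 then 1 else 0) * 2 ^ j) := by
    rw [jump, h14]
    by_cases hh : Hit n k l H H' j m b
    · rw [if_pos hh, if_pos (hhit.2 hh), one_mul]
    · rw [if_neg hh, if_neg fun h => hh (hhit.1 h), zero_mul]
  have hjle : h.reg 14 ≤ n := by
    rw [h14]
    rcases jump_eq (hit := fun j => Hit n k l H H' j m b) j with h0 | ⟨i, hi, hh, he⟩
    · omega
    · rw [he]; have := hh.1; omega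
  have hjle' : (if 0 < d1 + d2 then 1 else 0) * 2 ^ j ≤ n := by split_ifs <;> omega
  clear_value v d1 d2
  obtain ⟨f1, v1⟩ := Exp.cell_spec (s := h) (j := .var 16) (x := .var 12)
    (h := .sub (.var 5) (.num 1)) (w := w) (U := U) hb.reg_U S.word
    (by simp only [Exp.Fits]; omega)
    (by simp only [Exp.Fits]; omega)
    (by simp only [Exp.Fits, WordOp.Fits, Exp.val, hb.reg_U]; omega)
    (by simp only [Exp.val]; omega) (by simp only [Exp.val]; omega)
    (by simp only [Exp.val, WordOp.nat, hb.reg_U]; omega)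
  simp only [Exp.val, WordOp.nat, h16, h12, hb.reg_U] at v1
  obtain ⟨f2, v2⟩ := Exp.cell_spec (s := h.setReg 18 v) (j := .var 16)
    (x := .add (.div (.var 12) (.var 2)) (.var 11))
    (h := .var 18) (w := w) (U := U) (by simpa [Config.setReg] using hb.reg_U) S.word
    (by simp [Exp.Fits, Config.setReg]; omega)
    (by simp [Exp.Fits, WordOp.Fits, WordOp.nat, Exp.val, Config.setReg, h12, h11, hb.reg_l]; omega)
    (by simp [Exp.Fits, Config.setReg]; omega)
    (by simp [Exp.val, Config.setReg]; omega)
    (by simp [WordOp.nat, Exp.val, Config.setReg, h12, h11, hb.reg_l]; omega)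
    (by simp [Exp.val, Config.setReg]; omega)
  obtain ⟨f3, v3⟩ := Exp.cell_spec (s := h.setReg 18 v) (j := .var 16)
    (x := .add (.div (.var 12) (.var 2)) (.add (.var 11) (.num 1)))
    (h := .var 18) (w := w) (U := U) (by simpa [Config.setReg] using hb.reg_U) S.word
    (by simp [Exp.Fits, Config.setReg]; omega)
    (by simp [Exp.Fits, WordOp.Fits, WordOp.nat, Exp.val, Config.setReg, h12, h11, hb.reg_l]
        and_intros <;> omega)
    (by simp [Exp.Fits, Config.setReg]; omega)
    (by simp [Exp.val, Config.setReg]; omega)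
    (by simp [WordOp.nat, Exp.val, Config.setReg, h12, h11, hb.reg_l]; omega)
    (by simp [Exp.val, Config.setReg]; omega)
  have v2' : E' ((Exp.cell (.var 16) (.add (.div (.var 12) (.var 2)) (.var 11)) (.var 18)).val w
      (h.setReg 18 v)) = d1 := by
    rw [v2, hd1]; simp [Exp.val, WordOp.nat, Config.setReg, h16, h12, h11, hb.reg_l]
  have v3' : E' ((Exp.cell (.var 16) (.add (.div (.var 12) (.var 2)) (.add (.var 11) (.num 1)))
      (.var 18)).val w (h.setReg 18 v)) = d2 := by
    rw [v3, hd2]; simp [Exp.val, WordOp.nat, Config.setReg, h16, h12, h11, hb.reg_l]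
  have hmem : ∀ (h : Config) x v, (h.setReg x v).mem = h.mem := fun _ _ _ => rfl
  have vv : (Exp.get 2 (.cell (.var 16) (.var 12) (.sub (.var 5) (.num 1)))).val w h = v := by
    rw [Exp.val_get, hb.mem_E, v1, e1]
  have vv2 : (Exp.add
      (.get 3 (.cell (.var 16) (.add (.div (.var 12) (.var 2)) (.var 11)) (.var 18)))
      (.get 3 (.cell (.var 16) (.add (.div (.var 12) (.var 2)) (.add (.var 11) (.num 1)))
        (.var 18)))).val w (h.setReg 18 v) = d1 + d2 := by
    rw [Exp.add, Exp.val, Exp.val_get, Exp.val_get, hmem, hb.mem_E', v2', v3', WordOp.nat]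
  refine (Tri.assign_seq ?_ ?_ ?_ ?_ (Tri.assign_seq ?_ ?_ ?_ ?_ (Tri.assign_seq ?_ ?_ ?_ ?_
    (Tri.assign_seq ?_ ?_ ?_ ?_ (Tri.assign_seq ?_ ?_ ?_ ?_ (Tri.assign
      (Q := fun h' => h'.reg 14 = jump (fun j => Hit n k l H H' j m b) (j + 1) ∧
      h'.reg 15 = c ∧ h'.reg 16 = j + 1 ∧ h'.reg 17 = 2 ^ (j + 1) ∧ h'.mem = h.mem ∧
      ∀ r, r < 14 ∨ 19 < r → h'.reg r = h.reg r) ?_ ?_ ?_ ?_ ?_)))))).mono ?_ fun _ => id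
  all_goals try simp only [vv, vv2]
  · norm_num
  · simp [Exp.Low, Exp.cell]
  · exact f1
  · omega
  · norm_num
  · simp [Exp.Low, Exp.cell]
  · refine ⟨f2, f3, ?_⟩
    simp only [WordOp.Fits, Exp.val_get, hmem, hb.mem_E', v2', v3']; omega
  · omega
  · norm_num
  · simp [Exp.Low]
  · simp [Exp.Fits, Exp.val, WordOp.Fits, WordOp.nat, Config.setReg, h17]
    and_intros <;> first | omega | (split_ifs <;> omega)
  · simp [Exp.val, WordOp.nat, Config.setReg, h17]
    and_intros <;> first | omega | (split_ifs <;> omega)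
  · norm_num
  · simp [Exp.Low]
  · simp [Exp.Fits, Exp.val, WordOp.Fits, Config.setReg, h16]
    and_intros <;> omega
  · simp [Exp.val, WordOp.nat, Config.setReg, h16]; omega
  · norm_num
  · simp [Exp.Low]
  · simp [Exp.Fits, Exp.val, WordOp.Fits, Config.setReg, h17]
    and_intros <;> omega
  · simp [Exp.val, WordOp.nat, Config.setReg, h17]; omega
  · norm_num
  · simp [Exp.Low]
  · simp [Exp.Fits, Exp.val, WordOp.Fits, Config.setReg, h15]
    and_intros <;> omega
  · simp [Exp.val, WordOp.nat, Config.setReg, h15]; omega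
  · refine ⟨?_, ?_, ?_, ?_, rfl, ?_⟩
    · rw [hjump]; simp [Exp.val, WordOp.nat, Config.setReg, h17]
    · simp [Exp.val, WordOp.nat, Config.setReg, h15]
    · simp [Exp.val, WordOp.nat, Config.setReg, h16]
    · simp [Exp.val, WordOp.nat, Config.setReg, h17]; ring
    · intro r hr
      simp [Config.setReg, show r ≠ 14 by omega, show r ≠ 15 by omega, show r ≠ 16 by omega,
        show r ≠ 17 by omega, show r ≠ 18 by omega, show r ≠ 19 by omega]
  · simp [Exp.cost, Exp.cell]

theorem tri_scan (S : Sizes w n k l σ U D)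
    (hE : IsOutput U (k + l) l n H E) (hE' : IsOutput U (k + l) l n H' E')
    (hH : ∀ j x, 1 ≤ H j x ∧ H j x + 2 ≤ U) (hH' : ∀ j x, 1 ≤ H' j x ∧ H' j x + 2 ≤ U)
    {h : Config} (hb : QueryBase n l U nb (Nat.log 2 n + 1) E E' h) {m b : ℕ}
    (hm : m ≤ 2 * n) (hb1 : 1 ≤ b) (hb2 : b ≤ 2 * n + 1)
    (h11 : h.reg 11 = b) (h12 : h.reg 12 = m) {p : Prog} {T : ℕ} {Q : Config → Prop}
    (hp : ∀ h', h'.reg 14 = jump (fun j => Hit n k l H H' j m b) (Nat.log 2 n + 1) →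
      h'.mem = h.mem → (∀ r, r < 14 ∨ 19 < r → h'.reg r = h.reg r) → Tri w ω p h' T Q) :
    Tri w ω (scan p) h ((Nat.log 2 n + 1) * 151 + 20 + T) Q := by
  have := S.word_pos
  have := S.base_lt
  have := S.base
  have := S.one_le
  have := S.le
  have := S.le'
  have hlog : Nat.log 2 n < n := Nat.log_lt_self _ (by omega)
  let Inv : ℕ → Config → Prop := fun c h' => c ≤ n ∧ h'.mem = h.mem ∧
    (∀ r, r < 14 ∨ 19 < r → h'.reg r = h.reg r) ∧ h'.reg 15 = c ∧
    ∃ j, j + c = Nat.log 2 n + 1 ∧ h'.reg 16 = j ∧ h'.reg 17 = 2 ^ j ∧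
      h'.reg 14 = jump (fun j => Hit n k l H H' j m b) j
  refine (Tri.assign_seq ?_ ?_ ?_ ?_ (Tri.assign_seq ?_ ?_ ?_ ?_ (Tri.assign_seq ?_ ?_ ?_ ?_
    (Tri.assign_seq ?_ ?_ ?_ ?_ (Tri.seq (T' := T) (Tri.loop (T := 150) ?_ Inv ?_ ?_ ?_
      (Nat.log 2 n + 1) ?_) ?_))))).mono ?_ fun _ => id
  · norm_num
  · simp [Exp.Low]
  · simp [Exp.Fits]
  · simp [Exp.val]
  · norm_num
  · simp [Exp.Low]
  · simp [Exp.Fits, Config.setReg, hb.reg_L]; omega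
  · simp [Exp.val, Config.setReg, hb.reg_L]; omega
  · norm_num
  · simp [Exp.Low]
  · simp [Exp.Fits]
  · simp [Exp.val]
  · norm_num
  · simp [Exp.Low]
  · simp [Exp.Fits]; omega
  · simp [Exp.val]; omega
  · norm_num
  · exact fun h hi => hi.2.2.2.1
  · exact fun c h hi => by rw [hi.2.2.2.1]; omega
  · rintro c h' ⟨g1, g2, g3, g4, j, g5, g6, g7, g8⟩
    refine (tri_scanBody (j := j) S hE hE' hH hH' (hb.congr (fun r hr => g3 r (by omega))
      (by rw [g2]) (by rw [g2])) (by omega) hm hb1 hb2 (by rw [g3 _ (by omega), h11])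
      (by rw [g3 _ (by omega), h12]) g8 g4 (by omega) g6 g7).mono le_rfl ?_
    rintro h'' ⟨e1, e2, e3, e4, e5, e6⟩
    exact ⟨by omega, e5.trans g2, fun r hr => (e6 r hr).trans (g3 r hr), e2, j + 1, by omega,
      e3, e4, e1⟩
  · refine ⟨by omega, rfl, ?_, ?_, 0, by omega, ?_, ?_, ?_⟩
    · intro r hr
      simp [Config.setReg, show r ≠ 14 by omega, show r ≠ 15 by omega, show r ≠ 16 by omega,
        show r ≠ 17 by omega]
    · simp [Config.setReg, Exp.val, hb.reg_L]
    · simp [Config.setReg, Exp.val]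
    · simp [Config.setReg, Exp.val]
    · simp [Config.setReg, Exp.val, jump]
  · rintro h' ⟨g1, g2, g3, g4, j, g5, g6, g7, g8⟩
    obtain rfl : j = Nat.log 2 n + 1 := g5
    exact hp h' g8 g2 g3
  · simp only [Exp.cost]; omega

/-- The state of the query while round `i + 1` is under way, the blocks above `b₀` being done. -/
structure RoundState (k nb U : ℕ) (F : ℕ → ℕ → ℕ) (i b₀ : ℕ) (h : Config) : Prop where
  round : h.reg 10 = i
  block : h.reg 11 = b₀
  front : ∀ i' b, b ≤ nb + 1 →
    h.mem 4 (i' * U + b) = if i' ≤ i ∨ i' = i + 1 ∧ b₀ < b then F i' b else 0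
  -- Register `20` holds the maximum of the fronts computed so far. That it is attained serves
  -- soundness; that it dominates the finished blocks of the current round serves completeness.
  best_mem : ∃ i' b, i' ≤ k ∧ b ≤ nb ∧ h.reg 20 = F i' b
  le_best : ∀ b, b₀ < b → b ≤ nb → F (i + 1) b ≤ h.reg 20

theorem tri_blockBody (S : Sizes w n k l σ U D) (hnb : nb ≤ 2 * n + 1)
    (hE : IsOutput U (k + l) l n H E) (hE' : IsOutput U (k + l) l n H' E')
    (hH : ∀ j x, 1 ≤ H j x ∧ H j x + 2 ≤ U) (hH' : ∀ j x, 1 ≤ H' j x ∧ H' j x + 2 ≤ U)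
    {F : ℕ → ℕ → ℕ} (hF : F = front (Hit n k l H H') nb (Nat.log 2 n + 1))
    {h : Config} (hb : QueryBase n l U nb (Nat.log 2 n + 1) E E' h) {i b c : ℕ} (hi : i + 1 ≤ k)
    (hbnb : b + 1 ≤ nb) (h9 : h.reg 9 = c) (hs : RoundState k nb U F i (b + 1) h) :
    Tri w ω blockBody h ((Nat.log 2 n + 1) * 151 + 170) fun h' =>
      QueryBase n l U nb (Nat.log 2 n + 1) E E' h' ∧ h'.reg 9 = c ∧
        RoundState k nb U F i b h' := by
  have := S.word_pos
  have := S.base_lt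
  have := S.base
  have := S.one_le
  have := S.le
  have := S.le'
  have hsq := S.sq_lt
  have hFle : ∀ i b, F i b ≤ n + i := fun i b => by
    rw [hF]; exact front_le (fun j m b hh => hh.1) i b
  have hiU : (i + 2) * U ≤ U * U := Nat.mul_le_mul_right _ (by omega)
  have hiU0 := Nat.zero_le (i * U)
  have hexp : (i + 2) * U = i * U + U + U := by ring
  have hexp1 : (i + 1) * U = i * U + U := by ring
  set m := bestNeighbor (F i) (b + 1) with hm
  have hmle : m ≤ n + i := by
    obtain ⟨b', hb', -⟩ := bestNeighbor_mem (F i) (b + 1)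
    rw [hm, hb']; exact hFle _ _
  have hsucc : F (i + 1) (b + 1) = m +
      jump (fun j => Hit n k l H H' j m (b + 1)) (Nat.log 2 n + 1) + 1 := by
    rw [hm, hF]; exact front_succ (by omega) hbnb
  have hsle := hFle (i + 1) (b + 1)
  have r1 : h.mem 4 (i * U + b) = F i b := by
    rw [hs.front _ _ (by omega), if_pos (by omega)]
  have r2 : h.mem 4 (i * U + (b + 1)) = F i (b + 1) := by
    rw [hs.front _ _ (by omega), if_pos (by omega)]
  have r3 : h.mem 4 (i * U + (b + 1 + 1)) = F i (b + 1 + 1) := by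
    rw [hs.front _ _ (by omega), if_pos (by omega)]
  have l1 := hFle i b
  have l2 := hFle i (b + 1)
  have l3 := hFle i (b + 1 + 1)
  obtain ⟨i₀, b₀, hi₀, hb₀, h20⟩ := hs.best_mem
  have h20le : h.reg 20 ≤ n + k := by rw [h20]; have := hFle i₀ b₀; omega
  have hmval : (Exp.max (.max (.get 4 (frontCell (.var 10) (.sub (.var 11) (.num 1))))
      (.get 4 (frontCell (.var 10) (.var 11))))
      (.get 4 (frontCell (.var 10) (.add (.var 11) (.num 1))))).val w h = m := by
    simp only [Exp.val, frontCell, WordOp.nat, hs.round, hs.block, hb.reg_U, Nat.add_sub_cancel,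
      r1, r2, r3]
    rw [hm, bestNeighbor, Nat.add_sub_cancel]
  refine (Tri.assign_seq ?_ ?_ ?_ ?_ (tri_scan (nb := nb) (m := m) (b := b + 1) (T := 100) S hE hE' hH hH'
    ?_ ?_ ?_ ?_ ?_ ?_ ?_)).mono ?_ fun _ => id
  · norm_num
  · simp [Exp.Low, frontCell]
  · simp only [Exp.Fits, Exp.val, WordOp.Fits, frontCell, WordOp.nat, hs.round, hs.block,
      hb.reg_U, Nat.add_sub_cancel, r2, r3]
    and_intros <;> omega
  · rw [hmval]; omega
  · exact hb.congr (fun r hr => by simp [Config.setReg, show r ≠ 12 by omega]) rfl rfl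
  · omega
  · omega
  · omega
  · simp [Config.setReg, hs.block]
  · simp [Config.setReg, hmval]
  · intro h' g1 g2 g3
    rw [hmval] at g2 g3
    have g3' : ∀ r, r < 12 ∨ r = 13 ∨ 19 < r → h'.reg r = h.reg r := fun r hr => by
      rw [g3 r (by omega)]; simp [Config.setReg, show r ≠ 12 by omega]
    have g12 : h'.reg 12 = m := by rw [g3 _ (by omega)]; simp [Config.setReg]
    have g10 : h'.reg 10 = i := by rw [g3' _ (by omega), hs.round]
    have g11 : h'.reg 11 = b + 1 := by rw [g3' _ (by omega), hs.block]
    have g5 : h'.reg 5 = U := by rw [g3' _ (by omega), hb.reg_U]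
    have g20 : h'.reg 20 = h.reg 20 := g3' _ (by omega)
    have hmem : h'.mem = h.mem := g2
    have hsum : m + h'.reg 14 + 1 = F (i + 1) (b + 1) := by rw [hsucc, g1]
    refine (Tri.assign_seq ?_ ?_ ?_ ?_ (Tri.put_seq ?_ ?_ ?_ ?_ (Tri.assign_seq ?_ ?_ ?_ ?_
      (Tri.assign (Q := fun h' => QueryBase n l U nb (Nat.log 2 n + 1) E E' h' ∧ h'.reg 9 = c ∧
        RoundState k nb U F i b h') ?_ ?_ ?_ ?_ ?_)))).mono ?_ fun _ => id
    all_goals try simp only [Exp.Fits, Exp.val, WordOp.Fits, frontCell, WordOp.nat, g12, hsum,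
      Config.setReg, Config.setMem, Function.update_self]
    · norm_num
    · simp [Exp.Low]
    · and_intros <;> omega
    · omega
    · simp [Exp.Low]
    · simp [Exp.Low]
    · simp [g10, g5, g11]
      and_intros <;> omega
    · omega
    · norm_num
    · simp [Exp.Low]
    · simp [g20]
      and_intros <;> omega
    · simp [g20]
      and_intros <;> omega
    · norm_num
    · simp [Exp.Low]
    · simp [g11]
      and_intros <;> omega
    · simp [g11]; omega
    · refine ⟨hb.congr ?_ ?_ ?_, ?_, ?_⟩
      · intro r hr
        simp [show r ≠ 12 by omega, show r ≠ 20 by omega, show r ≠ 11 by omega,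
          g3' r (by omega)]
      · simp [hmem]
      · simp [hmem]
      · simp [g3' 9 (by omega), h9]
      · constructor
        · simp [g10]
        · simp [g11]
        · intro i' b' hb'
          simp only [Function.update_self, ne_eq, Nat.reduceEqDiff,
            not_false_eq_true, Function.update_of_ne, g10, g5, g11, hmem, Function.update_apply]
          by_cases he : i' * U + b' = (i + 1) * U + (b + 1)
          · obtain ⟨rfl, rfl⟩ := mul_add_inj_of_lt (by omega) (by omega) he
            simp
          · have hne : ¬ (i' = i + 1 ∧ b' = b + 1) := by rintro ⟨rfl, rfl⟩; exact he rfl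
            have := hs.front i' b' hb'
            simp only [he, if_false]
            rw [this]
            congr 1
            apply propext
            omega
        · simp only [ne_eq, Nat.reduceEqDiff, not_false_eq_true, Function.update_of_ne,
            Function.update_self, g20]
          rcases max_choice (h.reg 20) (F (i + 1) (b + 1)) with hc | hc
          · exact ⟨i₀, b₀, hi₀, hb₀, by rw [hc, h20]⟩
          · exact ⟨i + 1, b + 1, hi, hbnb, by rw [hc]⟩
        · intro b' h1 h2
          simp only [ne_eq, Nat.reduceEqDiff, not_false_eq_true, Function.update_of_ne,
            Function.update_self, g20]
          rcases Nat.lt_or_ge (b + 1) b' with h3 | h3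
          · exact (hs.le_best b' h3 h2).trans (le_max_left _ _)
          · obtain rfl : b' = b + 1 := by omega
            exact le_max_right _ _
    · simp [Exp.cost]
  · simp only [Exp.cost, frontCell]; omega

/-- The state of the query after `i` rounds. -/
structure RoundsDone (k nb U : ℕ) (F : ℕ → ℕ → ℕ) (i : ℕ) (h : Config) : Prop where
  round : h.reg 10 = i
  front : ∀ i' b, b ≤ nb + 1 → h.mem 4 (i' * U + b) = if i' ≤ i then F i' b else 0
  best_mem : ∃ i' b, i' ≤ k ∧ b ≤ nb ∧ h.reg 20 = F i' b
  le_best : ∀ b, 1 ≤ b → b ≤ nb → F i b ≤ h.reg 20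

theorem tri_roundBody (S : Sizes w n k l σ U D) (hnb : nb ≤ 2 * n + 1)
    (hE : IsOutput U (k + l) l n H E) (hE' : IsOutput U (k + l) l n H' E')
    (hH : ∀ j x, 1 ≤ H j x ∧ H j x + 2 ≤ U) (hH' : ∀ j x, 1 ≤ H' j x ∧ H' j x + 2 ≤ U)
    {F : ℕ → ℕ → ℕ} (hF : F = front (Hit n k l H H') nb (Nat.log 2 n + 1))
    {h : Config} (hb : QueryBase n l U nb (Nat.log 2 n + 1) E E' h) {i c : ℕ} (hi : i + 1 ≤ k)
    (h9 : h.reg 9 = c + 1) (hc : c ≤ n) (hs : RoundsDone k nb U F i h) :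
    Tri w ω roundBody h (nb * ((Nat.log 2 n + 1) * 151 + 171) + 30) fun h' =>
      QueryBase n l U nb (Nat.log 2 n + 1) E E' h' ∧ h'.reg 9 = c ∧
        RoundsDone k nb U F (i + 1) h' := by
  have := S.word_pos
  have := S.base_lt
  have := S.base
  have := S.le'
  have hF0 : ∀ i b, ¬ (1 ≤ b ∧ b ≤ nb) → F i b = 0 := fun i b hn => by
    rw [hF]; exact front_of_not hn
  let Inv : ℕ → Config → Prop := fun b h' => b ≤ nb ∧
    QueryBase n l U nb (Nat.log 2 n + 1) E E' h' ∧ h'.reg 9 = c + 1 ∧ RoundState k nb U F i b h'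
  refine (Tri.assign_seq ?_ ?_ ?_ ?_ (Tri.seq (T' := 20)
    (Tri.loop (T := (Nat.log 2 n + 1) * 151 + 170) ?_ Inv ?_ ?_ ?_ nb ?_) ?_)).mono ?_ fun _ => id
  · norm_num
  · simp [Exp.Low]
  · simp [Exp.Fits, hb.reg_nb]; omega
  · simp [Exp.val, hb.reg_nb]; omega
  · norm_num
  · exact fun h hh => hh.2.2.2.block
  · exact fun m h hh => by rw [hh.2.2.2.block]; omega
  · rintro b h ⟨g1, g2, g3, g4⟩
    exact (tri_blockBody S hnb hE hE' hH hH' hF g2 hi g1 g3 g4).mono le_rfl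
      fun h' hh => ⟨by omega, hh⟩
  · refine ⟨le_rfl, hb.congr ?_ rfl rfl, ?_, ?_⟩
    · intro r hr
      simp [Config.setReg, show r ≠ 11 by omega]
    · simp [Config.setReg, h9]
    · constructor
      · simp [Config.setReg, hs.round]
      · simp [Config.setReg, Exp.val, hb.reg_nb]
      · intro i' b hb'
        simp only [Config.setReg]
        rw [hs.front i' b hb']
        by_cases h1 : i' ≤ i
        · simp [h1]
        -- The only entry concerned is the border block `nb + 1`: it is never written, and its
        -- initial `0` is its front.
        · simp only [h1, false_or, if_false]
          split_ifs with h2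
          · rw [hF0 _ _ (by omega)]
          · rfl
      · simpa [Config.setReg] using hs.best_mem
      · intro b h1 h2; omega
  · rintro h ⟨g1, g2, g3, g4⟩
    refine (Tri.assign_seq ?_ ?_ ?_ ?_ (Tri.assign (Q := fun h' =>
      QueryBase n l U nb (Nat.log 2 n + 1) E E' h' ∧ h'.reg 9 = c ∧
        RoundsDone k nb U F (i + 1) h') ?_ ?_ ?_ ?_ ?_)).mono ?_ fun _ => id
    · norm_num
    · simp [Exp.Low]
    · simp [Exp.Fits, Exp.val, WordOp.Fits, g4.round]
      and_intros <;> omega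
    · simp [Exp.val, WordOp.nat, g4.round]; omega
    · norm_num
    · simp [Exp.Low]
    · simp [Exp.Fits, Exp.val, WordOp.Fits, Config.setReg, g3]
      and_intros <;> omega
    · simp [Exp.val, WordOp.nat, Config.setReg, g3]; omega
    · refine ⟨g2.congr ?_ rfl rfl, ?_, ?_⟩
      · intro r hr
        simp [Config.setReg, show r ≠ 10 by omega, show r ≠ 9 by omega]
      · simp [Config.setReg, Exp.val, WordOp.nat, g3]
      · constructor
        · simp [Config.setReg, Exp.val, WordOp.nat, g4.round]
        · intro i' b hb'
          simp only [Config.setReg]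
          rw [g4.front i' b hb']
          by_cases h1 : i' ≤ i
          · simp [h1, show i' ≤ i + 1 by omega]
          · by_cases h2 : i' = i + 1
            · subst h2
              rcases Nat.eq_zero_or_pos b with rfl | h3
              · simp [hF0 (i + 1) 0 (by omega)]
              · simp [h3]
            · simp [h1, h2, show ¬ i' ≤ i + 1 by omega]
        · simpa [Config.setReg] using g4.best_mem
        · intro b h1 h2
          simpa [Config.setReg] using g4.le_best b h1 h2
    · simp [Exp.cost]
  · simp only [Exp.cost]
    rw [show (Nat.log 2 n + 1) * 151 + 170 + 1 = (Nat.log 2 n + 1) * 151 + 171 by omega]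
    omega

/-- The query halts, and its answer tells whether the fingerprints of the whole strings agree or
some front reaches the end. -/
theorem exec_query (S : Sizes w n k l σ U D) (hE : IsOutput U (k + l) l n H E)
    (hE' : IsOutput U (k + l) l n H' E') (hH : ∀ j x, 1 ≤ H j x ∧ H j x + 2 ≤ U)
    (hH' : ∀ j x, 1 ≤ H' j x ∧ H' j x + 2 ≤ U) (A B : Fin n → Fin σ)
    {F : ℕ → ℕ → ℕ} (hF : F = front (Hit n k l H H') (2 * k / l + 1) (Nat.log 2 n + 1)) :
    ∃ t s, Exec w ω query (queryInit k l A B E E') t s ∧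
      t ≤ k * ((2 * k / l + 1) * ((Nat.log 2 n + 1) * 151 + 171) + 31) + 60 ∧
      (s.reg 0 = 0 ∨ s.reg 0 = 1) ∧
      (s.reg 0 = 1 → E 0 = E' 0 ∨ ∃ i b, i ≤ k ∧ b ≤ 2 * k / l + 1 ∧ n ≤ F i b) ∧
      ((E 0 = E' 0 ∨ ∃ b, 1 ≤ b ∧ b ≤ 2 * k / l + 1 ∧ n ≤ F k b) → s.reg 0 = 1) := by
  have := S.word_pos
  have := S.base_lt
  have := S.base
  have := S.one_le
  have := S.le
  have := S.le'
  have hlog : Nat.log 2 n < n := Nat.log_lt_self _ (by omega)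
  have hnb : 2 * k / l + 1 ≤ 2 * n + 1 := by
    have := Nat.div_le_self (2 * k) l
    omega
  have hFle : ∀ i b, F i b ≤ n + i := fun i b => by
    rw [hF]; exact front_le (fun j m b hh => hh.1) i b
  have hdivle : 2 * k / l ≤ 2 * k := Nat.div_le_self _ _
  generalize hnbdef : 2 * k / l + 1 = nb at *
  let Inv : ℕ → Config → Prop := fun c h' => c ≤ n ∧ h'.reg 9 = c ∧
    QueryBase n l U nb (Nat.log 2 n + 1) E E' h' ∧ ∃ i, i + c = k ∧ RoundsDone k nb U F i h'
  let Q : Config → Prop := fun h' => (h'.reg 0 = 0 ∨ h'.reg 0 = 1) ∧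
      (h'.reg 0 = 1 → E 0 = E' 0 ∨ ∃ i b, i ≤ k ∧ b ≤ nb ∧ n ≤ F i b) ∧
      ((E 0 = E' 0 ∨ ∃ b, 1 ≤ b ∧ b ≤ nb ∧ n ≤ F k b) → h'.reg 0 = 1)
  have key : Tri w ω query (queryInit k l A B E E')
      (k * (nb * ((Nat.log 2 n + 1) * 151 + 171) + 31) + 60) Q := by
    refine (Tri.assign_seq ?_ ?_ ?_ ?_ (Tri.assign_seq ?_ ?_ ?_ ?_ (Tri.assign_seq ?_ ?_ ?_ ?_
      (Tri.assign_seq ?_ ?_ ?_ ?_ (Tri.seq (T' := 20)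
      (Tri.loop (T := nb * ((Nat.log 2 n + 1) * 151 + 171) + 30) ?_ Inv ?_ ?_ ?_ k ?_)
      ?_))))).mono ?_ fun _ => id
    all_goals try simp only [Exp.val, Exp.Fits, WordOp.nat, WordOp.Fits, Config.setReg, queryInit,
      hE.base, hE.levels]
    · norm_num
    · simp [Exp.Low]
    · omega
    · omega
    · norm_num
    · simp [Exp.Low]
    · omega
    · omega
    · norm_num
    · simp [Exp.Low]
    · simp [paramRegs]
      and_intros <;> omega
    · simp [paramRegs, hnbdef]; omega
    · norm_num
    · simp [Exp.Low]
    · simp [paramRegs]; omega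
    · simp [paramRegs]; omega
    · norm_num
    · exact fun h hh => hh.2.1
    · exact fun m h hh => by rw [hh.2.1]; omega
    · rintro c h ⟨g1, g2, g3, i, g4, g5⟩
      exact (tri_roundBody S hnb hE hE' hH hH' hF g3 (by omega) g2 (by omega) g5).mono le_rfl
        fun h' hh => ⟨by omega, hh.2.1, hh.1, i + 1, by omega, hh.2.2⟩
    · refine ⟨by omega, ?_, ?_, 0, by omega, ?_⟩
      · simp [paramRegs]
      · constructor <;> simp [paramRegs, hnbdef]
      · constructor
        · simp [paramRegs]
        · intro i' b hb
          simp only [Nat.le_zero_eq]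
          split_ifs with h0
          · rw [h0, hF]; rfl
          · rfl
        · refine ⟨0, 0, by omega, by omega, ?_⟩
          rw [hF]; simp [paramRegs, front]
        · intro b h1 h2
          rw [hF]; simp [front]
    · rintro h ⟨g1, g2, g3, i, g4, g5⟩
      obtain rfl : i = k := g4
      obtain ⟨i₀, b₀, hi₀, hb₀, h20⟩ := g5.best_mem
      have h20le : h.reg 20 ≤ n + i := by rw [h20]; have := hFle i₀ b₀; omega
      have hite : ∀ (p : Prop) [Decidable p], (if p then 1 else 0) < 2 ^ w := fun p _ => by
        split_ifs <;> omega
      refine (Tri.assign (Q := Q) ?_ ?_ ?_ ?_ ?_).mono ?_ fun _ => id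
      · norm_num
      · simp [Exp.Low]
      · simp [Exp.Fits, Exp.val, WordOp.Fits, WordOp.nat, g3.reg_n, hite]
        and_intros <;> omega
      · simp [Exp.val, WordOp.nat, hite]
        exact hite _
      · simp only [Q, Exp.val, WordOp.nat, g3.reg_n, g3.mem_E, g3.mem_E', Config.setReg,
          Function.update_self]
        by_cases c1 : E 0 = E' 0
        · rw [if_pos c1]
          have : max 1 (if n < h.reg 20 + 1 then 1 else 0) = 1 := by split_ifs <;> rfl
          rw [this]
          exact ⟨.inr rfl, fun _ => .inl c1, fun _ => rfl⟩
        · rw [if_neg c1]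
          by_cases c2 : n < h.reg 20 + 1
          · rw [if_pos c2]
            exact ⟨.inr rfl, fun _ => .inr ⟨i₀, b₀, hi₀, hb₀, by omega⟩, fun _ => rfl⟩
          · rw [if_neg c2]
            refine ⟨.inl rfl, fun h => absurd h (by norm_num), ?_⟩
            rintro (h1 | ⟨b, h1, h2, h3⟩)
            · exact absurd h1 c1
            · have := g5.le_best b h1 h2
              omega
      · simp [Exp.cost]
    · simp only [Exp.cost]
      rw [show nb * ((Nat.log 2 n + 1) * 151 + 171) + 30 + 1 =
        nb * ((Nat.log 2 n + 1) * 151 + 171) + 31 by omega]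
      omega
  obtain ⟨t, s, h', he, ht, hs, hq⟩ := key _ ⟨fun _ _ => rfl, rfl, rfl⟩
  refine ⟨t, s, he, ht, ?_⟩
  rw [hs.1 0 (by omega)]
  exact hq

end query

/-! ### The main theorem -/

/-- With `P = 2 ^ (Nat.size n + Nat.size σ)`, the number `4 * n * σ` is at most `P ^ 2`, so the base
is at most `P ^ 9` and its cube, which bounds all addresses, at most `P ^ 27`. Words of `32` times
the basic length exceed this. -/
theorem sizes_wordLength {n k l σ : ℕ} (hl : 1 ≤ l) (hlk : l ≤ k) (hkn : k ≤ n) (hσ : 1 ≤ σ) :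
    Sizes (wordLength 32 n σ) n k l σ (tableBase n σ) (hashDiv (wordLength 32 n σ) n σ) := by
  set W := 2 ^ wordLength 32 n σ with hW
  set t := 4 * (n * σ) with ht
  set P := 2 ^ (Nat.size n + Nat.size σ) with hP
  set Q := t * t * (t * t) with hQ
  have hU : tableBase n σ = Q + 4 := rfl
  have hDdef : hashDiv (wordLength 32 n σ) n σ = (W - 1) / Q := rfl
  have hWP : W = P ^ 32 := by rw [hW, hP, wordLength, ← pow_mul, mul_comm]
  have hn1 : n < 2 ^ Nat.size n := Nat.lt_size_self n
  have hσ1 : σ < 2 ^ Nat.size σ := Nat.lt_size_self σ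
  have hPn : n * σ < P := by
    rw [hP, pow_add]
    exact Nat.mul_lt_mul'' hn1 hσ1
  have hP4 : 4 ≤ P := by
    rw [hP, pow_add]
    exact Nat.mul_le_mul (show 2 ≤ 2 ^ Nat.size n by omega) (show 2 ≤ 2 ^ Nat.size σ by omega)
  have hnσ : n ≤ n * σ := Nat.le_mul_of_pos_right _ hσ
  have hσn : σ ≤ n * σ := Nat.le_mul_of_pos_left _ (by omega)
  have htt : t ≤ t * t := Nat.le_mul_self t
  have h16 : 4 * t ≤ t * t := Nat.mul_le_mul_right _ (by omega)
  have h256 : 16 * (t * t) ≤ Q := Nat.mul_le_mul_right _ (by nlinarith)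
  have htP : t ≤ P ^ 2 := by rw [ht]; nlinarith
  have hQP : Q ≤ P ^ 8 := by
    calc Q = t ^ 4 := by rw [hQ]; ring
      _ ≤ (P ^ 2) ^ 4 := Nat.pow_le_pow_left htP 4
      _ = P ^ 8 := by ring
  have hUP : Q + 4 ≤ P ^ 9 := by
    have h1 : P ^ 9 = P ^ 8 * P := by ring
    have h2 : P ^ 8 * 4 ≤ P ^ 8 * P := Nat.mul_le_mul_left _ hP4
    omega
  have hU3 : (Q + 4) ^ 3 < W := by
    rw [hWP]
    calc (Q + 4) ^ 3 ≤ (P ^ 9) ^ 3 := Nat.pow_le_pow_left hUP 3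
      _ = P ^ 27 := by ring
      _ < P ^ 32 := Nat.pow_lt_pow_right (by omega) (by norm_num)
  have hQQ : Q * Q < W - 1 := by
    have : Q * Q + 2 ≤ (Q + 4) ^ 3 := by ring_nf; omega
    omega
  have hQpos : 0 < Q := by omega
  have hDQ : Q ≤ (W - 1) / Q := (Nat.le_div_iff_mul_le hQpos).2 hQQ.le
  have hDle : (W - 1) / Q ≤ W - 1 := Nat.div_le_self _ _
  rw [hU, hDdef]
  refine ⟨hl, hlk, hkn, by omega, by omega, hU3, by omega, by omega, ?_⟩
  have hdm := Nat.div_add_mod (W - 1) Q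
  have hmod := Nat.mod_lt (W - 1) hQpos
  -- As the divisor `(W - 1) / Q` is at least `Q`, the remainder lost in forming it is smaller than
  -- the divisor, and dividing by it leads back to at most `Q`.
  have : (W - 1) / ((W - 1) / Q) < Q + 1 := by
    rw [Nat.div_lt_iff_lt_mul (by omega), add_mul, one_mul]
    omega
  show (W - 1) / ((W - 1) / Q) + 3 ≤ Q + 4
  omega

/-- The base is chosen with `256 * n ^ 4 ≤ Q < U`. Since `Q * D ≤ 2 ^ w` and `U ^ 3 < 2 ^ w`, both
`n ^ 4 * D` and `n ^ 4 * U ^ 2` are at most `2 ^ w / 256`. -/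
theorem hash_failure_le {n k l σ w : ℕ} (S : Sizes w n k l σ (tableBase n σ) (hashDiv w n σ))
    (hσ : 1 ≤ σ) :
    (Nat.log 2 n * n * n * (4 * hashDiv w n σ + 2 * (tableBase n σ * tableBase n σ))) * n ≤
      2 ^ w := by
  have h1 := S.one_le
  have h2 := S.le
  have h3 := S.le'
  have hlog : Nat.log 2 n ≤ n := Nat.log_le_self _ _
  have hword := S.word
  set U := tableBase n σ with hU
  set D := hashDiv w n σ with hD
  set t := 4 * (n * σ) with ht
  have hUt : U = t * t * (t * t) + 4 := rfl
  have hDdef : D = (2 ^ w - 1) / (t * t * (t * t)) := rfl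
  have hnt : 4 * n ≤ t := by
    rw [ht]; exact Nat.mul_le_mul_left _ (Nat.le_mul_of_pos_right _ hσ)
  have hn4 : 256 * n ^ 4 ≤ t * t * (t * t) := by
    calc 256 * n ^ 4 = (4 * n) * (4 * n) * ((4 * n) * (4 * n)) := by ring
      _ ≤ _ := by gcongr
  have hDQ : t * t * (t * t) * D ≤ 2 ^ w := by
    rw [hDdef]; exact (Nat.mul_div_le _ _).trans (Nat.sub_le _ _)
  generalize t * t * (t * t) = Q at *
  calc Nat.log 2 n * n * n * (4 * D + 2 * (U * U)) * n
      ≤ n * n * n * (4 * D + 2 * (U * U)) * n := by gcongr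
    _ = 4 * (n ^ 4 * D) + 2 * (n ^ 4 * (U * U)) := by ring
    _ ≤ 2 ^ w := by
      have e1 : 256 * n ^ 4 * D ≤ Q * D := Nat.mul_le_mul_right _ hn4
      have e2 : 256 * n ^ 4 * (U * U) ≤ U * (U * U) := Nat.mul_le_mul_right _ (by omega)
      have e3 : U ^ 3 = U * (U * U) := by ring
      rw [mul_assoc] at e1 e2
      omega

section strings

variable {n σ : ℕ} {A B : Fin n → Fin σ}

theorem stringArray_le (A : Fin n → Fin σ) (x : ℕ) : stringArray A x ≤ σ := by
  unfold stringArray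
  split_ifs with hx
  · exact (A ⟨x, hx⟩).2.le
  · omega

theorem getElem?_eq_iff {x y : ℕ} (hx : x < n) (hy : y < n) :
    (List.ofFn A)[x]? = (List.ofFn B)[y]? ↔ stringArray A x = stringArray B y := by
  simp [stringArray, hx, hy, Fin.ext_iff]

theorem eq_of_stringArray (h : ∀ x < n, stringArray A x = stringArray B x) : A = B := by
  funext x
  have := h x x.2
  simpa [stringArray, Fin.ext_iff] using this

end strings

/-- A front that reaches the end bounds the edit distance. -/
theorem editDist_le_of_front {n k l σ nb L i b : ℕ} {A B : Fin n → Fin σ}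
    {hit : ℕ → ℕ → ℕ → Prop} (hl : 1 ≤ l) (hlk : l ≤ k) (hnb : nb * l ≤ 2 * k + l)
    (hh : ∀ j m β, hit j m β → ∃ y, ((y + (k + l)) / l = m / l + β ∨
      (y + (k + l)) / l = m / l + β + 1) ∧
      ∀ t < 2 ^ j, (List.ofFn A)[m + t]? = (List.ofFn B)[y + t]?)
    (hi : i ≤ k) (hb : b ≤ nb) (hn : n ≤ front hit nb L i b) : editDist A B ≤ 12 * k * l := by
  have hbl : b * l ≤ 2 * k + 2 * l := by
    have := Nat.mul_le_mul_right l hb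
    omega
  have h := prefixED_front (nb := nb) (L := L) hl hnb hh i b hbl
  generalize front hit nb L i b = x at *
  -- The target prefix may still be up to `k + l` letters short; lengthening it past `n` gives a
  -- total of `2 * (k + l) + 8 * l * k`, at most `12 * k * l`.
  have h2 := h.of_le_right (y' := x + b * l) (by omega)
  obtain ⟨d, hd, hs⟩ := h2
  rw [List.take_of_length_le (by simpa using hn),
    List.take_of_length_le (by rw [List.length_ofFn]; exact hn.trans (Nat.le_add_right _ _))] at hs
  refine (editDist_le hs).trans (hd.trans ?_)
  have e1 : 8 * l * i ≤ 8 * l * k := Nat.mul_le_mul_left _ hi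
  have e2 : k ≤ k * l := Nat.le_mul_of_pos_right _ hl
  have e3 : l * k = k * l := mul_comm _ _
  have e4 : 8 * l * k = 8 * (k * l) := by ring
  have e5 : 12 * k * l = 12 * (k * l) := by ring
  omega

/-- Executions on a fixed tape are unique, so every halting run is the one constructed in
`exec_preprocess`. -/
theorem preOut_isOutput {w n k l σ : ℕ} (S : Sizes w n k l σ (tableBase n σ) (hashDiv w n σ))
    {ω : Tape w} {A : Fin n → Fin σ} {E : ℕ → ℕ} (h : PreOut w ω preprocess k l A E) :
    IsOutput (tableBase n σ) (k + l) l n (fingerprint (2 ^ w) (tableBase n σ) (hashDiv w n σ)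
      (tapeWords ω) (stringArray A)) E := by
  obtain ⟨t, s, he, rfl⟩ := h
  obtain ⟨t', s', he', -, ho⟩ := exec_preprocess S ω A
  rw [(he.unique he').2]
  exact ho

section answers

variable {w n k l σ : ℕ}

/-- The programs always halt, and the answer has the stated meaning in terms of the fingerprints. -/
theorem exists_answers (S : Sizes w n k l σ (tableBase n σ) (hashDiv w n σ)) (ω : Tape w)
    (A B : Fin n → Fin σ) {H H' : ℕ → ℕ → ℕ}
    (hH : H = fingerprint (2 ^ w) (tableBase n σ) (hashDiv w n σ) (tapeWords ω) (stringArray A))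
    (hH' : H' = fingerprint (2 ^ w) (tableBase n σ) (hashDiv w n σ) (tapeWords ω)
      (stringArray B)) :
    ∃ ans, Answers w ω preprocess query k l A B ans ∧ (ans = 0 ∨ ans = 1) ∧
      (ans = 1 → (H (Nat.log 2 n) 0 = H' (Nat.log 2 n) 0 ∧
        H (Nat.log 2 n) (n - 2 ^ Nat.log 2 n) = H' (Nat.log 2 n) (n - 2 ^ Nat.log 2 n)) ∨
        ∃ i b, i ≤ k ∧ b ≤ 2 * k / l + 1 ∧
          n ≤ front (Hit n k l H H') (2 * k / l + 1) (Nat.log 2 n + 1) i b) ∧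
      ((H = H' ∨ ∃ b, 1 ≤ b ∧ b ≤ 2 * k / l + 1 ∧
        n ≤ front (Hit n k l H H') (2 * k / l + 1) (Nat.log 2 n + 1) k b) → ans = 1) := by
  obtain ⟨tA, sA, eA, -, oA⟩ := exec_preprocess S ω A
  obtain ⟨tB, sB, eB, -, oB⟩ := exec_preprocess S ω B
  rw [← hH] at oA
  rw [← hH'] at oB
  have hb : ∀ j x, 1 ≤ H j x ∧ H j x + 2 ≤ tableBase n σ := fun j x => by
    rw [hH]; exact ⟨fingerprint_pos _ _, S.fingerprint_le (stringArray_le A) _ _ _⟩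
  have hb' : ∀ j x, 1 ≤ H' j x ∧ H' j x + 2 ≤ tableBase n σ := fun j x => by
    rw [hH']; exact ⟨fingerprint_pos _ _, S.fingerprint_le (stringArray_le B) _ _ _⟩
  obtain ⟨t, s, e, -, h01, h1, h2⟩ := exec_query (ω := ω) S oA oB hb hb' A B rfl
  refine ⟨s.reg 0, ⟨_, _, t, s, ⟨_, _, eA, rfl⟩, ⟨_, _, eB, rfl⟩, e, rfl⟩, h01, fun h => ?_,
    fun h => h2 ?_⟩
  · rcases h1 h with h | h
    · rw [oA.whole, oB.whole] at h
      refine .inl (mul_add_inj_of_lt ?_ ?_ h)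
      · have := (hb (Nat.log 2 n) (n - 2 ^ Nat.log 2 n)).2
        omega
      · have := (hb' (Nat.log 2 n) (n - 2 ^ Nat.log 2 n)).2
        omega
    · exact .inr h
  · rcases h with h | h
    · left; rw [oA.whole, oB.whole, h]
    · exact .inr h

/-- Strings that are close are always reported. -/
theorem answers_one (S : Sizes w n k l σ (tableBase n σ) (hashDiv w n σ)) (ω : Tape w)
    {A B : Fin n → Fin σ} (h : 3 * editDist A B * (Nat.log 2 n + 1) ≤ k) :
    Answers w ω preprocess query k l A B 1 := by
  have hl := S.one_le
  have hlk := S.le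
  have hkn := S.le'
  obtain ⟨ans, hans, -, -, h1⟩ := exists_answers S ω A B rfl rfl
  rw [h1 ?_] at hans
  · exact hans
  set e := editDist A B with he
  have hs := editScript_editDist A B
  rw [← he] at hs
  -- For equal strings the hypothesis puts no lower bound on `k`, which may be too small for even
  -- one run of `L` rounds. The comparison of whole strings takes care of this case.
  rcases Nat.eq_zero_or_pos e with h0 | hpos
  · left
    rw [h0] at hs
    rcases hs.eq_or_exists_edit with h2 | ⟨_, _, _, _, h2, -⟩
    · rw [List.ofFn_injective h2]
    · omega
  · right
    set L := Nat.log 2 n + 1 with hL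
    -- For `e ≥ 1` each of `e * L`, `e` and `L` is at most `e * L`; this is the factor `3` in the
    -- hypothesis.
    have hR : e * (L + 1) + L ≤ k := by
      have : L ≤ e * L := Nat.le_mul_of_pos_left _ hpos
      have : e ≤ e * L := Nat.le_mul_of_pos_right _ (by omega)
      rw [mul_assoc] at h
      rw [mul_add]; omega
    have hek : e ≤ k := by
      have : e ≤ e * (L + 1) := Nat.le_mul_of_pos_right _ (by omega)
      omega
    have hk := Nat.div_mul_le_self k l
    have hk' := Nat.lt_div_mul_add (a := k) hl
    have h2k := Nat.lt_div_mul_add (a := 2 * k) hl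
    have hkl := Nat.lt_div_mul_add (a := k + l) hl
    have hkl' := Nat.div_mul_le_self (k + l) l
    -- Position `0` is reached in every round, so the script may be followed from a late round,
    -- chosen so that the end is reached exactly in round `k`. The starting block `(k + l) / l`
    -- contains the main diagonal.
    obtain ⟨b, hb1, hb2, hb3⟩ := exists_le_front
      (hit := Hit n k l (fingerprint (2 ^ w) (tableBase n σ) (hashDiv w n σ) (tapeWords ω)
        (stringArray A)) (fingerprint (2 ^ w) (tableBase n σ) (hashDiv w n σ) (tapeWords ω)
        (stringArray B))) (nb := 2 * k / l + 1) (L := L) (n := n) (k := k)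
      (l := l) (a := List.ofFn A) (b := List.ofFn B) (p := 0) (q := 0)
      (i := k - (e * (L + 1) + L)) (β := (k + l) / l) hl
      (by simp only [add_mul, one_mul]; omega)
      (Nat.lt_pow_succ_log_self (by omega) n) (by simp) (by simp) (by
        intro j m y β _ hm hy hw hblk
        refine ⟨hm, y, hy, hblk, ?_⟩
        refine (fingerprint_congr fun t ht => ?_).symm
        exact (getElem?_eq_iff (by omega) (by omega)).1 (hw t ht)) e hs rfl rfl (by omega) (by omega)
      (by omega) (by omega) (by omega) (by omega) (Nat.zero_le _)
    refine ⟨b, hb1, hb2, ?_⟩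
    rwa [show k - (e * (L + 1) + L) + e * (L + 1) + L = k by omega] at hb3

/-- Strings that are far apart are reported unless a collision occurs. -/
theorem answers_zero (S : Sizes w n k l σ (tableBase n σ) (hashDiv w n σ)) (ω : Tape w)
    {A B : Fin n → Fin σ} (h : 12 * k * l < editDist A B)
    (hc : ∀ i < Nat.log 2 n, ∀ x < n, ∀ y < n, ¬ Collide (2 ^ w) (tableBase n σ) (hashDiv w n σ)
      (tapeWords ω) (stringArray A) (stringArray B) i x y) :
    Answers w ω preprocess query k l A B 0 := by
  have hl := S.one_le
  have hlk := S.le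
  have hkn := S.le'
  obtain ⟨ans, hans, h01, h1, -⟩ := exists_answers S ω A B rfl rfl
  rcases h01 with rfl | rfl
  · exact hans
  exfalso
  have hlt : ∀ (C : Fin n → Fin σ) i z, fingerprint (2 ^ w) (tableBase n σ) (hashDiv w n σ)
      (tapeWords ω) (stringArray C) i z < tableBase n σ := fun C i z => by
    have := S.fingerprint_le (stringArray_le C) (tapeWords ω) i z
    omega
  have hwin := fun {j x y : ℕ} => eq_of_fingerprint_eq (j := j) (x := x) (y := y) (hlt A) (hlt B) hc
  rcases h1 rfl with ⟨g1, g2⟩ | ⟨i, b, hi, hb, hn⟩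
  · have hJ : 2 ^ Nat.log 2 n ≤ n := Nat.pow_log_le_self 2 (by omega)
    have hJ' : n < 2 ^ (Nat.log 2 n + 1) := Nat.lt_pow_succ_log_self (by omega) n
    rw [pow_succ] at hJ'
    have w1 := hwin le_rfl (by omega) (by omega) g1
    have w2 := hwin le_rfl (by omega) (by omega) g2
    have : A = B := by
      refine eq_of_stringArray fun x hx => ?_
      by_cases hxJ : x < 2 ^ Nat.log 2 n
      · simpa using w1 x hxJ
      · have := w2 (x - (n - 2 ^ Nat.log 2 n)) (by omega)
        rwa [show n - 2 ^ Nat.log 2 n + (x - (n - 2 ^ Nat.log 2 n)) = x by omega] at this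
    rw [this, editDist_self] at h
    omega
  · refine absurd (editDist_le_of_front (A := A) (B := B) hl hlk ?_ ?_ hi hb hn) (not_le.2 h)
    · have := Nat.div_mul_le_self (2 * k) l
      rw [add_mul]; omega
    · rintro j m β ⟨hm, y, hy, hblk, hf⟩
      refine ⟨y, hblk, fun t ht => ?_⟩
      rw [getElem?_eq_iff (by omega) (by omega)]
      refine hwin ?_ hm hy hf.symm t ht
      exact Nat.le_log_of_pow_le (by omega) (by omega)

end answers

theorem le_polylog {C c n : ℕ} (hc : c ≤ C) (hC : 1 ≤ C) :
    c * (Nat.log 2 n + 1) ≤ polylog C n :=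
  Nat.mul_le_mul hc (Nat.le_self_pow (by omega) _)

/-- Since `l ≤ k`, the number of blocks times `l` is at most `3 * k`, and the lower order terms are
absorbed in `k ^ 2`; the constant is `3 * (151 + 171) + 31 + 60 = 1057`. -/
theorem query_time_le {n k l t : ℕ} (hl : 1 ≤ l) (hlk : l ≤ k)
    (ht : t ≤ k * ((2 * k / l + 1) * ((Nat.log 2 n + 1) * 151 + 171) + 31) + 60) :
    (t : ℝ) ≤ (polylog 2000 n : ℝ) * (k : ℝ) ^ 2 / (l : ℝ) := by
  have hl0 : (0 : ℝ) < l := by exact_mod_cast hl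
  rw [le_div_iff₀ hl0]
  have hp : 2000 * (Nat.log 2 n + 1) ≤ polylog 2000 n := le_polylog le_rfl (by norm_num)
  have key : t * l ≤ polylog 2000 n * k ^ 2 := by
    set x := Nat.log 2 n + 1 with hx
    have hx1 : 1 ≤ x := by omega
    have h1 : (2 * k / l + 1) * l ≤ 3 * k := by
      have := Nat.div_mul_le_self (2 * k) l
      rw [add_mul]; omega
    calc t * l ≤ (k * ((2 * k / l + 1) * (x * 151 + 171) + 31) + 60) * l :=
          Nat.mul_le_mul_right _ ht
      _ = k * (((2 * k / l + 1) * l) * (x * 151 + 171)) + 31 * k * l + 60 * l := by ring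
      _ ≤ k * ((3 * k) * (x * 151 + x * 171)) + 31 * k * k * x + 60 * (k * k * x) := by
          have e1 : l ≤ k * k * x := hlk.trans
            ((Nat.le_mul_of_pos_right k (by omega)).trans (Nat.le_mul_of_pos_right _ hx1))
          have e2 : 31 * k * l ≤ 31 * k * k * x :=
            (Nat.mul_le_mul_left _ hlk).trans (Nat.le_mul_of_pos_right _ hx1)
          have e3 : 171 ≤ x * 171 := Nat.le_mul_of_pos_left _ hx1
          gcongr
      _ = 1057 * x * k ^ 2 := by ring
      _ ≤ 2000 * x * k ^ 2 := by gcongr; norm_num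
      _ ≤ _ := Nat.mul_le_mul_right _ hp
  exact_mod_cast key

/-- Gap edit distance with two-sided preprocessing.  Answer `1` means SMALL, `0` means LARGE. -/
theorem mainTheorem5 :
    ∃ (c C : ℕ) (pre query : Prog), 1 ≤ c ∧ 1 ≤ C ∧ query.Deterministic ∧
      ∀ (n k l σ : ℕ), 1 ≤ l → l ≤ k → k ≤ n →
        -- each string is preprocessed in expected time `Õ(n k / l)`
        (∀ A : Fin n → Fin σ,
          ∫⁻ ω, runTime (wordLength c n σ) ω pre (preInit k l A) ∂(tapeLaw (wordLength c n σ)) ≤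
            (polylog C n : ℝ≥0∞) * n * k / l) ∧
        ∀ A B : Fin n → Fin σ,
          -- every query takes time `Õ(k ^ 2 / l)`
          (∀ (ω : Tape (wordLength c n σ)) (DA DB : ℕ → ℕ),
            PreOut (wordLength c n σ) ω pre k l A DA →
            PreOut (wordLength c n σ) ω pre k l B DB →
              ∃ t s, Exec (wordLength c n σ) ω query (queryInit k l A B DA DB) t s ∧
                (t : ℝ) ≤ (polylog C n : ℝ) * (k : ℝ) ^ 2 / (l : ℝ)) ∧
          -- close strings are reported SMALL
          ((editDist A B : ℝ) ≤ (k : ℝ) / (polylog C n : ℝ) →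
            1 - 1 / (n : ℝ≥0∞) ≤ tapeLaw (wordLength c n σ)
              {ω | Answers (wordLength c n σ) ω pre query k l A B 1}) ∧
          -- far strings are reported LARGE
          ((C : ℝ) * k * l ≤ (editDist A B : ℝ) →
            1 - 1 / (n : ℝ≥0∞) ≤ tapeLaw (wordLength c n σ)
              {ω | Answers (wordLength c n σ) ω pre query k l A B 0}) := by
  -- The constant `2000` dominates `1000` for the preprocessing, `1057` for the query, `3` for the
  -- number of rounds and `12` for the gap.
  refine ⟨32, 2000, preprocess, query, by norm_num, by norm_num, query_deterministic, ?_⟩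
  intro n k l σ hl hlk hkn
  have hσ : ∀ _ : Fin n → Fin σ, 1 ≤ σ := fun A => (A ⟨0, by omega⟩).pos
  have hprob : ∀ w, IsProbabilityMeasure (tapeLaw w) := fun w => by
    unfold tapeLaw; infer_instance
  have hpl : 2000 * (Nat.log 2 n + 1) ≤ polylog 2000 n := le_polylog le_rfl (by norm_num)
  refine ⟨fun A => ?_, fun A B => ?_⟩
  · have S := sizes_wordLength hl hlk hkn (hσ A)
    have hl0 : (l : ℝ≥0∞) ≠ 0 := by
      rw [Ne, Nat.cast_eq_zero]; omega
    have hbound : ∀ ω, runTime (wordLength 32 n σ) ω preprocess (preInit k l A) ≤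
        (polylog 2000 n : ℝ≥0∞) * n * k / l := by
      intro ω
      obtain ⟨t, s, he, ht, -⟩ := exec_preprocess S ω A
      refine (iInf_le_of_le t (iInf_le_of_le s (iInf_le _ he))).trans ?_
      rw [ENNReal.le_div_iff_mul_le (.inl hl0) (.inl (ENNReal.natCast_ne_top _))]
      have key : t * l ≤ polylog 2000 n * n * k := by
        refine Nat.mul_le_mul (ht.trans ?_) hlk
        calc 1000 * n * (Nat.log 2 n + 1) = 1000 * (Nat.log 2 n + 1) * n := by ring
          _ ≤ _ := Nat.mul_le_mul_right _ (by omega)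
      exact_mod_cast key
    refine (lintegral_mono hbound).trans ?_
    rw [lintegral_const, measure_univ, mul_one]
  · have hσ1 := hσ A
    have S := sizes_wordLength hl hlk hkn hσ1
    have hlt : ∀ (C : Fin n → Fin σ) (ω : Tape (wordLength 32 n σ)) i z,
        fingerprint (2 ^ wordLength 32 n σ) (tableBase n σ) (hashDiv (wordLength 32 n σ) n σ)
          (tapeWords ω) (stringArray C) i z < tableBase n σ := fun C ω i z => by
      have := S.fingerprint_le (stringArray_le C) (tapeWords ω) i z
      omega
    refine ⟨fun ω DA DB hA hB => ?_, fun h => ?_, fun h => ?_⟩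
    · obtain ⟨t, s, he, ht, -⟩ := exec_query (ω := ω) S (preOut_isOutput S hA)
        (preOut_isOutput S hB)
        (fun j x => ⟨fingerprint_pos _ _, S.fingerprint_le (stringArray_le A) _ _ _⟩)
        (fun j x => ⟨fingerprint_pos _ _, S.fingerprint_le (stringArray_le B) _ _ _⟩) A B rfl
      exact ⟨t, s, he, query_time_le hl hlk ht⟩
    -- The error is one-sided: close strings are reported on every tape.
    · have hall : {ω | Answers (wordLength 32 n σ) ω preprocess query k l A B 1} = Set.univ := by
        refine Set.eq_univ_of_forall fun ω => answers_one S ω ?_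
        have hpos : (0 : ℝ) < polylog 2000 n := by
          have : 0 < polylog 2000 n := by omega
          exact_mod_cast this
        rw [le_div_iff₀ hpos] at h
        have h' : editDist A B * polylog 2000 n ≤ k := by exact_mod_cast h
        refine le_trans ?_ h'
        rw [mul_assoc, mul_left_comm]
        exact Nat.mul_le_mul_left _ (by omega)
      rw [hall, measure_univ]
      exact tsub_le_self
    · have h' : 2000 * k * l ≤ editDist A B := by exact_mod_cast h
      have hkl : 0 < k * l := Nat.mul_pos (by omega) hl
      have hbad := tapeLaw_exists_collide_le (w := wordLength 32 n σ) S.pos (hlt A) (hlt B)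
        (Nat.log 2 n) n
      set bad : Set (Tape (wordLength 32 n σ)) := {ω | ¬ ∀ i < Nat.log 2 n, ∀ x < n, ∀ y < n,
        ¬ Collide (2 ^ wordLength 32 n σ) (tableBase n σ) (hashDiv (wordLength 32 n σ) n σ)
          (tapeWords ω) (stringArray A) (stringArray B) i x y} with hbaddef
      have hn0 : (n : ℝ≥0∞) ≠ 0 := by rw [Ne, Nat.cast_eq_zero]; omega
      have hbad' : tapeLaw (wordLength 32 n σ) bad ≤ 1 / (n : ℝ≥0∞) := by
        refine hbad.trans ?_
        rw [ENNReal.le_div_iff_mul_le (.inl hn0) (.inl (ENNReal.natCast_ne_top _)),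
          ← ENNReal.mul_div_right_comm]
        refine ENNReal.div_le_of_le_mul ?_
        rw [one_mul]
        exact_mod_cast hash_failure_le S hσ1
      rw [tsub_le_iff_right]
      -- The good event and the collisions cover all tapes, so subadditivity suffices and no event
      -- has to be measurable.
      calc (1 : ℝ≥0∞) = tapeLaw (wordLength 32 n σ) Set.univ := measure_univ.symm
        _ ≤ tapeLaw (wordLength 32 n σ)
            ({ω | Answers (wordLength 32 n σ) ω preprocess query k l A B 0} ∪ bad) := by
          refine measure_mono fun ω _ => ?_
          by_cases hω : ω ∈ bad
          · exact .inr hω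
          · refine .inl (answers_zero S ω ?_ ?_)
            · refine lt_of_lt_of_le ?_ h'
              rw [mul_assoc, mul_assoc]; omega
            · simpa [hbaddef] using hω
        _ ≤ _ := (measure_union_le _ _).trans (by gcongr)
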